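/- Consider a word RAM with word length $w \ge 1$ that has a read-only input memory, a constant number of registers and a read-write working memory of words (organized in a constant number of arrays, with arbitrary initial content), and on which addition, subtraction, multiplication, modulo, bit shifts, bitwise AND and OR (all on $w$-bit words), comparisons and memory accesses take one step each. The input is a rooted tree $T$ with node set $\{0,\dots,n-1\}$, given by its root and by an adjacency array in which the neighbors of each node are listed in arbitrary order, one number per word; if $N$ is the size of this input in bits, then $w \ge \log_2 N$. The height of a node $u$ is the number of edges of a longest path from $u$ to a leaf that is a descendant of $u$. A choice dictionary stores a subset $S$ of the universe $\{0,\dots,n-1\}$ and supports, in $O(1)$ time each, the operations add, remove and contains, the operation choice, which returns an arbitrary element of $S$ (and the value $n$ if $S=\emptyset$), and the (re-)initialization with $S=\emptyset$. There are fixed programs, independent of $T$ and $w$, that realize an iteration over all nodes of $T$ in order of their height through the following methods. - $\mathrm{init}(T)$ initializes the iterator and sets $h=0$. - $\mathrm{hasNext}$ returns true exactly if there are nodes of height $h$. - $\mathrm{next}$, which may be called if there are nodes of height $h$, returns a choice dictionary that contains exactly the nodes of height $h$, and increments $h$ by $1$. The returned choice dictionary may be used and modified through its operations until $\mathrm{next}$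 is called again; this does not affect the iteration. The iteration runs in linear time: $\mathrm{init}(T)$ takes $O(n)$ time, all calls of $\mathrm{next}$ together take $O(n)$ time, and every call of $\mathrm{hasNext}$ and of a dictionary operation takes $O(1)$ time. The whole working memory, registers and returned dictionary included, consists of $O(n)$ bits plus $O(1)$ words, i.e. of $O(n+w)$ bits, which is $O(n)$ bits if $w=O(n)$. All constants are absolute. -/

import Mathlib

/-! ### Word RAM

A word RAM with word length `w`. The machine has a read-only input memory, a constant number `r` of
registers, and a working memory that consists of a constant number `k` of arrays ("banks") of words.
Programs are uniform: they do not depend on `w`. -/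

namespace WordRAM

/-- Operands: a register, a literal (taken modulo `2 ^ w`), or the word length `w`. -/
inductive Operand (r : ℕ) : Type
  | reg (i : Fin r)
  | lit (m : ℕ)
  | width

/-- The binary word operations. -/
inductive BinOp : Type
  | add | sub | mul | mod | shl | shr | and | or

/-- The comparisons available in tests. -/
inductive Cmp : Type
  | eq | lt

/-- Programs over `r` registers and `k` memory banks. -/
inductive Prog (r k : ℕ) : Type
  | skip
  /-- `dst := a ∘ b` for a word operation `∘`. -/
  | op (dst : Fin r) (o : BinOp) (a b : Operand r)
  /-- `dst := mem[bank][addr]`. -/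
  | load (dst : Fin r) (bank : Fin k) (addr : Operand r)
  /-- `mem[bank][addr] := val`. -/
  | store (bank : Fin k) (addr val : Operand r)
  /-- `dst := input[addr]`. -/
  | read (dst : Fin r) (addr : Operand r)
  | seq (p q : Prog r k)
  | ite (c : Cmp) (a b : Operand r) (p q : Prog r k)
  | while (c : Cmp) (a b : Operand r) (p : Prog r k)

/-- Content of the registers and of the working memory. -/
structure State (r k w : ℕ) : Type where
  regs : Fin r → BitVec w
  mem : Fin k → BitVec w → BitVec w

variable {r k w : ℕ}

def State.setReg (σ : State r k w) (i : Fin r) (x : BitVec w) : State r k w :=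
  { σ with regs := Function.update σ.regs i x }

def State.setMem (σ : State r k w) (b : Fin k) (a x : BitVec w) : State r k w :=
  { σ with mem := Function.update σ.mem b (Function.update (σ.mem b) a x) }

def Operand.eval (σ : State r k w) : Operand r → BitVec w
  | .reg i => σ.regs i
  | .lit m => BitVec.ofNat w m
  | .width => BitVec.ofNat w w

def BinOp.eval : BinOp → BitVec w → BitVec w → BitVec w
  | .add, x, y => x + y
  | .sub, x, y => x - y
  | .mul, x, y => x * y
  | .mod, x, y => x % y
  | .shl, x, y => x <<< y
  | .shr, x, y => x >>> y
  | .and, x, y => x &&& y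
  | .or, x, y => x ||| y

/-- The outcome of a comparison of words, read as unsigned numbers. -/
def Cmp.Holds : Cmp → BitVec w → BitVec w → Prop
  | .eq, x, y => x = y
  | .lt, x, y => x.toNat < y.toNat

/-- `Exec inp B p σ σ' t`: with input memory `inp` and started in the state `σ`, the program `p` halts
in the state `σ'` after `t` steps, and it accesses only the first `B` words of every memory bank.
Every operation, memory access and test takes one step. A program that accesses a word outside of
the input memory or of the first `B` words of a bank gets stuck. -/
inductive Exec (inp : List (BitVec w)) (B : ℕ) :
    Prog r k → State r k w → State r k w → ℕ → Prop
  | skip (σ : State r k w) : Exec inp B .skip σ σ 1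
  | op (σ : State r k w) (dst : Fin r) (o : BinOp) (a b : Operand r) :
      Exec inp B (.op dst o a b) σ (σ.setReg dst (o.eval (a.eval σ) (b.eval σ))) 1
  | load (σ : State r k w) (dst : Fin r) (bank : Fin k) (addr : Operand r)
      (h : (addr.eval σ).toNat < B) :
      Exec inp B (.load dst bank addr) σ (σ.setReg dst (σ.mem bank (addr.eval σ))) 1
  | store (σ : State r k w) (bank : Fin k) (addr val : Operand r)
      (h : (addr.eval σ).toNat < B) :
      Exec inp B (.store bank addr val) σ (σ.setMem bank (addr.eval σ) (val.eval σ)) 1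
  | read (σ : State r k w) (dst : Fin r) (addr : Operand r) (x : BitVec w)
      (h : inp[(addr.eval σ).toNat]? = some x) :
      Exec inp B (.read dst addr) σ (σ.setReg dst x) 1
  | seq {σ σ₁ σ₂ : State r k w} {p q : Prog r k} {t₁ t₂ : ℕ}
      (h₁ : Exec inp B p σ σ₁ t₁) (h₂ : Exec inp B q σ₁ σ₂ t₂) :
      Exec inp B (.seq p q) σ σ₂ (t₁ + t₂)
  | ite_true {σ σ' : State r k w} {c : Cmp} {a b : Operand r} {p q : Prog r k} {t : ℕ}
      (hc : c.Holds (a.eval σ) (b.eval σ)) (h : Exec inp B p σ σ' t) :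
      Exec inp B (.ite c a b p q) σ σ' (t + 1)
  | ite_false {σ σ' : State r k w} {c : Cmp} {a b : Operand r} {p q : Prog r k} {t : ℕ}
      (hc : ¬ c.Holds (a.eval σ) (b.eval σ)) (h : Exec inp B q σ σ' t) :
      Exec inp B (.ite c a b p q) σ σ' (t + 1)
  | while_true {σ σ₁ σ₂ : State r k w} {c : Cmp} {a b : Operand r} {p : Prog r k} {t₁ t₂ : ℕ}
      (hc : c.Holds (a.eval σ) (b.eval σ)) (h₁ : Exec inp B p σ σ₁ t₁)
      (h₂ : Exec inp B (.while c a b p) σ₁ σ₂ t₂) :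
      Exec inp B (.while c a b p) σ σ₂ (t₁ + t₂ + 1)
  | while_false {σ : State r k w} {c : Cmp} {a b : Operand r} {p : Prog r k}
      (hc : ¬ c.Holds (a.eval σ) (b.eval σ)) :
      Exec inp B (.while c a b p) σ σ 1

end WordRAM

/-! ### Rooted trees -/

namespace RootedTree

variable {n : ℕ}

/-- `v` is a descendant of `u` (possibly `u` itself) in the tree `G` rooted at `root`: the path from
the root to `v` visits `u`. -/
def IsDesc (G : SimpleGraph (Fin n)) (root u v : Fin n) : Prop :=
  ∃ p : G.Walk root v, p.IsPath ∧ u ∈ p.support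

/-- A leaf has no descendants other than itself. -/
def IsLeaf (G : SimpleGraph (Fin n)) (root v : Fin n) : Prop :=
  ∀ x, IsDesc G root v x → x = v

open Classical in
/-- The height of `u`: the number of edges of a longest path from `u` down to a descendant leaf. -/
noncomputable def height (G : SimpleGraph (Fin n)) (root u : Fin n) : ℕ :=
  (Finset.univ.filter fun v => IsDesc G root u v ∧ IsLeaf G root v).sup fun v => G.dist u v

/-- `adj` lists the neighbors of every node of `G`, in an arbitrary order and without repetition. -/
def IsAdjacencyList (G : SimpleGraph (Fin n)) (adj : Fin n → List (Fin n)) : Prop :=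
  ∀ u, (adj u).Nodup ∧ ∀ v, v ∈ adj u ↔ G.Adj u v

/-- The adjacency array representation of a rooted tree: the number of nodes, the root, for every
`i ≤ n` the sum of the degrees of the nodes less than `i` (this is where the neighbors of node `i`
start in the last block), and finally the concatenation of the lists of neighbors. -/
def encode (root : Fin n) (adj : Fin n → List (Fin n)) : List ℕ :=
  [n, (root : ℕ)]
    ++ (List.range (n + 1)).map
        (fun i => (((List.finRange n).take i).map fun v => (adj v).length).sum)
    ++ (List.finRange n).flatMap (fun v => (adj v).map fun u => (u : ℕ))

/-- The input memory: one number of the representation per word. -/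
def inputWords (w : ℕ) (root : Fin n) (adj : Fin n → List (Fin n)) : List (BitVec w) :=
  (encode root adj).map (BitVec.ofNat w)

end RootedTree

/-! ### Iterators that return choice dictionaries -/

namespace HeightIterator

open WordRAM

/-- The calls that a client can make after the iterator has been initialized: the two methods of the
iterator, and the operations of the choice dictionary that the latest call of `next` has returned.
The call `clear` initializes that dictionary anew, as the empty subset of `{0, …, n - 1}`. -/
inductive Call (n : ℕ) : Type
  | hasNext
  | next
  | add (v : Fin n)
  | remove (v : Fin n)
  | contains (v : Fin n)
  | choice
  | clear
  deriving DecidableEq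

/-- What a client knows: the current height `h` of the iterator (that is, the number of calls of
`next` so far) and the set that is stored in the current choice dictionary. -/
structure View (n : ℕ) : Type where
  h : ℕ
  S : Finset (Fin n)

section Spec

variable {n : ℕ}

open Classical in
/-- The nodes of height `h`. -/
noncomputable def level (G : SimpleGraph (Fin n)) (root : Fin n) (h : ℕ) : Finset (Fin n) :=
  Finset.univ.filter fun v => RootedTree.height G root v = h

/-- The view of the client after a call. -/
noncomputable def View.after (G : SimpleGraph (Fin n)) (root : Fin n) (a : View n) :
    Call n → View n
  | .hasNext => a
  | .next => ⟨a.h + 1, level G root a.h⟩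
  | .add v => ⟨a.h, insert v a.S⟩
  | .remove v => ⟨a.h, a.S.erase v⟩
  | .contains _ => a
  | .choice => a
  | .clear => ⟨a.h, ∅⟩

/-- Calls that are permitted: `next` only if there are nodes of the current height, the operations of
the dictionary only after a dictionary has been returned. -/
def Permitted (G : SimpleGraph (Fin n)) (root : Fin n) (a : View n) : Call n → Prop
  | .hasNext => True
  | .next => (level G root a.h).Nonempty
  | _ => 0 < a.h

/-- Finite sequences of permitted calls. -/
def AllPermitted (G : SimpleGraph (Fin n)) (root : Fin n) : View n → List (Call n) → Prop
  | _, [] => True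
  | a, c :: cs => Permitted G root a c ∧ AllPermitted G root (a.after G root c) cs

/-- The correct answers to a call. Truth values are returned as `1` and `0`. The operation `choice`
returns an arbitrary element of the stored set, and `n`, which is not an element of the universe, if
this set is empty. -/
def CorrectAnswer (G : SimpleGraph (Fin n)) (root : Fin n) {w : ℕ} (a : View n) :
    Call n → BitVec w → Prop
  | .hasNext, x => ((level G root a.h).Nonempty ∧ x = BitVec.ofNat w 1) ∨
      (¬ (level G root a.h).Nonempty ∧ x = BitVec.ofNat w 0)
  | .contains v, x => (v ∈ a.S ∧ x = BitVec.ofNat w 1) ∨ (v ∉ a.S ∧ x = BitVec.ofNat w 0)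
  | .choice, x => (∃ v ∈ a.S, x = BitVec.ofNat w (v : ℕ)) ∨ (a.S = ∅ ∧ x = BitVec.ofNat w n)
  | _, _ => True

/-- A call together with the answer it got and the number of steps it took. -/
structure Event (n w : ℕ) : Type where
  call : Call n
  answer : BitVec w
  time : ℕ

/-- All answers in a sequence of events are correct. -/
def AllCorrect (G : SimpleGraph (Fin n)) (root : Fin n) {w : ℕ} : View n → List (Event n w) → Prop
  | _, [] => True
  | a, e :: es => CorrectAnswer G root a e.call e.answer ∧
      AllCorrect G root (a.after G root e.call) es

end Spec

/-- An implementation: one program for every operation, over common registers and a common working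
memory, with a register `arg` where the client puts the argument of a call and a register `res`
where the client finds the answer. -/
structure Impl : Type where
  r : ℕ
  k : ℕ
  arg : Fin r
  res : Fin r
  init : Prog r k
  hasNext : Prog r k
  next : Prog r k
  add : Prog r k
  remove : Prog r k
  contains : Prog r k
  choice : Prog r k
  clear : Prog r k

variable {n w : ℕ}

/-- The program that serves a call. -/
def Impl.prog (I : Impl) : Call n → Prog I.r I.k
  | .hasNext => I.hasNext
  | .next => I.next
  | .add _ => I.add
  | .remove _ => I.remove
  | .contains _ => I.contains
  | .choice => I.choice
  | .clear => I.clear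

/-- The client puts the argument of a call, if there is one, into the register `arg`. -/
def Impl.pass (I : Impl) (σ : State I.r I.k w) : Call n → State I.r I.k w
  | .add v => σ.setReg I.arg (BitVec.ofNat w (v : ℕ))
  | .remove v => σ.setReg I.arg (BitVec.ofNat w (v : ℕ))
  | .contains v => σ.setReg I.arg (BitVec.ofNat w (v : ℕ))
  | _ => σ

/-- `Session I inp B σ es`: in the state `σ`, the implementation can serve the calls of `es` one after
the other, and it does so with the answers and the numbers of steps recorded in `es`. -/
inductive Session (I : Impl) (inp : List (BitVec w)) (B : ℕ) :
    State I.r I.k w → List (Event n w) → Prop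
  | nil (σ : State I.r I.k w) : Session I inp B σ []
  | cons {σ σ' : State I.r I.k w} {c : Call n} {t : ℕ} {es : List (Event n w)}
      (h : Exec inp B (I.prog c) (I.pass σ c) σ' t) (hs : Session I inp B σ' es) :
      Session I inp B σ (⟨c, σ'.regs I.res, t⟩ :: es)

end HeightIterator

/-!
The nodes of height `h` are the leaves of the tree from which all nodes of smaller height have been
deleted, so the iteration deletes the leaves level by level. Every node keeps a counter of its
remaining children; when the counter of the parent of a deleted node is exhausted, the parent joins
the next level.

The space bound forces the counters to be stored in binary, each in as many bits as its node has
entries in the adjacency array, and at the place of these entries, so that no further index is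
needed: as there are `2 * n - 2` entries, the counters take `O(n)` bits altogether. A counter is
stored decremented by one, since a node without remaining children never needs it again. A
decrement takes amortized constant time; the potential counts the zeros among the bits of the
counters. Nor are parents stored: the parent of a node that is about to be deleted is its only
neighbor that has not been deleted yet, and is found by scanning the neighbors. This costs the
degree of the node, and the degrees add up to `2 * n - 2`.

All sets of nodes, and the bits of the counters, are choice dictionaries. A dictionary is a sequence
of `O(n / W)` words of `W = Θ(min w n)` bits, with a list of the nonzero words and of their
positions in that list, so that uninitialized memory does no harm and initialization takes constant
time. An element is chosen as the lowest one of a listed word. To find its position `j` in constant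
time, write `W = s * s` with `s` a power of two: the ones of `2 ^ (j + 1) - 1` at the multiples of
`s` are counted by reduction modulo `2 ^ s - 1`, which gives `j / s + 1`, and `j % s` is obtained
similarly.
-/

/-! ### Program logic with time credits -/

namespace WordRAM

variable {r k w : ℕ}

/-- Total correctness with time credits: a run of `p` from a state that is related by `R` to the
abstract state `a` and with `b` credits halts in a state related to some `a'`, pays one credit per
step, and leaves at least `b'` credits, where `Q a' b'`. Credits that are left over may pay for
later steps, which is how amortized bounds are expressed. -/
def Runs (inp : List (BitVec w)) (B : ℕ) {α : Type*} (R : State r k w → α → Prop) (p : Prog r k)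
    (a : α) (b : ℕ) (Q : α → ℕ → Prop) : Prop :=
  ∀ σ, R σ a → ∃ σ' t a' b', Exec inp B p σ σ' t ∧ R σ' a' ∧ t + b' ≤ b ∧ Q a' b'

/-- The outcome of a comparison of natural numbers. -/
def Cmp.HoldsNat : Cmp → ℕ → ℕ → Prop
  | .eq, x, y => x = y
  | .lt, x, y => x < y

theorem Cmp.holds_iff_holdsNat (c : Cmp) (x y : BitVec w) :
    c.Holds x y ↔ c.HoldsNat x.toNat y.toNat := by
  cases c
  · exact BitVec.toNat_inj.symm
  · exact Iff.rfl

namespace Runs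

variable {inp : List (BitVec w)} {B : ℕ} {α : Type*} {R : State r k w → α → Prop}
  {p q : Prog r k} {a a' : α} {b : ℕ} {Q Q' : α → ℕ → Prop} {c : Cmp} {x y : Operand r} {m n : ℕ}

theorem mono (h : Runs inp B R p a b Q) (hQ : ∀ a' b', Q a' b' → Q' a' b') :
    Runs inp B R p a b Q' := by
  intro σ hσ
  obtain ⟨σ', t, a', b', hp, hσ', ht, hab⟩ := h σ hσ
  exact ⟨σ', t, a', b', hp, hσ', ht, hQ _ _ hab⟩

theorem frame {Q : α → Prop} (h : Runs inp B R p a m fun a' _ => Q a') (hm : m ≤ b)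
    (hQ : ∀ a', Q a' → Q' a' (b - m)) : Runs inp B R p a b Q' := by
  intro σ hσ
  obtain ⟨σ', t, a', b', hp, hσ', ht, ha'⟩ := h σ hσ
  exact ⟨σ', t, a', b - m, hp, hσ', by lia, hQ _ ha'⟩

theorem of_exec_one (hb : 1 ≤ b) (h : ∀ σ, R σ a → ∃ σ', Exec inp B p σ σ' 1 ∧ R σ' a')
    (hQ : Q a' (b - 1)) : Runs inp B R p a b Q := by
  intro σ hσ
  obtain ⟨σ', hp, hσ'⟩ := h σ hσ
  exact ⟨σ', 1, a', b - 1, hp, hσ', by lia, hQ⟩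

theorem seq (h : Runs inp B R p a b fun a' b' => Runs inp B R q a' b' Q) :
    Runs inp B R (p.seq q) a b Q := by
  intro σ hσ
  obtain ⟨σ₁, t₁, a₁, b₁, hp, hσ₁, ht₁, hq⟩ := h σ hσ
  obtain ⟨σ₂, t₂, a₂, b₂, hq, hσ₂, ht₂, hQ⟩ := hq σ₁ hσ₁
  exact ⟨σ₂, _, a₂, b₂, .seq hp hq, hσ₂, by lia, hQ⟩

theorem ite (hx : ∀ σ, R σ a → (x.eval σ).toNat = m) (hy : ∀ σ, R σ a → (y.eval σ).toNat = n)
    (hb : 1 ≤ b) (hp : c.HoldsNat m n → Runs inp B R p a (b - 1) Q)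
    (hq : ¬ c.HoldsNat m n → Runs inp B R q a (b - 1) Q) :
    Runs inp B R (.ite c x y p q) a b Q := by
  intro σ hσ
  have hc : c.Holds (x.eval σ) (y.eval σ) ↔ c.HoldsNat m n := by
    rw [c.holds_iff_holdsNat, hx σ hσ, hy σ hσ]
  by_cases h : c.HoldsNat m n
  · obtain ⟨σ', t, a', b', hp, hσ', ht, hQ⟩ := hp h σ hσ
    exact ⟨σ', _, a', b', .ite_true (hc.2 h) hp, hσ', by lia, hQ⟩
  · obtain ⟨σ', t, a', b', hq, hσ', ht, hQ⟩ := hq h σ hσ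
    exact ⟨σ', _, a', b', .ite_false (mt hc.1 h) hq, hσ', by lia, hQ⟩

theorem loop {I : α → ℕ → Prop} {C : α → Prop}
    (hc : ∀ a b, I a b → ∀ σ, R σ a → (c.Holds (x.eval σ) (y.eval σ) ↔ C a))
    (hb : ∀ a b, I a b → 0 < b)
    (hp : ∀ a b, I a b → C a → Runs inp B R p a (b - 1) I) (ha : I a b) :
    Runs inp B R (.while c x y p) a b fun a' b' => I a' (b' + 1) ∧ ¬ C a' := by
  induction b using Nat.strong_induction_on generalizing a with | h b ih
  intro σ hσ
  have hpos := hb a b ha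
  by_cases h : C a
  · obtain ⟨σ₁, t₁, a₁, b₁, hrun₁, hσ₁, ht₁, ha₁⟩ := hp a b ha h σ hσ
    obtain ⟨σ₂, t₂, a₂, b₂, hrun₂, hσ₂, ht₂, ha₂⟩ := ih b₁ (by lia) ha₁ σ₁ hσ₁
    exact ⟨σ₂, _, a₂, b₂, .while_true ((hc a b ha σ hσ).2 h) hrun₁ hrun₂, hσ₂, by lia, ha₂⟩
  · refine ⟨σ, 1, a, b - 1, .while_false (mt (hc a b ha σ hσ).1 h), hσ, by lia, ?_, h⟩
    rwa [Nat.sub_add_cancel hpos]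

theorem iterate {I : ℕ → α → Prop} {i : ℕ}
    (hc : ∀ i a, I i a → ∀ σ, R σ a → (c.Holds (x.eval σ) (y.eval σ) ↔ i < n))
    (hp : ∀ i < n, ∀ a, I i a → Runs inp B R p a m fun a' _ => I (i + 1) a') (hi : i ≤ n)
    (ha : I i a) : Runs inp B R (.while c x y p) a ((m + 1) * (n - i) + 1) fun a' _ => I n a' := by
  induction hk : n - i generalizing i a with
  | zero =>
    obtain rfl : i = n := by lia
    exact fun σ hσ => ⟨σ, 1, a, 0, .while_false (by simp [hc i a ha σ hσ]), hσ, by lia, ha⟩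
  | succ k ih =>
    intro σ hσ
    obtain ⟨σ₁, t₁, a₁, b₁, hrun₁, hσ₁, ht₁, ha₁⟩ := hp i (by lia) a ha σ hσ
    obtain ⟨σ₂, t₂, a₂, b₂, hrun₂, hσ₂, ht₂, ha₂⟩ := ih (i := i + 1) (by lia) ha₁ (by lia) σ₁ hσ₁
    exact ⟨σ₂, _, a₂, 0, .while_true ((hc i a ha σ hσ).2 (by lia)) hrun₁ hrun₂, hσ₂, by lia, ha₂⟩

end Runs

/-- A machine state with numbers in place of words. -/
structure NatState (r k : ℕ) : Type where
  reg : Fin r → ℕ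
  mem : Fin k → ℕ → ℕ

namespace NatState

/-- Writes a register. -/
def setReg (ν : NatState r k) (i : Fin r) (x : ℕ) : NatState r k :=
  { ν with reg := Function.update ν.reg i x }

/-- Writes a memory cell. -/
def setMem (ν : NatState r k) (b : Fin k) (a x : ℕ) : NatState r k :=
  { ν with mem := Function.update ν.mem b (Function.update (ν.mem b) a x) }

variable (ν : NatState r k)

@[simp] theorem mem_setReg (i : Fin r) (x : ℕ) : (ν.setReg i x).mem = ν.mem := rfl

@[simp] theorem reg_setMem (b : Fin k) (a x : ℕ) : (ν.setMem b a x).reg = ν.reg := rfl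

@[simp] theorem reg_setReg_self (i : Fin r) (x : ℕ) : (ν.setReg i x).reg i = x :=
  Function.update_self ..

@[simp] theorem reg_setReg_of_ne {i j : Fin r} (h : j ≠ i) (x : ℕ) :
    (ν.setReg i x).reg j = ν.reg j :=
  Function.update_of_ne h ..

@[simp] theorem mem_setMem_self (b : Fin k) (a x : ℕ) :
    (ν.setMem b a x).mem b = Function.update (ν.mem b) a x :=
  Function.update_self ..

@[simp] theorem mem_setMem_of_ne {b b' : Fin k} (h : b' ≠ b) (a x : ℕ) :
    (ν.setMem b a x).mem b' = ν.mem b' :=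
  Function.update_of_ne h ..

end NatState

/-- The value of an operand in a state of numbers. -/
def Operand.val (w : ℕ) (ν : NatState r k) : Operand r → ℕ
  | .reg i => ν.reg i
  | .lit m => m
  | .width => w

/-- The literals fit into a word. -/
def Operand.Fits (w : ℕ) : Operand r → Prop
  | .lit m => m < 2 ^ w
  | _ => True

/-- The operations on numbers that the word operations compute modulo `2 ^ w`. -/
def BinOp.val : BinOp → ℕ → ℕ → ℕ
  | .add, x, y => x + y
  | .sub, x, y => x - y
  | .mul, x, y => x * y
  | .mod, x, y => x % y
  | .shl, x, y => x * 2 ^ y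
  | .shr, x, y => x / 2 ^ y
  | .and, x, y => x &&& y
  | .or, x, y => x ||| y

/-- The operation neither overflows nor underflows. -/
def BinOp.Fits (w : ℕ) : BinOp → ℕ → ℕ → Prop
  | .add, x, y => x + y < 2 ^ w
  | .sub, x, y => y ≤ x
  | .mul, x, y => x * y < 2 ^ w
  | .shl, x, y => x * 2 ^ y < 2 ^ w
  | _, _, _ => True

theorem BinOp.toNat_eval (o : BinOp) {x y : BitVec w} (h : o.Fits w x.toNat y.toNat) :
    (o.eval x y).toNat = o.val x.toNat y.toNat := by
  cases o
  case sub => exact BitVec.toNat_sub_of_le h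
  all_goals
    simp only [BinOp.Fits] at h
    simp [BinOp.eval, BinOp.val, Nat.shiftLeft_eq, Nat.shiftRight_eq_div_pow, Nat.mod_eq_of_lt, h]

/-- The words of `σ` have the values recorded in `ν`. -/
structure Represents (σ : State r k w) (ν : NatState r k) : Prop where
  reg : ∀ i, (σ.regs i).toNat = ν.reg i
  mem : ∀ b a, (σ.mem b a).toNat = ν.mem b a.toNat

namespace Represents

variable {σ : State r k w} {ν : NatState r k}

theorem toNat_eval (h : Represents σ ν) {o : Operand r} (ho : o.Fits w) :
    (o.eval σ).toNat = o.val w ν := by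
  cases o with
  | reg i => exact h.reg i
  | lit m => exact (BitVec.toNat_ofNat _ _).trans (Nat.mod_eq_of_lt ho)
  | width => exact (BitVec.toNat_ofNat _ _).trans (Nat.mod_eq_of_lt Nat.lt_two_pow_self)

theorem setReg (h : Represents σ ν) (i : Fin r) {x : BitVec w} {v : ℕ} (hx : x.toNat = v) :
    Represents (σ.setReg i x) (ν.setReg i v) := by
  refine ⟨fun j => ?_, h.mem⟩
  obtain rfl | hj := eq_or_ne j i
  · simpa [State.setReg] using hx
  · simpa [State.setReg, hj] using h.reg j

theorem setMem (h : Represents σ ν) (b : Fin k) {a x : BitVec w} {m v : ℕ} (ha : a.toNat = m)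
    (hx : x.toNat = v) : Represents (σ.setMem b a x) (ν.setMem b m v) := by
  subst ha
  refine ⟨h.reg, fun b' a' => ?_⟩
  obtain rfl | hb := eq_or_ne b' b
  · obtain rfl | ha := eq_or_ne a' a
    · simpa [State.setMem] using hx
    · simpa [State.setMem, ha, mt BitVec.toNat_inj.1 ha] using h.mem b' a'
  · simpa [State.setMem, hb] using h.mem b' a'

end Represents

/-- The weakest precondition of a program for the postcondition `Q`, computed by symbolic execution
on states of numbers. A loop has no such unfolding and is left to `Runs.loop` and
`Runs.iterate`. -/
def wp (inp : List (BitVec w)) (B : ℕ) :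
    Prog r k → NatState r k → ℕ → (NatState r k → ℕ → Prop) → Prop
  | .skip, ν, b, Q => 1 ≤ b ∧ Q ν (b - 1)
  | .op dst o x y, ν, b, Q => 1 ≤ b ∧ x.Fits w ∧ y.Fits w ∧ o.Fits w (x.val w ν) (y.val w ν) ∧
      Q (ν.setReg dst (o.val (x.val w ν) (y.val w ν))) (b - 1)
  | .load dst bank addr, ν, b, Q => 1 ≤ b ∧ addr.Fits w ∧ addr.val w ν < B ∧
      Q (ν.setReg dst (ν.mem bank (addr.val w ν))) (b - 1)
  | .store bank addr x, ν, b, Q => 1 ≤ b ∧ addr.Fits w ∧ x.Fits w ∧ addr.val w ν < B ∧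
      Q (ν.setMem bank (addr.val w ν) (x.val w ν)) (b - 1)
  | .read dst addr, ν, b, Q => 1 ≤ b ∧ addr.Fits w ∧
      ∃ x, (inp.map BitVec.toNat)[addr.val w ν]? = some x ∧ Q (ν.setReg dst x) (b - 1)
  | .seq p q, ν, b, Q => wp inp B p ν b fun ν' b' => wp inp B q ν' b' Q
  | .ite c x y p q, ν, b, Q => 1 ≤ b ∧ x.Fits w ∧ y.Fits w ∧
      (c.HoldsNat (x.val w ν) (y.val w ν) → wp inp B p ν (b - 1) Q) ∧
      (¬ c.HoldsNat (x.val w ν) (y.val w ν) → wp inp B q ν (b - 1) Q)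
  | .while c x y p, ν, b, Q => Runs inp B Represents (.while c x y p) ν b Q

theorem Runs.of_wp {inp : List (BitVec w)} {B : ℕ} {p : Prog r k} {ν : NatState r k} {b : ℕ}
    {Q : NatState r k → ℕ → Prop} (h : wp inp B p ν b Q) : Runs inp B Represents p ν b Q := by
  induction p generalizing ν b Q with
  | skip => exact .of_exec_one h.1 (fun σ hσ => ⟨σ, .skip σ, hσ⟩) h.2
  | op dst o x y =>
    obtain ⟨hb, hx, hy, ho, hQ⟩ := h
    refine .of_exec_one hb (fun σ hσ => ⟨_, .op σ dst o x y, hσ.setReg dst ?_⟩) hQ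
    rw [← hσ.toNat_eval hx, ← hσ.toNat_eval hy] at ho ⊢
    exact o.toNat_eval ho
  | load dst bank addr =>
    obtain ⟨hb, hx, ho, hQ⟩ := h
    refine .of_exec_one hb (fun σ hσ => ⟨_, .load σ dst bank addr ?_, hσ.setReg dst ?_⟩) hQ
    · rwa [hσ.toNat_eval hx]
    · rw [hσ.mem, hσ.toNat_eval hx]
  | store bank addr x =>
    obtain ⟨hb, hx, hy, ho, hQ⟩ := h
    refine .of_exec_one hb (fun σ hσ => ⟨_, .store σ bank addr x ?_,
      hσ.setMem bank (hσ.toNat_eval hx) (hσ.toNat_eval hy)⟩) hQ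
    rwa [hσ.toNat_eval hx]
  | read dst addr =>
    obtain ⟨hb, hx, v, hv, hQ⟩ := h
    rw [List.getElem?_map, Option.map_eq_some_iff] at hv
    obtain ⟨y, hy, rfl⟩ := hv
    refine .of_exec_one hb (fun σ hσ => ⟨_, .read σ dst addr y ?_, hσ.setReg dst rfl⟩) hQ
    rwa [hσ.toNat_eval hx]
  | seq p q ihp ihq => exact .seq ((ihp h).mono fun _ _ h' => ihq h')
  | ite c x y p q ihp ihq =>
    obtain ⟨hb, hx, hy, hp, hq⟩ := h
    exact .ite (fun σ hσ => hσ.toNat_eval hx) (fun σ hσ => hσ.toNat_eval hy) hb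
      (fun hc => ihp (hp hc)) (fun hc => ihq (hq hc))
  | _ => exact h

end WordRAM

/-! ### Bit tricks -/

namespace BitTricks

variable {s r m j x : ℕ}

/-- The number `∑ i < m, 2 ^ (i * s)`: `m` fields of `s` bits, each of which holds a one. -/
def repunit (s : ℕ) : ℕ → ℕ
  | 0 => 0
  | m + 1 => repunit s m * 2 ^ s + 1

theorem mul_repunit_lt {y : ℕ} (hy : y < 2 ^ s) (m : ℕ) : y * repunit s m < 2 ^ (m * s) := by
  induction m with
  | zero => simp [repunit]
  | succ m ih =>
    calc y * repunit s (m + 1) = y * repunit s m * 2 ^ s + y := by rw [repunit]; ring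
      _ < (y * repunit s m + 1) * 2 ^ s := by rw [add_one_mul]; gcongr
      _ ≤ 2 ^ (m * s) * 2 ^ s := by gcongr; exact ih
      _ = 2 ^ ((m + 1) * s) := by rw [← pow_add, add_one_mul]

theorem repunit_succ_lt (hs : 1 ≤ s) (m : ℕ) : repunit s (m + 1) < 2 ^ (m * s + 1) := by
  induction m with
  | zero => simp [repunit]
  | succ m ih =>
    have h2 : 1 < 2 ^ s := Nat.one_lt_two_pow (by lia)
    calc repunit s (m + 2) = repunit s (m + 1) * 2 ^ s + 1 := rfl
      _ < (repunit s (m + 1) + 1) * 2 ^ s := by lia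
      _ ≤ 2 ^ (m * s + 1) * 2 ^ s := by gcongr; exact ih
      _ = 2 ^ ((m + 1) * s + 1) := by rw [← pow_add]; ring_nf

theorem repunit_modEq (s m : ℕ) : repunit s m ≡ m [MOD 2 ^ s - 1] := by
  induction m with
  | zero => rfl
  | succ m ih =>
    have h : 2 ^ s ≡ 1 [MOD 2 ^ s - 1] :=
      ((Nat.modEq_iff_dvd' Nat.one_le_two_pow).2 dvd_rfl).symm
    simpa [repunit] using (ih.mul h).add_right 1

theorem repunit_mod (h : m < 2 ^ s - 1) : repunit s m % (2 ^ s - 1) = m :=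
  Eq.trans (repunit_modEq s m) (Nat.mod_eq_of_lt h)

theorem testBit_mul_repunit {y : ℕ} (hs : 1 ≤ s) (hy : y < 2 ^ s) (m p : ℕ) :
    (y * repunit s m).testBit p = (decide (p / s < m) && y.testBit (p % s)) := by
  induction m generalizing p with
  | zero => simp [repunit]
  | succ m ih =>
    have : y * repunit s (m + 1) = 2 ^ s * (y * repunit s m) + y := by rw [repunit]; ring
    rw [this, Nat.testBit_two_pow_mul_add _ hy]
    split_ifs with h
    · simp [Nat.div_eq_of_lt h, Nat.mod_eq_of_lt h]
    · rw [not_lt] at h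
      rw [ih, ← Nat.mod_eq_sub_mod h, Nat.div_eq_sub_div (by lia) h]
      simp

theorem testBit_repunit (hs : 1 ≤ s) (m p : ℕ) :
    (repunit s m).testBit p = decide (p / s < m ∧ p % s = 0) := by
  have := testBit_mul_repunit hs (y := 1) (Nat.one_lt_two_pow (by lia)) m p
  rw [← one_mul (repunit s m), this]
  cases p % s <;> simp [Nat.testBit_succ]

theorem ones_and_repunit (hs : 1 ≤ s) (hj : j < m * s) :
    (2 ^ (j + 1) - 1) &&& repunit s m = repunit s (j / s + 1) := by
  have hjm : j / s < m := (Nat.div_lt_iff_lt_mul (by lia)).2 hj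
  refine Nat.eq_of_testBit_eq fun p => ?_
  have hp : p % s = 0 → (p < j + 1 ↔ p / s < j / s + 1) := by
    intro hp
    rw [Nat.lt_succ_iff, Nat.lt_succ_iff, Nat.le_div_iff_mul_le (by lia),
      Nat.div_mul_cancel (Nat.dvd_of_mod_eq_zero hp)]
  rw [Nat.testBit_and, Nat.testBit_two_pow_sub_one, testBit_repunit hs, testBit_repunit hs,
    Bool.eq_iff_iff]
  simp only [Bool.and_eq_true, decide_eq_true_eq]
  grind

theorem ones_mul_repunit_and_repunit (hs : 1 ≤ s) (hr : r < s) :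
    ((2 ^ r - 1) * repunit s s) &&& repunit (s + 1) s = repunit (s + 1) r := by
  have hlt : 2 ^ r - 1 < 2 ^ s :=
    (Nat.sub_le _ _).trans_lt (Nat.pow_lt_pow_right (by norm_num) hr)
  refine Nat.eq_of_testBit_eq fun p => ?_
  -- The `i`-th field of length `s + 1` starts at the `i`-th bit of the `i`-th field of length `s`.
  have hp : p % (s + 1) = 0 → p / (s + 1) < s →
      p / s = p / (s + 1) ∧ p % s = p / (s + 1) := by
    intro h0 h1
    rw [Nat.div_mod_unique (by lia)]
    have := Nat.div_add_mod p (s + 1)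
    exact ⟨by linarith, h1⟩
  rw [Nat.testBit_and, testBit_mul_repunit hs hlt, testBit_repunit (by lia),
    testBit_repunit (by lia), Nat.testBit_two_pow_sub_one, Bool.eq_iff_iff]
  simp only [Bool.and_eq_true, decide_eq_true_eq]
  grind

theorem ones_and_repunit_mod (hs : 1 ≤ s) (hm : m < 2 ^ s - 1) (hj : j < m * s) :
    ((2 ^ (j + 1) - 1) &&& repunit s m) % (2 ^ s - 1) = j / s + 1 := by
  have hjm : j / s < m := (Nat.div_lt_iff_lt_mul (by lia)).2 hj
  rw [ones_and_repunit hs hj, repunit_mod (by lia)]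

theorem ones_mul_repunit_and_repunit_mod (hs : 1 ≤ s) (hr : r < s) :
    (((2 ^ r - 1) * repunit s s) &&& repunit (s + 1) s) % (2 ^ (s + 1) - 1) = r := by
  have : s < 2 ^ s := Nat.lt_two_pow_self
  rw [ones_mul_repunit_and_repunit hs hr, repunit_mod (by rw [pow_succ]; lia)]

theorem testBit_sub_two_pow (h : x.testBit j = true) (p : ℕ) :
    (x - 2 ^ j).testBit p = (x.testBit p && decide (p ≠ j)) := by
  induction j generalizing x p with
  | zero =>
    have hx : x % 2 = 1 := by simpa using h
    cases p with
    | zero => grind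
    | succ p =>
      have : (x - 1) / 2 = x / 2 := by lia
      simp [Nat.testBit_succ, this]
  | succ j ih =>
    rw [Nat.testBit_succ] at h
    have hj : 2 ^ j ≤ x / 2 := Nat.ge_two_pow_of_testBit h
    cases p with
    | zero =>
      have : (x - 2 ^ (j + 1)) % 2 = x % 2 := by rw [pow_succ]; lia
      simp [Nat.testBit_zero, this]
    | succ p =>
      have : (x - 2 ^ (j + 1)) / 2 = x / 2 - 2 ^ j := by rw [pow_succ]; lia
      rw [Nat.testBit_succ, Nat.testBit_succ, this, ih h]
      simp

theorem testBit_pred (h : x.testBit j = true) (hlow : ∀ i < j, x.testBit i = false) (p : ℕ) :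
    (x - 1).testBit p = if p < j then true else if p = j then false else x.testBit p := by
  induction j generalizing x p with
  | zero =>
    have := testBit_sub_two_pow h p
    grind
  | succ j ih =>
    have h0 : x % 2 = 0 := by simpa using hlow 0 (by lia)
    rw [Nat.testBit_succ] at h
    have hj : 2 ^ j ≤ x / 2 := Nat.ge_two_pow_of_testBit h
    have hpos : 0 < 2 ^ j := by positivity
    cases p with
    | zero =>
      have : (x - 1) % 2 = 1 := by lia
      simp [Nat.testBit_zero, this]
    | succ p =>
      have : (x - 1) / 2 = x / 2 - 1 := by lia
      rw [Nat.testBit_succ, Nat.testBit_succ, this,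
        ih h fun i hi => by rw [← Nat.testBit_succ]; exact hlow _ (by lia)]
      simp

theorem exists_testBit_sub_and_pred (hx : x ≠ 0) :
    ∃ j, x.testBit j = true ∧ x - (x &&& (x - 1)) = 2 ^ j := by
  have hex := Nat.exists_testBit_of_ne_zero hx
  obtain ⟨j, hj, hlow⟩ : ∃ j, x.testBit j = true ∧ ∀ i < j, x.testBit i = false :=
    ⟨Nat.find hex, Nat.find_spec hex, fun i hi => by simpa using Nat.find_min hex hi⟩
  have hand : x &&& (x - 1) = x - 2 ^ j := by
    refine Nat.eq_of_testBit_eq fun p => ?_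
    rw [Nat.testBit_and, testBit_pred hj hlow, testBit_sub_two_pow hj]
    grind
  exact ⟨j, hj, by rw [hand, Nat.sub_sub_self (Nat.ge_two_pow_of_testBit hj)]⟩

end BitTricks

/-! ### Sparse sequences of words in uninitialized memory -/

/-- A sequence `f` of words of `W` bits, all but the first `m` of which are zero, is stored in
uninitialized memory: `dense` lists the indices of the `c` nonzero words, `sparse` gives the
positions of these indices in the list, and `bits` the words themselves. The entries of `sparse` and
`bits` at other indices are arbitrary; an index is recognized as listed by following `sparse` and
`dense`. -/
structure SparseWords (W m c : ℕ) (bits dense sparse f : ℕ → ℕ) : Prop where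
  dense_lt : ∀ j < c, dense j < m
  sparse_dense : ∀ j < c, sparse (dense j) = j
  eq_bits : ∀ i, sparse i < c → dense (sparse i) = i → f i = bits i
  listed_iff : ∀ i, sparse i < c ∧ dense (sparse i) = i ↔ f i ≠ 0
  lt : ∀ i, f i < 2 ^ W

namespace SparseWords

variable {W m c i y : ℕ} {bits dense sparse f : ℕ → ℕ}

theorem lt_of_ne_zero (h : SparseWords W m c bits dense sparse f) (hi : f i ≠ 0) : i < m := by
  obtain ⟨hc, hd⟩ := (h.listed_iff i).2 hi
  exact hd ▸ h.dense_lt _ hc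

theorem dense_ne_zero (h : SparseWords W m c bits dense sparse f) {j : ℕ} (hj : j < c) :
    f (dense j) ≠ 0 := by
  rw [← h.listed_iff, h.sparse_dense j hj]
  exact ⟨hj, rfl⟩

theorem dense_eq_bits (h : SparseWords W m c bits dense sparse f) {j : ℕ} (hj : j < c) :
    f (dense j) = bits (dense j) := by
  obtain ⟨hc, hd⟩ := (h.listed_iff _).2 (h.dense_ne_zero hj)
  exact h.eq_bits _ hc hd

theorem eq_zero (h : SparseWords W m 0 bits dense sparse f) (i : ℕ) : f i = 0 := by
  have := h.listed_iff i
  simp_all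

theorem dense_injOn (h : SparseWords W m c bits dense sparse f) :
    Set.InjOn dense (Finset.range c : Set ℕ) := by
  intro j hj k hk hjk
  rw [Finset.coe_range, Set.mem_Iio] at hj hk
  rw [← h.sparse_dense j hj, hjk, h.sparse_dense k hk]

theorem count_le_card (h : SparseWords W m c bits dense sparse f) {s : Finset ℕ}
    (hs : ∀ i, f i ≠ 0 → i ∈ s) : c ≤ s.card := by
  simpa using Finset.card_le_card_of_injOn (s := Finset.range c) dense
    (fun j hj => hs _ (h.dense_ne_zero (by simpa using hj))) h.dense_injOn

theorem count_le (h : SparseWords W m c bits dense sparse f) : c ≤ m := by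
  simpa using h.count_le_card (s := .range m) fun i hi => by simpa using h.lt_of_ne_zero hi

theorem count_lt (h : SparseWords W m c bits dense sparse f) (him : i < m) (hi : f i = 0) :
    c < m := by
  have := h.count_le_card (s := (Finset.range m).erase i) fun k hk => by
    rw [Finset.mem_erase, Finset.mem_range]
    exact ⟨fun hki => hk (hki ▸ hi), h.lt_of_ne_zero hk⟩
  rw [Finset.card_erase_of_mem (by simpa using him), Finset.card_range] at this
  lia

theorem clear (W m : ℕ) (bits dense sparse : ℕ → ℕ) :
    SparseWords W m 0 bits dense sparse fun _ => 0 := by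
  constructor <;> simp

theorem set_listed (h : SparseWords W m c bits dense sparse f) (hi : f i ≠ 0) (hy : y ≠ 0)
    (hlt : y < 2 ^ W) :
    SparseWords W m c (Function.update bits i y) dense sparse (Function.update f i y) := by
  obtain ⟨hd, hs, hb, hl, hf⟩ := h
  constructor <;> grind [Function.update_apply]

theorem set_unlisted (h : SparseWords W m c bits dense sparse f) (him : i < m) (hi : f i = 0)
    (hy : y ≠ 0) (hlt : y < 2 ^ W) :
    SparseWords W m (c + 1) (Function.update bits i y) (Function.update dense c i)
      (Function.update sparse i c) (Function.update f i y) := by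
  have hne : ∀ j < c, dense j ≠ i := fun j hj hji => h.dense_ne_zero hj (hji ▸ hi)
  obtain ⟨hd, hs, hb, hl, hf⟩ := h
  constructor <;> grind [Function.update_apply]

theorem erase_listed (h : SparseWords W m c bits dense sparse f) (hi : f i ≠ 0) (y : ℕ) :
    SparseWords W m (c - 1) (Function.update bits i y)
      (Function.update dense (sparse i) (dense (c - 1)))
      (Function.update sparse (dense (c - 1)) (sparse i)) (Function.update f i 0) := by
  have hlast := h.sparse_dense (c - 1)
  obtain ⟨hd, hs, hb, hl, hf⟩ := h
  constructor <;> grind [Function.update_apply]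

end SparseWords

/-- The sequence `f` of words of `W` bits, read as a set of numbers. -/
def IsBitSet (W : ℕ) (f : ℕ → ℕ) (S : Finset ℕ) : Prop :=
  ∀ v, v ∈ S ↔ (f (v / W)).testBit (v % W) = true

namespace IsBitSet

variable {W : ℕ} {f : ℕ → ℕ} {S : Finset ℕ}

theorem zero (W : ℕ) : IsBitSet W (fun _ => 0) ∅ := fun v => by simp

theorem insert (h : IsBitSet W f S) (v : ℕ) :
    IsBitSet W (Function.update f (v / W) (f (v / W) ||| 2 ^ (v % W))) (insert v S) := by
  intro u
  have := Nat.div_add_mod u W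
  have := Nat.div_add_mod v W
  rw [Finset.mem_insert, h u, Function.update_apply]
  split_ifs with huv
  · rw [huv, Nat.testBit_or, Nat.testBit_two_pow, Bool.or_eq_true, decide_eq_true_eq]
    grind
  · grind

theorem erase (h : IsBitSet W f S) {v : ℕ} (hv : v ∈ S) :
    IsBitSet W (Function.update f (v / W) (f (v / W) - 2 ^ (v % W))) (S.erase v) := by
  intro u
  have := Nat.div_add_mod u W
  have := Nat.div_add_mod v W
  rw [Finset.mem_erase, h u, Function.update_apply]
  split_ifs with huv
  · rw [huv, BitTricks.testBit_sub_two_pow ((h v).1 hv), Bool.and_eq_true, decide_eq_true_eq]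
    grind
  · grind

end IsBitSet

/-! ### Choice dictionaries -/

namespace DictMachine

open WordRAM

infixr:60 " ;; " => WordRAM.Prog.seq

/-- The registers of the programs that use the dictionaries. -/
def user (i : Fin 12) : Fin 25 := ⟨i, by lia⟩

/-- The registers for the constants on which the dictionary operations rely. -/
def const (i : Fin 7) : Fin 25 := ⟨12 + i, by lia⟩

/-- The registers that the dictionary operations may overwrite. -/
def scratch (i : Fin 6) : Fin 25 := ⟨19 + i, by lia⟩

/-- The four memory banks of the dictionary `d`. -/
def bank (c : Fin 4) (d : Fin 5) : Fin 20 := ⟨4 * d + c, by lia⟩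

@[simp] theorem user_inj {i j : Fin 12} : user i = user j ↔ i = j := by simp [user, Fin.ext_iff]

@[simp] theorem const_inj {i j : Fin 7} : const i = const j ↔ i = j := by
  simp [const, Fin.ext_iff]

@[simp] theorem scratch_inj {i j : Fin 6} : scratch i = scratch j ↔ i = j := by
  simp [scratch, Fin.ext_iff]

@[simp] theorem user_ne_const (i : Fin 12) (j : Fin 7) : user i ≠ const j :=
  Fin.ne_of_val_ne (by simp only [user, const]; lia)

@[simp] theorem user_ne_scratch (i : Fin 12) (j : Fin 6) : user i ≠ scratch j :=
  Fin.ne_of_val_ne (by simp only [user, scratch]; lia)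

@[simp] theorem const_ne_scratch (i : Fin 7) (j : Fin 6) : const i ≠ scratch j :=
  Fin.ne_of_val_ne (by simp only [const, scratch]; lia)

@[simp] theorem const_ne_user (i : Fin 7) (j : Fin 12) : const i ≠ user j :=
  (user_ne_const j i).symm

@[simp] theorem scratch_ne_const (i : Fin 6) (j : Fin 7) : scratch i ≠ const j :=
  (const_ne_scratch j i).symm

@[simp] theorem bank_inj {c c' : Fin 4} {d d' : Fin 5} :
    bank c d = bank c' d' ↔ c = c' ∧ d = d' := by
  simp only [bank, Fin.ext_iff]
  lia

/-- The index of the word that contains the element in question. -/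
abbrev wordIx : Fin 25 := scratch 0

/-- The position of the element in question within its word. -/
abbrev bitIx : Fin 25 := scratch 1

/-- The number of nonzero words. -/
abbrev count : Fin 25 := scratch 2

/-- The position in the list of the nonzero words. -/
abbrev pos : Fin 25 := scratch 3

/-- An intermediate result. -/
abbrev acc : Fin 25 := scratch 4

/-- The word that contains the element in question. -/
abbrev word : Fin 25 := scratch 5

/-- The words themselves. -/
abbrev bits (d : Fin 5) : Fin 20 := bank 0 d

/-- The list of the indices of the nonzero words. -/
abbrev dense (d : Fin 5) : Fin 20 := bank 1 d

/-- The positions of the indices in `dense`. -/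
abbrev sparse (d : Fin 5) : Fin 20 := bank 2 d

/-- The number of nonzero words, in cell `0`. -/
abbrev size (d : Fin 5) : Fin 20 := bank 3 d

/-- The parameters of the dictionaries: each has `m` words of length `4 ^ κ`, a power of `4` so that
the positions in a word form a square whose side length is a power of two. -/
structure Params (w B : ℕ) : Type where
  κ : ℕ
  m : ℕ
  one_le : 1 ≤ κ
  W_le : 4 ^ κ ≤ w
  m_le : m ≤ B
  B_pos : 0 < B
  U_lt : m * 4 ^ κ < 2 ^ w

namespace Params

variable {w B : ℕ} (P : Params w B) {i v : ℕ}

/-- The word length of the dictionaries. -/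
def W : ℕ := 4 ^ P.κ

/-- The square root of the word length of the dictionaries. -/
def s : ℕ := 2 ^ P.κ

/-- The size of the universe. -/
def U : ℕ := P.m * P.W

theorem s_mul_s : P.s * P.s = P.W := by
  rw [s, W, ← mul_pow]
  norm_num

theorem two_pow_κ : 2 ^ P.κ = P.s := rfl

theorem two_le_s : 2 ≤ P.s := Nat.pow_le_pow_right two_pos P.one_le

theorem W_pos : 0 < P.W := Nat.pow_pos four_pos

theorem two_pow_two_mul : 2 ^ (2 * P.κ) = P.W := by
  rw [W, pow_mul]
  norm_num

theorem two_pow_W_le : 2 ^ P.W ≤ 2 ^ w := Nat.pow_le_pow_right two_pos P.W_le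

include P in
theorem lt_two_pow_of_lt_sixteen (h : i < 16) : i < 2 ^ w := by
  have h4 : 4 ≤ w := (Nat.pow_le_pow_right four_pos P.one_le).trans P.W_le
  exact h.trans_le (Nat.pow_le_pow_right (n := 2) two_pos h4)

include P in
theorem one_lt_two_pow : 1 < 2 ^ w := P.lt_two_pow_of_lt_sixteen (by norm_num)

theorem div_lt_m (h : v < P.U) : v / P.W < P.m := (Nat.div_lt_iff_lt_mul P.W_pos).2 h

theorem div_lt_B (h : v < P.U) : v / P.W < B := (P.div_lt_m h).trans_le P.m_le

theorem lt_U (h : v / P.W < P.m) : v < P.U := (Nat.div_lt_iff_lt_mul P.W_pos).1 h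

theorem m_lt_two_pow : P.m < 2 ^ w := (Nat.le_mul_of_pos_right _ P.W_pos).trans_lt P.U_lt

theorem s_lt_two_pow_sub_one : P.s < 2 ^ P.s - 1 := by
  obtain ⟨t, ht⟩ := Nat.exists_eq_add_of_le' P.two_le_s
  have : t < 2 ^ t := Nat.lt_two_pow_self
  rw [ht, pow_add]
  lia

theorem two_pow_mod_lt (v : ℕ) : 2 ^ (v % P.W) < 2 ^ P.W :=
  Nat.pow_lt_pow_right one_lt_two (Nat.mod_lt _ P.W_pos)

/-- The contents of the registers with constants: shift and modulus for the access to a bit, the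
binary logarithm of `s`, and, for `s` fields of `s` and of `s + 1` bits, the number with a one in
each field and the modulus that adds up the fields. -/
def constant : Fin 7 → ℕ :=
  ![2 * P.κ, P.W, P.κ, BitTricks.repunit P.s P.s, BitTricks.repunit (P.s + 1) P.s, 2 ^ P.s - 1,
    2 ^ (P.s + 1) - 1]

end Params

/-- The state of a program that uses the dictionaries: its registers and the sets in the
dictionaries. -/
structure DictState : Type where
  reg : Fin 12 → ℕ
  set : Fin 5 → Finset ℕ

namespace DictState

/-- Writes a register. -/
def setReg (a : DictState) (i : Fin 12) (x : ℕ) : DictState :=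
  { a with reg := Function.update a.reg i x }

/-- Replaces a set. -/
def setSet (a : DictState) (d : Fin 5) (S : Finset ℕ) : DictState :=
  { a with set := Function.update a.set d S }

variable (a : DictState)

@[simp] theorem set_setReg (i : Fin 12) (x : ℕ) : (a.setReg i x).set = a.set := rfl

@[simp] theorem reg_setSet (d : Fin 5) (S : Finset ℕ) : (a.setSet d S).reg = a.reg := rfl

@[simp] theorem setSet_self (d : Fin 5) : a.setSet d (a.set d) = a := by
  simp [setSet]

@[simp] theorem reg_setReg_self (i : Fin 12) (x : ℕ) : (a.setReg i x).reg i = x :=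
  Function.update_self ..

@[simp] theorem reg_setReg_of_ne {i j : Fin 12} (h : j ≠ i) (x : ℕ) :
    (a.setReg i x).reg j = a.reg j :=
  Function.update_of_ne h ..

@[simp] theorem set_setSet_self (d : Fin 5) (S : Finset ℕ) : (a.setSet d S).set d = S :=
  Function.update_self ..

@[simp] theorem set_setSet_of_ne {d d' : Fin 5} (h : d' ≠ d) (S : Finset ℕ) :
    (a.setSet d S).set d' = a.set d' :=
  Function.update_of_ne h ..

end DictState

variable {w B : ℕ} {P : Params w B} {inp : List (BitVec w)} {ν ν' ν'' : NatState 25 20}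
  {a : DictState} {d : Fin 5} {x y : Fin 12} {f : ℕ → ℕ} {S : Finset ℕ} {v : ℕ}

/-- The words of the dictionary `d`. -/
def Stores (P : Params w B) (ν : NatState 25 20) (d : Fin 5) (f : ℕ → ℕ) : Prop :=
  SparseWords P.W P.m (ν.mem (size d) 0) (ν.mem (bits d)) (ν.mem (dense d)) (ν.mem (sparse d)) f

/-- The dictionary `d` contains the set `S`. -/
def StoresSet (P : Params w B) (ν : NatState 25 20) (d : Fin 5) (S : Finset ℕ) : Prop :=
  ∃ f, Stores P ν d f ∧ IsBitSet P.W f S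

theorem StoresSet.lt_U (h : StoresSet P ν d S) (hv : v ∈ S) : v < P.U := by
  obtain ⟨f, hf, hS⟩ := h
  refine P.lt_U (hf.lt_of_ne_zero fun h0 => ?_)
  rw [hS, h0, Nat.zero_testBit] at hv
  exact Bool.false_ne_true hv

/-- The state `ν` implements `a`. -/
structure Refines (P : Params w B) (ν : NatState 25 20) (a : DictState) : Prop where
  user : ∀ i, ν.reg (user i) = a.reg i
  const : ∀ i, ν.reg (const i) = P.constant i
  dict : ∀ d, StoresSet P ν d (a.set d)

/-- The states agree except in the scratch registers. -/
structure EqOffScratch (ν ν' : NatState 25 20) : Prop where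
  mem : ν'.mem = ν.mem
  reg : ∀ i, (∀ j, i ≠ scratch j) → ν'.reg i = ν.reg i

theorem eqOffScratch_iff : EqOffScratch ν ν' ↔
    ν'.mem = ν.mem ∧ ∀ i, (∀ j, i ≠ scratch j) → ν'.reg i = ν.reg i :=
  ⟨fun ⟨hm, hr⟩ => ⟨hm, hr⟩, fun ⟨hm, hr⟩ => ⟨hm, hr⟩⟩

theorem EqOffScratch.trans (h : EqOffScratch ν ν') (h' : EqOffScratch ν' ν'') :
    EqOffScratch ν ν'' :=
  ⟨h'.mem.trans h.mem, fun i hi => (h'.reg i hi).trans (h.reg i hi)⟩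

theorem EqOffScratch.setReg (h : EqOffScratch ν ν') (j : Fin 6) (v : ℕ) :
    EqOffScratch ν (ν'.setReg (scratch j) v) :=
  ⟨h.mem, fun i hi => by rw [NatState.reg_setReg_of_ne _ (hi j), h.reg i hi]⟩

/-- In the state `ν'` the dictionary `d` has the words `f`, and `ν'` agrees with `ν` in the other
dictionaries and outside of the scratch registers. -/
structure Rewrites (P : Params w B) (ν : NatState 25 20) (d : Fin 5) (f : ℕ → ℕ)
    (ν' : NatState 25 20) : Prop where
  reg : ∀ i, (∀ j, i ≠ scratch j) → ν'.reg i = ν.reg i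
  mem : ∀ c d', d' ≠ d → ν'.mem (bank c d') = ν.mem (bank c d')
  stores : Stores P ν' d f

theorem rewrites_iff : Rewrites P ν d f ν' ↔
    (∀ i, (∀ j, i ≠ scratch j) → ν'.reg i = ν.reg i) ∧
      (∀ c d', d' ≠ d → ν'.mem (bank c d') = ν.mem (bank c d')) ∧ Stores P ν' d f :=
  ⟨fun ⟨hr, hm, hf⟩ => ⟨hr, hm, hf⟩, fun ⟨hr, hm, hf⟩ => ⟨hr, hm, hf⟩⟩

namespace Refines

theorem congr (h : Refines P ν a) (hν : EqOffScratch ν ν') : Refines P ν' a := by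
  refine ⟨fun i => ?_, fun i => ?_, fun d => ?_⟩
  · rw [hν.reg _ fun _ => user_ne_scratch _ _, h.user]
  · rw [hν.reg _ fun _ => const_ne_scratch _ _, h.const]
  · simpa only [StoresSet, Stores, hν.mem] using h.dict d

theorem setReg (h : Refines P ν a) (i : Fin 12) (v : ℕ) :
    Refines P (ν.setReg (DictMachine.user i) v) (a.setReg i v) := by
  refine ⟨fun j => ?_, fun j => ?_, h.dict⟩
  · obtain rfl | hj := eq_or_ne j i
    · simp
    · simp [hj, h.user]
  · simp [h.const]

theorem setSet (h : Refines P ν a) (hν : Rewrites P ν d f ν') (hS : IsBitSet P.W f S) :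
    Refines P ν' (a.setSet d S) := by
  refine ⟨fun i => ?_, fun i => ?_, fun d' => ?_⟩
  · rw [hν.reg _ fun _ => user_ne_scratch _ _, h.user, DictState.reg_setSet]
  · rw [hν.reg _ fun _ => const_ne_scratch _ _, h.const]
  · obtain rfl | hd := eq_or_ne d' d
    · rw [DictState.set_setSet_self]
      exact ⟨f, hν.stores, hS⟩
    · simpa only [DictState.set_setSet_of_ne _ hd, StoresSet, Stores, hν.mem _ _ hd]
        using h.dict d'

end Refines

/-- Looks up the word that contains the bit `x`. -/
def locate (d : Fin 5) (x : Fin 12) : Prog 25 20 :=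
  .op wordIx .shr (.reg (user x)) (.reg (const 0)) ;;
  .op bitIx .mod (.reg (user x)) (.reg (const 1)) ;;
  .load count (size d) (.lit 0) ;;
  .load pos (sparse d) (.reg wordIx) ;;
  .op word .add (.lit 0) (.lit 0) ;;
  .ite .lt (.reg pos) (.reg count)
    (.load acc (dense d) (.reg pos) ;;
      .ite .eq (.reg acc) (.reg wordIx) (.load word (bits d) (.reg wordIx)) .skip)
    .skip

/-- The outcome `ν'` of looking up the word that contains the bit `v`, from the state `ν`. -/
structure Located (P : Params w B) (ν : NatState 25 20) (d : Fin 5) (f : ℕ → ℕ) (v : ℕ)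
    (ν' : NatState 25 20) : Prop where
  eqOffScratch : EqOffScratch ν ν'
  wordIx_eq : ν'.reg wordIx = v / P.W
  bitIx_eq : ν'.reg bitIx = v % P.W
  count_eq : ν'.reg count = ν.mem (size d) 0
  word_eq : ν'.reg word = f (v / P.W)
  pos_eq : ν'.reg pos = ν.mem (sparse d) (v / P.W)

theorem located_iff {v : ℕ} : Located P ν d f v ν' ↔
    EqOffScratch ν ν' ∧ ν'.reg wordIx = v / P.W ∧ ν'.reg bitIx = v % P.W ∧
      ν'.reg count = ν.mem (size d) 0 ∧ ν'.reg word = f (v / P.W) ∧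
      ν'.reg pos = ν.mem (sparse d) (v / P.W) :=
  ⟨fun ⟨h1, h2, h3, h4, h5, h6⟩ => ⟨h1, h2, h3, h4, h5, h6⟩,
    fun ⟨h1, h2, h3, h4, h5, h6⟩ => ⟨h1, h2, h3, h4, h5, h6⟩⟩

theorem runs_locate (h : Refines P ν a) (hx : a.reg x < P.U) (hf : Stores P ν d f) :
    Runs inp B Represents (locate d x) ν 10 fun ν' _ => Located P ν d f (a.reg x) ν' := by
  have hpos : ν.mem (sparse d) (a.reg x / P.W) < ν.mem (size d) 0 →
      ν.mem (sparse d) (a.reg x / P.W) < B := fun h => h.trans_le (hf.count_le.trans P.m_le)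
  have hlisted := hf.listed_iff (a.reg x / P.W)
  have hbits := hf.eq_bits (a.reg x / P.W)
  apply Runs.of_wp
  simp +contextual [locate, wp, Operand.Fits, Operand.val, BinOp.Fits, BinOp.val, Cmp.HoldsNat,
    h.user, h.const, Params.constant, P.two_pow_two_mul, P.B_pos, P.div_lt_B hx, hpos, located_iff,
    eqOffScratch_iff]
  grind

/-- Adds the element in the register `x`. -/
def insertProg (d : Fin 5) (x : Fin 12) : Prog 25 20 :=
  locate d x ;;
  .ite .eq (.reg word) (.lit 0)
    (.store (sparse d) (.reg wordIx) (.reg count) ;;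
      .store (dense d) (.reg count) (.reg wordIx) ;;
      .op count .add (.reg count) (.lit 1) ;;
      .store (size d) (.lit 0) (.reg count))
    .skip ;;
  .op acc .shl (.lit 1) (.reg bitIx) ;;
  .op word .or (.reg word) (.reg acc) ;;
  .store (bits d) (.reg wordIx) (.reg word)

theorem runs_insertProg (h : Refines P ν a) (hx : a.reg x < P.U) :
    Runs inp B Represents (insertProg d x) ν 40 fun ν' _ =>
      Refines P ν' (a.setSet d (insert (a.reg x) (a.set d))) := by
  obtain ⟨f, hf, hS⟩ := h.dict d
  refine .mono ?_ fun ν' _ hν' => h.setSet hν' (hS.insert _)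
  refine .seq ((runs_locate h hx hf).frame (by norm_num) fun ν' hν' => .of_wp ?_)
  obtain ⟨⟨hm, hr⟩, hwordIx, hbitIx, hcount, hword, -⟩ := hν'
  have hi := P.div_lt_m hx
  have hp := P.two_pow_mod_lt (a.reg x)
  set i := a.reg x / P.W
  set p := a.reg x % P.W
  have hlt : f i ||| 2 ^ p < 2 ^ P.W := Nat.or_lt_two_pow (hf.lt _) hp
  have hne : f i ||| 2 ^ p ≠ 0 := by simp
  have hiB := hi.trans_le P.m_le
  have hpw := hp.trans_le P.two_pow_W_le
  obtain h0 | h0 := eq_or_ne (f i) 0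
  · have hc := hf.count_lt hi h0
    have hcB := hc.trans_le P.m_le
    have hcw : ν.mem (size d) 0 + 1 < 2 ^ w := (Nat.succ_le_of_lt hc).trans_lt P.m_lt_two_pow
    have hf' := hf.set_unlisted hi h0 hne hlt
    simp_all [wp, Operand.Fits, Operand.val, BinOp.Fits, BinOp.val, P.B_pos, Cmp.HoldsNat,
      P.one_lt_two_pow, rewrites_iff, Stores]
  · have hf' := hf.set_listed h0 hne hlt
    simp_all [wp, Operand.Fits, Operand.val, BinOp.Fits, BinOp.val, P.B_pos, Cmp.HoldsNat,
      P.one_lt_two_pow, rewrites_iff, Stores]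

/-- Computes in `acc` whether the set contains the element in the register `x`. -/
def probe (d : Fin 5) (x : Fin 12) : Prog 25 20 :=
  locate d x ;;
  .op acc .shr (.reg word) (.reg bitIx) ;;
  .op acc .and (.reg acc) (.lit 1)

theorem runs_probe (h : Refines P ν a) (hx : a.reg x < P.U) (hf : Stores P ν d f)
    (hS : IsBitSet P.W f S) :
    Runs inp B Represents (probe d x) ν 20 fun ν' _ =>
      Located P ν d f (a.reg x) ν' ∧ (ν'.reg acc = 1 ↔ a.reg x ∈ S) := by
  have hbit := hS (a.reg x)
  refine .seq ((runs_locate h hx hf).frame (by norm_num) fun ν' hν' => .of_wp ?_)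
  obtain ⟨⟨hm, hr⟩, hwordIx, hbitIx, hcount, hword, hpos⟩ := hν'
  simp_all [wp, Operand.Fits, Operand.val, BinOp.Fits, BinOp.val, P.one_lt_two_pow, located_iff,
    eqOffScratch_iff, Nat.testBit_eq_decide_div_mod_eq]

/-- Removes the element in the register `x`. If its word becomes zero, then the last entry of the
list of the nonzero words takes its place. -/
def eraseProg (d : Fin 5) (x : Fin 12) : Prog 25 20 :=
  probe d x ;;
  .ite .eq (.reg acc) (.lit 1)
    (.op acc .shl (.lit 1) (.reg bitIx) ;;
      .op word .sub (.reg word) (.reg acc) ;;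
      .store (bits d) (.reg wordIx) (.reg word) ;;
      .ite .eq (.reg word) (.lit 0)
        (.op count .sub (.reg count) (.lit 1) ;;
          .store (size d) (.lit 0) (.reg count) ;;
          .load acc (dense d) (.reg count) ;;
          .store (dense d) (.reg pos) (.reg acc) ;;
          .store (sparse d) (.reg acc) (.reg pos))
        .skip)
    .skip

theorem runs_eraseProg (h : Refines P ν a) (hx : a.reg x < P.U) :
    Runs inp B Represents (eraseProg d x) ν 40 fun ν' _ =>
      Refines P ν' (a.setSet d ((a.set d).erase (a.reg x))) := by
  obtain ⟨f, hf, hS⟩ := h.dict d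
  refine .seq ((runs_probe h hx hf hS).frame (by norm_num) fun ν' ⟨hν', hacc⟩ => ?_)
  by_cases hxS : a.reg x ∈ a.set d
  · refine .mono (.of_wp ?_) fun ν' _ hν' => h.setSet hν' (hS.erase hxS)
    obtain ⟨⟨hm, hr⟩, hwordIx, hbitIx, hcount, hword, hpos⟩ := hν'
    have hiB := P.div_lt_B hx
    have hpw := (P.two_pow_mod_lt (a.reg x)).trans_le P.two_pow_W_le
    have hbit := (hS _).1 hxS
    set i := a.reg x / P.W
    set p := a.reg x % P.W
    have hle : 2 ^ p ≤ f i := Nat.ge_two_pow_of_testBit hbit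
    have hi : f i ≠ 0 := (Nat.pow_pos two_pos).trans_le hle |>.ne'
    obtain h0 | h0 := eq_or_ne (f i - 2 ^ p) 0
    · have hc : ν.mem (sparse d) i < ν.mem (size d) 0 := ((hf.listed_iff i).2 hi).1
      have hc1 : 1 ≤ ν.mem (size d) 0 := by lia
      have hcB : ν.mem (size d) 0 - 1 < B := by have := hf.count_le; have := P.m_le; lia
      have hsB : ν.mem (sparse d) i < B := by lia
      have hdB := (hf.dense_lt (ν.mem (size d) 0 - 1) (by lia)).trans_le P.m_le
      have hf' := hf.erase_listed hi (f i - 2 ^ p)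
      simp_all [wp, Operand.Fits, Operand.val, BinOp.Fits, BinOp.val, P.B_pos, Cmp.HoldsNat,
        P.one_lt_two_pow, rewrites_iff, Stores]
    · have hf' := hf.set_listed hi h0 ((Nat.sub_le _ _).trans_lt (hf.lt i))
      simp_all [wp, Operand.Fits, Operand.val, BinOp.Fits, BinOp.val, P.B_pos, Cmp.HoldsNat,
        P.one_lt_two_pow, rewrites_iff, Stores]
  · refine .of_wp ?_
    rw [Finset.erase_eq_of_notMem hxS, DictState.setSet_self]
    simpa [wp, Operand.Fits, Operand.val, P.one_lt_two_pow, Cmp.HoldsNat, hacc, hxS]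
      using h.congr hν'.eqOffScratch

/-- Empties the set, in constant time and whatever the contents of the memory are. -/
def clearProg (d : Fin 5) : Prog 25 20 := .store (size d) (.lit 0) (.lit 0)

theorem runs_clearProg (P : Params w B) :
    Runs inp B Represents (clearProg d) ν 40 fun ν' _ => Rewrites P ν d (fun _ => 0) ν' := by
  have hf := SparseWords.clear P.W P.m (ν.mem (bits d)) (ν.mem (dense d)) (ν.mem (sparse d))
  refine .of_wp ?_
  simp_all [clearProg, wp, Operand.Fits, Operand.val, P.B_pos, rewrites_iff, Stores]

/-- Isolates the lowest one of `word`. -/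
def isolateLowest : Prog 25 20 :=
  .op acc .sub (.reg word) (.lit 1) ;;
  .op acc .and (.reg word) (.reg acc) ;;
  .op word .sub (.reg word) (.reg acc)

theorem runs_isolateLowest (P : Params w B) (hx : ν.reg word ≠ 0) :
    Runs inp B Represents isolateLowest ν 3 fun ν' _ => EqOffScratch ν ν' ∧
      ν'.reg wordIx = ν.reg wordIx ∧ ∃ j, (ν.reg word).testBit j = true ∧ ν'.reg word = 2 ^ j := by
  have hle : ν.reg word &&& (ν.reg word - 1) ≤ ν.reg word := Nat.and_le_left
  refine .of_wp ?_
  simpa [isolateLowest, wp, Operand.Fits, Operand.val, BinOp.Fits, BinOp.val, P.one_lt_two_pow,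
    Nat.one_le_iff_ne_zero, hx, hle, eqOffScratch_iff] using
    ⟨fun i hi => by simp [hi], BitTricks.exists_testBit_sub_and_pred hx⟩

/-- Replaces the power of two in `word` by the multiple of `s` next below its logarithm, in
`bitIx`. -/
def rowProg : Prog 25 20 :=
  .op bitIx .sub (.reg word) (.lit 1) ;;
  .op bitIx .add (.reg bitIx) (.reg word) ;;
  .op bitIx .and (.reg bitIx) (.reg (const 3)) ;;
  .op bitIx .mod (.reg bitIx) (.reg (const 5)) ;;
  .op bitIx .sub (.reg bitIx) (.lit 1) ;;
  .op bitIx .shl (.reg bitIx) (.reg (const 2))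

theorem runs_rowProg (h : Refines P ν a) {j : ℕ} (hj : j < P.W) (hword : ν.reg word = 2 ^ j) :
    Runs inp B Represents rowProg ν 6 fun ν' _ => EqOffScratch ν ν' ∧
      ν'.reg wordIx = ν.reg wordIx ∧ ν'.reg word = 2 ^ j ∧ ν'.reg bitIx = j / P.s * P.s := by
  have hs := P.two_le_s
  have hsub : 2 ^ j - 1 + 2 ^ j = 2 ^ (j + 1) - 1 := by rw [pow_succ]; lia
  have hlt : 2 ^ (j + 1) - 1 < 2 ^ w := by
    have : 2 ^ (j + 1) ≤ 2 ^ P.W := Nat.pow_le_pow_right two_pos hj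
    have := P.two_pow_W_le
    have := Nat.pow_pos (n := w) two_pos
    lia
  have hmod := BitTricks.ones_and_repunit_mod (s := P.s) (m := P.s) (j := j) (by lia)
    (P.s_lt_two_pow_sub_one) (by rwa [P.s_mul_s])
  have hrow : j / P.s * P.s < 2 ^ w :=
    ((Nat.div_mul_le_self j P.s).trans_lt hj).trans_le (P.W_le.trans Nat.lt_two_pow_self.le)
  refine .of_wp ?_
  simp_all [rowProg, wp, Operand.Fits, Operand.val, BinOp.Fits, BinOp.val, P.one_lt_two_pow,
    P.two_pow_κ, h.const, Params.constant, eqOffScratch_iff, Nat.one_le_two_pow]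

/-- Replaces the power of two in `word` by the remainder of its logarithm modulo `s`, where `bitIx`
is the multiple of `s` next below. -/
def columnProg : Prog 25 20 :=
  .op word .shr (.reg word) (.reg bitIx) ;;
  .op word .sub (.reg word) (.lit 1) ;;
  .op word .mul (.reg word) (.reg (const 3)) ;;
  .op word .and (.reg word) (.reg (const 4)) ;;
  .op word .mod (.reg word) (.reg (const 6))

theorem runs_columnProg (h : Refines P ν a) {j : ℕ} (hword : ν.reg word = 2 ^ j)
    (hbitIx : ν.reg bitIx = j / P.s * P.s) :
    Runs inp B Represents columnProg ν 5 fun ν' _ => EqOffScratch ν ν' ∧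
      ν'.reg wordIx = ν.reg wordIx ∧ ν'.reg bitIx = j / P.s * P.s ∧ ν'.reg word = j % P.s := by
  have hs := P.two_le_s
  have hr : j % P.s < P.s := Nat.mod_lt _ (by lia)
  have hdiv : 2 ^ j / 2 ^ (j / P.s * P.s) = 2 ^ (j % P.s) := by
    rw [Nat.pow_div (Nat.div_mul_le_self ..) two_pos, Nat.mod_eq_sub_div_mul]
  have hmul : (2 ^ (j % P.s) - 1) * BitTricks.repunit P.s P.s < 2 ^ w := by
    have hlt : 2 ^ (j % P.s) - 1 < 2 ^ P.s :=
      (Nat.sub_le _ _).trans_lt (Nat.pow_lt_pow_right one_lt_two hr)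
    refine (BitTricks.mul_repunit_lt hlt _).trans_le ?_
    rw [P.s_mul_s]
    exact P.two_pow_W_le
  have hmod := BitTricks.ones_mul_repunit_and_repunit_mod (s := P.s) (by lia) hr
  refine .of_wp ?_
  simp_all [columnProg, wp, Operand.Fits, Operand.val, BinOp.Fits, BinOp.val, P.one_lt_two_pow,
    h.const, Params.constant, eqOffScratch_iff, Nat.one_le_two_pow]

/-- Replaces `word` by the position of its lowest one. -/
def lowestOne : Prog 25 20 :=
  isolateLowest ;; rowProg ;; columnProg ;;
  .op word .add (.reg word) (.reg bitIx)

theorem runs_lowestOne (h : Refines P ν a) (hx : ν.reg word ≠ 0) (hlt : ν.reg word < 2 ^ P.W) :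
    Runs inp B Represents lowestOne ν 15 fun ν' _ => EqOffScratch ν ν' ∧
      ν'.reg wordIx = ν.reg wordIx ∧
      ν'.reg word < P.W ∧ (ν.reg word).testBit (ν'.reg word) = true := by
  refine .seq ((runs_isolateLowest P hx).frame (by norm_num) fun ν₁ ⟨h₁, hi₁, j, hj, hx₁⟩ => ?_)
  have hjW : j < P.W :=
    (Nat.pow_lt_pow_iff_right one_lt_two).1 ((Nat.ge_two_pow_of_testBit hj).trans_lt hlt)
  have hjw : j < 2 ^ w := hjW.trans_le (P.W_le.trans Nat.lt_two_pow_self.le)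
  refine .seq ((runs_rowProg (h.congr h₁) hjW hx₁).frame (by norm_num)
    fun ν₂ ⟨h₂, hi₂, hx₂, hrow⟩ => ?_)
  refine .seq ((runs_columnProg (h.congr (h₁.trans h₂)) hx₂ hrow).frame (by norm_num)
    fun ν₃ ⟨h₃, hi₃, hrow₃, hcol⟩ => .of_wp ?_)
  simp_all [wp, Operand.Fits, Operand.val, BinOp.Fits, BinOp.val, Nat.mod_add_div',
    ((h₁.trans h₂).trans h₃).setReg]

/-- Writes the lowest element of the word that is listed first to the register `y`. -/
def chooseListed (y : Fin 12) (d : Fin 5) : Prog 25 20 :=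
  .load wordIx (dense d) (.lit 0) ;;
  .load word (bits d) (.reg wordIx) ;;
  lowestOne ;;
  .op wordIx .shl (.reg wordIx) (.reg (const 0)) ;;
  .op (user y) .add (.reg wordIx) (.reg word)

theorem runs_chooseListed (h : Refines P ν a) (hf : Stores P ν d f)
    (hS : IsBitSet P.W f (a.set d)) (hc : 0 < ν.mem (size d) 0) :
    Runs inp B Represents (chooseListed y d) ν 30 fun ν' _ =>
      ∃ v ∈ a.set d, Refines P ν' (a.setReg y v) := by
  have hi := hf.dense_ne_zero hc
  have hx := hf.dense_eq_bits hc
  have hm := hf.dense_lt 0 hc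
  have hlt := hf.lt (ν.mem (dense d) 0)
  set i := ν.mem (dense d) 0 with hi_def
  have h₂ : EqOffScratch ν ((ν.setReg wordIx i).setReg word (ν.mem (bits d) i)) :=
    .setReg (.setReg ⟨rfl, fun _ _ => rfl⟩ 0 _) 5 _
  refine .seq (.of_wp ⟨by norm_num, P.one_lt_two_pow.le.trans' (by norm_num), P.B_pos, ?_⟩)
  refine .seq (.of_wp ⟨by norm_num, trivial, ?_, ?_⟩)
  · simpa [Operand.val] using hm.trans_le P.m_le
  simp only [Operand.val, ← hi_def, NatState.reg_setReg_self, NatState.mem_setReg]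
  refine .seq ((runs_lowestOne (h.congr h₂) ?_ ?_).frame (by norm_num)
    fun ν₃ ⟨h₃, hi₃, hp, hbit⟩ => .of_wp ?_)
  · simpa [← hx] using hi
  · simpa [← hx] using hlt
  have hv : i * P.W + ν₃.reg word ∈ a.set d := by
    rw [hS, Nat.add_div_of_dvd_right (dvd_mul_left ..), Nat.mul_div_cancel _ P.W_pos,
      Nat.div_eq_of_lt hp, Nat.mul_add_mod_of_lt hp]
    simpa [hx] using hbit
  have hvw := (StoresSet.lt_U ⟨f, hf, hS⟩ hv).trans P.U_lt
  have hiw : i * P.W < 2 ^ w := by lia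
  have h₃ := h.congr (h₂.trans h₃)
  have hκ : 2 ^ ν₃.reg (const 0) = P.W := by
    rw [h₃.const]
    exact P.two_pow_two_mul
  have hset := (h₃.congr (.setReg ⟨rfl, fun _ _ => rfl⟩ 0 (i * P.W))).setReg y
    (i * P.W + ν₃.reg word)
  simpa [wp, Operand.Fits, Operand.val, BinOp.Fits, BinOp.val, hi₃, hκ, hiw, hvw] using
    ⟨_, hv, hset⟩

/-- Writes an element of the set to the register `y`, and the content of register `0` if there is
none. -/
def choiceProg (y : Fin 12) (d : Fin 5) : Prog 25 20 :=
  .load count (size d) (.lit 0) ;;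
  .ite .eq (.reg count) (.lit 0) (.op (user y) .add (.reg (user 0)) (.lit 0)) (chooseListed y d)

theorem runs_choiceProg (h : Refines P ν a) (hn : a.reg 0 < 2 ^ w) :
    Runs inp B Represents (choiceProg y d) ν 40 fun ν' _ =>
      (∃ v ∈ a.set d, Refines P ν' (a.setReg y v)) ∨
        a.set d = ∅ ∧ Refines P ν' (a.setReg y (a.reg 0)) := by
  obtain ⟨f, hf, hS⟩ := h.dict d
  have h₁ := h.congr (.setReg ⟨rfl, fun _ _ => rfl⟩ 2 (ν.mem (size d) 0))
  refine .seq (.of_wp ⟨by norm_num, P.one_lt_two_pow.le.trans' (by norm_num), P.B_pos, ?_⟩)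
  refine .ite (m := ν.mem (size d) 0) (n := 0)
    (fun σ hσ => by simp [Operand.eval, hσ.reg, Operand.val])
    (fun _ _ => by simp [Operand.eval]) (by norm_num) (fun hc => .of_wp ?_) fun hc =>
      (runs_chooseListed h₁ hf hS (Nat.pos_of_ne_zero hc)).frame (by norm_num) fun _ => .inl
  rw [Cmp.HoldsNat] at hc
  have hempty : a.set d = ∅ := Finset.eq_empty_of_forall_notMem fun v hv => by
    rw [Stores, hc] at hf
    simpa [hf.eq_zero] using (hS v).1 hv
  have hset := h₁.setReg y (a.reg 0)
  simp_all [wp, Operand.Fits, Operand.val, BinOp.Fits, BinOp.val, h.user]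

end DictMachine

/-! ### Programs that use choice dictionaries -/

namespace DictMachine

open WordRAM

/-- Programs with choice dictionaries. -/
inductive DictProg : Type
  | skip
  | op (dst : Fin 12) (o : BinOp) (x y : Operand 12)
  | read (dst : Fin 12) (addr : Operand 12)
  | insert (d : Fin 5) (x : Fin 12)
  | erase (d : Fin 5) (x : Fin 12)
  | clear (d : Fin 5)
  | choice (dst : Fin 12) (d : Fin 5)
  | seq (p q : DictProg)
  | ite (c : Cmp) (x y : Operand 12) (p q : DictProg)
  | ifMem (d : Fin 5) (x : Fin 12) (p q : DictProg)
  | loop (c : Cmp) (x y : Operand 12) (p : DictProg)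

infixr:60 " ;;; " => DictProg.seq

/-- The operand of the word RAM program. -/
def userOperand : Operand 12 → Operand 25
  | .reg i => .reg (user i)
  | .lit m => .lit m
  | .width => .width

/-- The word RAM program that executes a branch according to whether the element in the register
`x` is in the set. -/
def ifMemProg (d : Fin 5) (x : Fin 12) (p q : Prog 25 20) : Prog 25 20 :=
  probe d x ;; .ite .eq (.reg acc) (.lit 1) p q

/-- The translation into programs of the word RAM. -/
def DictProg.compile : DictProg → Prog 25 20
  | skip => .skip
  | op dst o x y => .op (user dst) o (userOperand x) (userOperand y)
  | read dst addr => .read (user dst) (userOperand addr)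
  | insert d x => insertProg d x
  | erase d x => eraseProg d x
  | clear d => clearProg d
  | choice dst d => choiceProg dst d
  | seq p q => p.compile ;; q.compile
  | ite c x y p q => .ite c (userOperand x) (userOperand y) p.compile q.compile
  | ifMem d x p q => ifMemProg d x p.compile q.compile
  | loop c x y p => .while c (userOperand x) (userOperand y) p.compile

/-- The value of an operand. -/
def DictState.val (w : ℕ) (a : DictState) : Operand 12 → ℕ
  | .reg i => a.reg i
  | .lit m => m
  | .width => w

variable {w B : ℕ} {P : Params w B} {inp : List (BitVec w)} {σ : State 25 20 w} {a : DictState}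
  {b : ℕ} {d : Fin 5} {x : Fin 12} {Q Q' : DictState → ℕ → Prop}

/-- The state `σ` of the word RAM implements `a`. -/
def Rel (P : Params w B) (σ : State 25 20 w) (a : DictState) : Prop :=
  ∃ ν, Represents σ ν ∧ Refines P ν a

/-- Total correctness of programs with choice dictionaries, with time credits for the steps of the
word RAM. -/
def DRuns (P : Params w B) (inp : List (BitVec w)) (p : DictProg) (a : DictState) (b : ℕ)
    (Q : DictState → ℕ → Prop) : Prop :=
  Runs inp B (Rel P) p.compile a b Q

/-- The weakest precondition of a program with choice dictionaries, where an operation of a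
dictionary costs `40` credits. A loop has no such unfolding and is left to `DRuns.loop`. -/
def dwp (P : Params w B) (inp : List (BitVec w)) :
    DictProg → DictState → ℕ → (DictState → ℕ → Prop) → Prop
  | .skip, a, b, Q => 1 ≤ b ∧ Q a (b - 1)
  | .op dst o x y, a, b, Q => 1 ≤ b ∧ x.Fits w ∧ y.Fits w ∧ o.Fits w (a.val w x) (a.val w y) ∧
      Q (a.setReg dst (o.val (a.val w x) (a.val w y))) (b - 1)
  | .read dst addr, a, b, Q => 1 ≤ b ∧ addr.Fits w ∧
      ∃ x, (inp.map BitVec.toNat)[a.val w addr]? = some x ∧ Q (a.setReg dst x) (b - 1)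
  | .insert d x, a, b, Q => 40 ≤ b ∧ a.reg x < P.U ∧
      Q (a.setSet d (insert (a.reg x) (a.set d))) (b - 40)
  | .erase d x, a, b, Q => 40 ≤ b ∧ a.reg x < P.U ∧
      Q (a.setSet d ((a.set d).erase (a.reg x))) (b - 40)
  | .clear d, a, b, Q => 40 ≤ b ∧ Q (a.setSet d ∅) (b - 40)
  | .choice dst d, a, b, Q => 40 ≤ b ∧ (∀ v ∈ a.set d, Q (a.setReg dst v) (b - 40)) ∧
      (a.set d = ∅ → Q (a.setReg dst (a.reg 0)) (b - 40))
  | .seq p q, a, b, Q => dwp P inp p a b fun a' b' => dwp P inp q a' b' Q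
  | .ite c x y p q, a, b, Q => 1 ≤ b ∧ x.Fits w ∧ y.Fits w ∧
      (c.HoldsNat (a.val w x) (a.val w y) → dwp P inp p a (b - 1) Q) ∧
      (¬ c.HoldsNat (a.val w x) (a.val w y) → dwp P inp q a (b - 1) Q)
  | .ifMem d x p q, a, b, Q => 40 ≤ b ∧ a.reg x < P.U ∧
      (a.reg x ∈ a.set d → dwp P inp p a (b - 40) Q) ∧
      (a.reg x ∉ a.set d → dwp P inp q a (b - 40) Q)
  | .loop c x y p, a, b, Q => DRuns P inp (.loop c x y p) a b Q

namespace Rel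

theorem toNat_eval (h : Rel P σ a) {o : Operand 12} (ho : o.Fits w) :
    ((userOperand o).eval σ).toNat = a.val w o := by
  obtain ⟨ν, hσ, hν⟩ := h
  cases o with
  | reg i => exact (hσ.reg _).trans (hν.user i)
  | lit m => exact hσ.toNat_eval (o := .lit m) ho
  | width => exact hσ.toNat_eval (o := .width) trivial

theorem setReg (h : Rel P σ a) (i : Fin 12) {y : BitVec w} {v : ℕ} (hy : y.toNat = v) :
    Rel P (σ.setReg (user i) y) (a.setReg i v) := by
  obtain ⟨ν, hσ, hν⟩ := h
  exact ⟨_, hσ.setReg _ hy, hν.setReg _ _⟩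

theorem reg_lt (h : Rel P σ a) (i : Fin 12) : a.reg i < 2 ^ w := by
  obtain ⟨ν, hσ, hν⟩ := h
  rw [← hν.user, ← hσ.reg]
  exact BitVec.isLt _

end Rel

theorem runs_rel_of_runs {p : Prog 25 20} {m : ℕ} (hm : m ≤ b)
    (h : ∀ ν, Refines P ν a → a.reg 0 < 2 ^ w →
      Runs inp B Represents p ν m fun ν' _ => ∃ a', Refines P ν' a' ∧ Q a' (b - m)) :
    Runs inp B (Rel P) p a b Q := by
  intro σ hR
  obtain ⟨ν, hσ, hν⟩ := hR
  obtain ⟨σ', t, ν', b', hp, hσ', ht, a', ha', hQ⟩ := h ν hν (Rel.reg_lt ⟨ν, hσ, hν⟩ 0) σ hσ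
  exact ⟨σ', t, a', b - m, hp, ⟨ν', hσ', ha'⟩, by lia, hQ⟩

theorem runs_ifMemProg {p q : Prog 25 20} (hb : 40 ≤ b) (hx : a.reg x < P.U)
    (hp : a.reg x ∈ a.set d → Runs inp B (Rel P) p a (b - 40) Q)
    (hq : a.reg x ∉ a.set d → Runs inp B (Rel P) q a (b - 40) Q) :
    Runs inp B (Rel P) (ifMemProg d x p q) a b Q := by
  rintro σ ⟨ν, hσ, hν⟩
  obtain ⟨f, hf, hS⟩ := hν.dict d
  obtain ⟨σ₁, t₁, ν₁, b₁, hprobe, hσ₁, ht₁, hν₁, hacc⟩ :=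
    runs_probe (inp := inp) hν hx hf hS σ hσ
  have hR : Rel P σ₁ a := ⟨ν₁, hσ₁, hν.congr hν₁.eqOffScratch⟩
  have hmem : Cmp.Holds .eq ((Operand.reg acc).eval σ₁) ((Operand.lit 1).eval σ₁) ↔
      a.reg x ∈ a.set d := by
    rw [Cmp.holds_iff_holdsNat, hσ₁.toNat_eval (o := .reg acc) trivial,
      hσ₁.toNat_eval (o := .lit 1) P.one_lt_two_pow]
    exact hacc
  by_cases h : a.reg x ∈ a.set d
  · obtain ⟨σ₂, t₂, a₂, b₂, hrun, hσ₂, ht₂, hQ⟩ := hp h σ₁ hR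
    exact ⟨σ₂, _, a₂, b₂, .seq hprobe (.ite_true (hmem.2 h) hrun), hσ₂, by lia, hQ⟩
  · obtain ⟨σ₂, t₂, a₂, b₂, hrun, hσ₂, ht₂, hQ⟩ := hq h σ₁ hR
    exact ⟨σ₂, _, a₂, b₂, .seq hprobe (.ite_false (mt hmem.1 h) hrun), hσ₂, by lia, hQ⟩

namespace DRuns

theorem ite {c : Cmp} {x y : Operand 12} {p q : DictProg} (hb : 1 ≤ b) (hx : x.Fits w)
    (hy : y.Fits w) (hp : c.HoldsNat (a.val w x) (a.val w y) → DRuns P inp p a (b - 1) Q)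
    (hq : ¬ c.HoldsNat (a.val w x) (a.val w y) → DRuns P inp q a (b - 1) Q) :
    DRuns P inp (.ite c x y p q) a b Q :=
  Runs.ite (fun _ hσ => hσ.toNat_eval hx) (fun _ hσ => hσ.toNat_eval hy) hb hp hq

theorem of_dwp {p : DictProg} (h : dwp P inp p a b Q) : DRuns P inp p a b Q := by
  induction p generalizing a b Q with
  | skip => exact .of_exec_one h.1 (fun σ hσ => ⟨σ, .skip σ, hσ⟩) h.2
  | op dst o x y =>
    obtain ⟨hb, hx, hy, ho, hQ⟩ := h
    refine .of_exec_one hb (fun σ hσ => ⟨_, .op σ _ o _ _, hσ.setReg dst ?_⟩) hQ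
    rw [← hσ.toNat_eval hx, ← hσ.toNat_eval hy] at ho ⊢
    exact o.toNat_eval ho
  | read dst addr =>
    obtain ⟨hb, hx, v, hv, hQ⟩ := h
    rw [List.getElem?_map, Option.map_eq_some_iff] at hv
    obtain ⟨y, hy, rfl⟩ := hv
    refine .of_exec_one hb (fun σ hσ => ⟨_, .read σ _ _ y ?_, hσ.setReg dst rfl⟩) hQ
    rwa [hσ.toNat_eval hx]
  | insert d x =>
    exact runs_rel_of_runs h.1 fun ν hν _ =>
      (runs_insertProg hν h.2.1).mono fun ν' _ hν' => ⟨_, hν', h.2.2⟩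
  | erase d x =>
    exact runs_rel_of_runs h.1 fun ν hν _ =>
      (runs_eraseProg hν h.2.1).mono fun ν' _ hν' => ⟨_, hν', h.2.2⟩
  | clear d =>
    exact runs_rel_of_runs h.1 fun ν hν _ =>
      (runs_clearProg P).mono fun ν' _ hν' => ⟨_, hν.setSet hν' (.zero _), h.2⟩
  | choice dst d =>
    refine runs_rel_of_runs h.1 fun ν hν hn => (runs_choiceProg hν hn).mono fun ν' _ hν' => ?_
    obtain ⟨v, hv, hν'⟩ | ⟨hd, hν'⟩ := hν'
    · exact ⟨_, hν', h.2.1 v hv⟩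
    · exact ⟨_, hν', h.2.2 hd⟩
  | seq p q ihp ihq => exact .seq ((ihp h).mono fun _ _ h' => ihq h')
  | ite c x y p q ihp ihq =>
    obtain ⟨hb, hx, hy, hp, hq⟩ := h
    exact .ite hb hx hy (fun hc => ihp (hp hc)) (fun hc => ihq (hq hc))
  | ifMem d x p q ihp ihq =>
    exact runs_ifMemProg h.1 h.2.1 (fun hm => ihp (h.2.2.1 hm)) (fun hm => ihq (h.2.2.2 hm))
  | _ => exact h

theorem frame {p : DictProg} {m : ℕ} (h : DRuns P inp p a m Q) (hm : m ≤ b)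
    (hQ : ∀ a' b', Q a' b' → Q' a' (b' + (b - m))) : DRuns P inp p a b Q' := by
  intro σ hσ
  obtain ⟨σ', t, a', b', hp, hσ', ht, hab⟩ := h σ hσ
  exact ⟨σ', t, a', _, hp, hσ', by lia, hQ _ _ hab⟩

theorem seq {p q : DictProg} (h : DRuns P inp p a b fun a' b' => DRuns P inp q a' b' Q) :
    DRuns P inp (p ;;; q) a b Q :=
  Runs.seq h

theorem loop {I : DictState → ℕ → Prop} {c : Cmp} {x y : Operand 12} {p : DictProg}
    (hx : x.Fits w) (hy : y.Fits w) (hb : ∀ a b, I a b → 0 < b)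
    (hp : ∀ a b, I a b → c.HoldsNat (a.val w x) (a.val w y) → DRuns P inp p a (b - 1) I)
    (ha : I a b) :
    DRuns P inp (.loop c x y p) a b fun a' b' =>
      I a' (b' + 1) ∧ ¬ c.HoldsNat (a'.val w x) (a'.val w y) :=
  Runs.loop (fun a _ _ σ hσ => by rw [c.holds_iff_holdsNat, hσ.toNat_eval hx, hσ.toNat_eval hy])
    hb hp ha

theorem iterate {I : ℕ → DictState → Prop} {c : Cmp} {x y : Operand 12} {p : DictProg} {m n : ℕ}
    (hx : x.Fits w) (hy : y.Fits w)
    (hc : ∀ i a, I i a → (c.HoldsNat (a.val w x) (a.val w y) ↔ i < n))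
    (hp : ∀ i < n, ∀ a, I i a → DRuns P inp p a m fun a' _ => I (i + 1) a') (ha : I 0 a) :
    DRuns P inp (.loop c x y p) a ((m + 1) * n + 1) fun a' _ => I n a' :=
  Runs.iterate (fun i a ha σ hσ => by
    rw [c.holds_iff_holdsNat, hσ.toNat_eval hx, hσ.toNat_eval hy, hc i a ha]) hp n.zero_le ha

end DRuns

end DictMachine

/-! ### Initialization of the dictionaries -/

namespace DictMachine

open WordRAM

/-- The binary logarithm of the square root of the word length of the dictionaries: the word length
`4 ^ logRoot n w` is, up to a constant factor, the minimum of `w` and `n`. -/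
def logRoot (n w : ℕ) : ℕ := max 1 (Nat.clog 4 (min w n / 4 + 1))

/-- The number of words of the dictionaries. -/
def numWords (n w : ℕ) : ℕ := 2 * n / 4 ^ logRoot n w + 1

variable {n w B j : ℕ}

theorem one_le_logRoot : 1 ≤ logRoot n w := le_max_left ..

theorem lt_logRoot_iff (hj : 1 ≤ j) : j < logRoot n w ↔ 4 ^ j < min w n / 4 + 1 := by
  rw [logRoot, lt_max_iff, Nat.lt_clog_iff_pow_lt (by norm_num)]
  lia

theorem four_pow_logRoot_le : 4 ^ logRoot n w ≤ max 4 (min w n) := by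
  obtain h | h := one_le_logRoot.eq_or_lt (b := logRoot n w)
  · rw [← h]
    exact le_max_left ..
  · have := (lt_logRoot_iff (n := n) (w := w) (j := logRoot n w - 1) (by lia)).1 (by lia)
    have hpow : 4 ^ logRoot n w = 4 ^ (logRoot n w - 1) * 4 := by
      rw [← pow_succ, Nat.sub_add_cancel one_le_logRoot]
    lia

theorem min_lt_four_mul_pow_logRoot : min w n < 4 * 4 ^ logRoot n w := by
  have := (lt_logRoot_iff (n := n) (w := w) one_le_logRoot).not.1 (lt_irrefl _)
  lia

theorem numWords_mul_le (n w : ℕ) : numWords n w * w ≤ 8 * n + 9 * w := by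
  have hmin := min_lt_four_mul_pow_logRoot (n := n) (w := w)
  have hdiv := Nat.div_mul_le_self (2 * n) (4 ^ logRoot n w)
  rw [numWords, add_mul]
  obtain hw | hn := min_lt_iff.1 hmin
  · have := Nat.mul_le_mul_left (2 * n / 4 ^ logRoot n w) hw.le
    lia
  · have : 2 * n / 4 ^ logRoot n w < 8 := (Nat.div_lt_iff_lt_mul (by positivity)).2 (by lia)
    have := Nat.mul_le_mul_right w this.le
    lia

/-- The parameters for trees with `n` nodes. -/
def mkParams (n w : ℕ) (hw : 4 ≤ w) (hnw : 2 * n + w < 2 ^ w) : Params w (numWords n w) where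
  κ := logRoot n w
  m := numWords n w
  one_le := one_le_logRoot
  W_le := four_pow_logRoot_le.trans (by lia)
  m_le := le_rfl
  B_pos := Nat.succ_pos _
  U_lt := by
    have := four_pow_logRoot_le (n := n) (w := w)
    have := Nat.div_mul_le_self (2 * n) (4 ^ logRoot n w)
    rw [numWords, add_mul]
    lia

theorem le_mkParams_U (hw : 4 ≤ w) (hnw : 2 * n + w < 2 ^ w) : 2 * n ≤ (mkParams n w hw hnw).U := by
  have hlt := Nat.lt_div_mul_add (a := 2 * n) (b := 4 ^ logRoot n w) (by positivity)
  have hU : (mkParams n w hw hnw).U = (2 * n / 4 ^ logRoot n w + 1) * 4 ^ logRoot n w := rfl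
  rw [hU, add_mul]
  lia

/-- Reads `n` and computes the bound for the search for the word length. -/
def boundProg : Prog 25 20 :=
  .read (user 0) (.lit 0) ;;
  .ite .lt .width (.reg (user 0)) (.op (scratch 0) .shr .width (.lit 2))
    (.op (scratch 0) .shr (.reg (user 0)) (.lit 2)) ;;
  .op (scratch 0) .add (.reg (scratch 0)) (.lit 1) ;;
  .op (const 1) .add (.lit 4) (.lit 0) ;;
  .op (const 2) .add (.lit 1) (.lit 0)

/-- Determines the word length of the dictionaries. -/
def wordLengthLoop : Prog 25 20 :=
  .while .lt (.reg (const 1)) (.reg (scratch 0))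
    (.op (const 1) .shl (.reg (const 1)) (.lit 2) ;;
      .op (const 2) .add (.reg (const 2)) (.lit 1))

/-- Computes the constants that are not repunits. -/
def maskProg : Prog 25 20 :=
  .op (const 0) .add (.reg (const 2)) (.reg (const 2)) ;;
  .op (scratch 2) .shl (.lit 1) (.reg (const 2)) ;;
  .op (scratch 3) .add (.reg (scratch 2)) (.lit 1) ;;
  .op (const 5) .shl (.lit 1) (.reg (scratch 2)) ;;
  .op (const 5) .sub (.reg (const 5)) (.lit 1) ;;
  .op (const 6) .shl (.lit 1) (.reg (scratch 3)) ;;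
  .op (const 6) .sub (.reg (const 6)) (.lit 1) ;;
  .op (const 3) .add (.lit 0) (.lit 0) ;;
  .op (const 4) .add (.lit 0) (.lit 0) ;;
  .op (scratch 1) .add (.lit 0) (.lit 0)

/-- Computes the repunits. -/
def repunitLoop : Prog 25 20 :=
  .while .lt (.reg (scratch 1)) (.reg (scratch 2))
    (.op (const 3) .shl (.reg (const 3)) (.reg (scratch 2)) ;;
      .op (const 3) .add (.reg (const 3)) (.lit 1) ;;
      .op (const 4) .shl (.reg (const 4)) (.reg (scratch 3)) ;;
      .op (const 4) .add (.reg (const 4)) (.lit 1) ;;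
      .op (scratch 1) .add (.reg (scratch 1)) (.lit 1))

/-- Computes the constants. -/
def constProg : Prog 25 20 := boundProg ;; wordLengthLoop ;; maskProg ;; repunitLoop

/-- Empties the dictionaries in the list. -/
def clearAll : List (Fin 5) → Prog 25 20
  | [] => .skip
  | d :: ds => clearProg d ;; clearAll ds

/-- Computes the constants and empties the dictionaries. -/
def setupProg : Prog 25 20 := constProg ;; clearAll (List.finRange 5)

variable {inp : List (BitVec w)} {ν : NatState 25 20}

theorem lt_two_pow_of_lt_sixteen {i : ℕ} (hw : 4 ≤ w) (hi : i < 16) : i < 2 ^ w :=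
  hi.trans_le (Nat.pow_le_pow_right (n := 2) two_pos hw)

theorem runs_boundProg (hw : 4 ≤ w) (hinp : (inp.map BitVec.toNat)[0]? = some n) :
    Runs inp B Represents boundProg ν 6 fun ν' _ => ν'.reg (user 0) = n ∧
      ν'.reg (const 1) = 4 ∧ ν'.reg (const 2) = 1 ∧ ν'.reg (scratch 0) = min w n / 4 + 1 := by
  have hlit := fun i => lt_two_pow_of_lt_sixteen (i := i) hw
  have hlt : w / 4 + 1 < 2 ^ w := by have := Nat.lt_two_pow_self (n := w); lia
  refine .of_wp ⟨by norm_num, hlit 0 (by norm_num), n, hinp, by norm_num, trivial, trivial,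
    fun hc => ?_, fun hc => ?_⟩
  all_goals
    simp only [Cmp.HoldsNat, Operand.val, NatState.reg_setReg_self] at hc
    simp [wp, Operand.Fits, Operand.val, BinOp.Fits, BinOp.val, hlit]
    lia

theorem runs_wordLengthLoop (hw : 4 ≤ w) (h₀ : ν.reg (user 0) = n) (h₁ : ν.reg (const 1) = 4)
    (h₂ : ν.reg (const 2) = 1) (h₃ : ν.reg (scratch 0) = min w n / 4 + 1) :
    Runs inp B Represents wordLengthLoop ν (3 * (logRoot n w - 1) + 1) fun ν' _ =>
      ν'.reg (user 0) = n ∧ ν'.reg (const 1) = 4 ^ logRoot n w ∧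
        ν'.reg (const 2) = logRoot n w := by
  refine .mono (.iterate (i := 1) (I := fun j ν => 1 ≤ j ∧ ν.reg (user 0) = n ∧
    ν.reg (const 1) = 4 ^ j ∧ ν.reg (const 2) = j ∧ ν.reg (scratch 0) = min w n / 4 + 1) ?_ ?_
    one_le_logRoot ?_) ?_
  · rintro j ν ⟨hj, -, h₁, -, h₃⟩ σ hσ
    rw [Cmp.holds_iff_holdsNat, lt_logRoot_iff hj]
    simp [Operand.eval, hσ.reg, h₁, h₃, Cmp.HoldsNat]
  · rintro j hlt ν ⟨hj, h₀, h₁, h₂, h₃⟩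
    have hpow := (lt_logRoot_iff hj).1 hlt
    have := Nat.lt_two_pow_self (n := w)
    have := Nat.lt_pow_self (n := j) (show 1 < 4 by norm_num)
    have h4 : 4 ^ j * 4 < 2 ^ w := by lia
    have hj1 : j + 1 < 2 ^ w := by lia
    have hlit := fun i => lt_two_pow_of_lt_sixteen (i := i) hw
    refine .of_wp ?_
    simp [wp, Operand.Fits, Operand.val, BinOp.Fits, BinOp.val, *, pow_succ]
  · simp [*]
  · rintro ν' - ⟨-, h₀, h₁, h₂, -⟩
    exact ⟨h₀, h₁, h₂⟩

/-- The constants are computed except for the repunits. -/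
structure Masked (P : Params w B) (n : ℕ) (ν : NatState 25 20) : Prop where
  user : ν.reg (user 0) = n
  const : ∀ i, i ≠ 3 → i ≠ 4 → ν.reg (const i) = P.constant i
  side : ν.reg (scratch 2) = P.s
  side_succ : ν.reg (scratch 3) = P.s + 1

theorem masked_iff {P : Params w B} : Masked P n ν ↔ ν.reg (DictMachine.user 0) = n ∧
    (∀ i, i ≠ 3 → i ≠ 4 → ν.reg (DictMachine.const i) = P.constant i) ∧
    ν.reg (scratch 2) = P.s ∧ ν.reg (scratch 3) = P.s + 1 :=
  ⟨fun ⟨h₁, h₂, h₃, h₄⟩ => ⟨h₁, h₂, h₃, h₄⟩, fun ⟨h₁, h₂, h₃, h₄⟩ => ⟨h₁, h₂, h₃, h₄⟩⟩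

theorem runs_maskProg (P : Params w B) (h₀ : ν.reg (user 0) = n) (h₁ : ν.reg (const 1) = P.W)
    (h₂ : ν.reg (const 2) = P.κ) :
    Runs inp B Represents maskProg ν 10 fun ν' _ => Masked P n ν' ∧
      ν'.reg (const 3) = 0 ∧ ν'.reg (const 4) = 0 ∧ ν'.reg (scratch 1) = 0 := by
  have hs := P.two_le_s
  have hκ : P.κ < P.s := Nat.lt_two_pow_self
  have hw := Nat.lt_two_pow_self (n := w)
  have hsw : 2 * P.s ≤ w := by
    refine (Nat.mul_le_mul_right P.s hs).trans ?_
    rw [P.s_mul_s]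
    exact P.W_le
  have hpow : 2 ^ P.s < 2 ^ w := Nat.pow_lt_pow_right one_lt_two (by lia)
  have hpow' : 2 ^ (P.s + 1) < 2 ^ w := Nat.pow_lt_pow_right one_lt_two (by lia)
  have hκw : 2 * P.κ < 2 ^ w := by lia
  have hs1 : P.s + 1 < 2 ^ w := by lia
  have hs0 : P.s < 2 ^ w := by lia
  have hconst : ∀ ν : NatState 25 20, (∀ i, i ≠ 3 → i ≠ 4 → ν.reg (const i) = P.constant i) ↔
      ν.reg (const 0) = 2 * P.κ ∧ ν.reg (const 1) = P.W ∧ ν.reg (const 2) = P.κ ∧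
        ν.reg (const 5) = 2 ^ P.s - 1 ∧ ν.reg (const 6) = 2 ^ (P.s + 1) - 1 := fun ν => by
    simp [Fin.forall_fin_succ, Params.constant]
  refine .of_wp ?_
  simp [maskProg, wp, Operand.Fits, Operand.val, BinOp.Fits, BinOp.val, masked_iff, P.two_pow_κ,
    P.one_lt_two_pow, Nat.one_le_two_pow, ← two_mul, *]

theorem runs_repunitLoop (P : Params w B) (h : Masked P n ν) (h₃ : ν.reg (const 3) = 0)
    (h₄ : ν.reg (const 4) = 0) (hj : ν.reg (scratch 1) = 0) :
    Runs inp B Represents repunitLoop ν (6 * P.s + 1) fun ν' _ =>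
      ν'.reg (user 0) = n ∧ ∀ i, ν'.reg (const i) = P.constant i := by
  refine .mono (.iterate (n := P.s) (i := 0) (I := fun j ν => Masked P n ν ∧
    ν.reg (const 3) = BitTricks.repunit P.s j ∧ ν.reg (const 4) = BitTricks.repunit (P.s + 1) j ∧
    ν.reg (scratch 1) = j) ?_ ?_ P.s.zero_le ?_) ?_
  · rintro j ν ⟨h, -, -, hj⟩ σ hσ
    simp [Cmp.holds_iff_holdsNat, Operand.eval, hσ.reg, hj, h.side, Cmp.HoldsNat]
  · rintro j hlt ν ⟨h, h₃, h₄, hj⟩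
    have hsq : P.s * P.s ≤ w := P.s_mul_s.trans_le P.W_le
    have hw := Nat.lt_two_pow_self (n := w)
    have hmul : (j + 1) * P.s ≤ P.s * P.s := Nat.mul_le_mul_right _ hlt
    have hs := P.two_le_s
    have h3 := (BitTricks.repunit_succ_lt (one_le_two.trans hs) j).trans_le
      (Nat.pow_le_pow_right two_pos (show j * P.s + 1 ≤ w by lia))
    have h4 := (BitTricks.repunit_succ_lt P.s.succ_pos j).trans_le
      (Nat.pow_le_pow_right two_pos (show j * (P.s + 1) + 1 ≤ w by lia))
    have hj1 : j + 1 < 2 ^ w := by nlinarith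
    have hlit := P.one_lt_two_pow
    simp only [BitTricks.repunit] at h3 h4
    refine .of_wp ?_
    simp_all [wp, Operand.Fits, Operand.val, BinOp.Fits, BinOp.val, masked_iff, BitTricks.repunit,
      (Nat.lt_succ_self _).trans h3, (Nat.lt_succ_self _).trans h4]
  · exact ⟨h, h₃, h₄, hj⟩
  · rintro ν' - ⟨h, h₃, h₄, -⟩
    refine ⟨h.user, fun i => ?_⟩
    obtain rfl | hi₃ := eq_or_ne i 3
    · exact h₃
    obtain rfl | hi₄ := eq_or_ne i 4
    · exact h₄
    exact h.const i hi₃ hi₄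

theorem runs_constProg (hw : 4 ≤ w) (hnw : 2 * n + w < 2 ^ w)
    (hinp : (inp.map BitVec.toNat)[0]? = some n) :
    Runs inp (numWords n w) Represents constProg ν (9 * n + 50) fun ν' _ => ν'.reg (user 0) = n ∧
      ∀ i, ν'.reg (const i) = (mkParams n w hw hnw).constant i := by
  set P := mkParams n w hw hnw
  have hκ : logRoot n w < P.s := Nat.lt_two_pow_self
  have hs := P.two_le_s
  have hW : P.s * P.s ≤ max 4 (min w n) := P.s_mul_s.trans_le four_pow_logRoot_le
  have hs_le : P.s ≤ n + 2 := by
    obtain h | h := hs.eq_or_lt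
    · lia
    · have : 3 * P.s ≤ P.s * P.s := Nat.mul_le_mul_right _ h
      lia
  refine .seq ((runs_boundProg hw hinp).frame (by lia) fun ν₁ ⟨h₀, h₁, h₂, h₃⟩ => ?_)
  refine .seq ((runs_wordLengthLoop hw h₀ h₁ h₂ h₃).frame (by lia) fun ν₂ ⟨h₀, h₁, h₂⟩ => ?_)
  refine .seq ((runs_maskProg P h₀ h₁ h₂).frame (by lia) fun ν₃ ⟨h, h₃, h₄, hj⟩ => ?_)
  exact (runs_repunitLoop P h h₃ h₄ hj).frame (by lia) fun _ => id

theorem runs_clearAll (P : Params w B) (ds : List (Fin 5)) :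
    Runs inp B Represents (clearAll ds) ν (40 * ds.length + 1) fun ν' _ =>
      (∀ i, (∀ j, i ≠ scratch j) → ν'.reg i = ν.reg i) ∧
        ∀ d, d ∈ ds ∨ StoresSet P ν d ∅ → StoresSet P ν' d ∅ := by
  induction ds generalizing ν with
  | nil => exact .of_wp (by simp [clearAll, wp])
  | cons d ds ih =>
    rw [List.length_cons]
    refine .seq ((runs_clearProg P).frame (by lia) fun ν₁ h₁ => ?_)
    refine (ih (ν := ν₁)).frame (by lia) fun ν₂ ⟨hreg, hset⟩ =>
      ⟨fun i hi => (hreg i hi).trans (h₁.reg i hi), fun d' hd' => hset d' ?_⟩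
    obtain rfl | hne := eq_or_ne d' d
    · exact .inr ⟨_, h₁.stores, .zero _⟩
    · simpa [hne, StoresSet, Stores, h₁.mem _ _ hne] using hd'

theorem runs_setupProg (hw : 4 ≤ w) (hnw : 2 * n + w < 2 ^ w)
    (hinp : (inp.map BitVec.toNat)[0]? = some n) :
    Runs inp (numWords n w) Represents setupProg ν (9 * n + 260) fun ν' _ =>
      ν'.reg (user 0) = n ∧
        Refines (mkParams n w hw hnw) ν' ⟨fun i => ν'.reg (user i), fun _ => ∅⟩ := by
  refine .seq ((runs_constProg hw hnw hinp).frame (by lia) fun ν₁ ⟨h₀, hc⟩ => ?_)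
  refine (runs_clearAll (mkParams n w hw hnw) _).frame (by rw [List.length_finRange]; lia)
    fun ν₂ ⟨hreg, hset⟩ => ⟨by simp [hreg, h₀], fun i => rfl, fun i => by simp [hreg, hc],
      fun d => hset d (.inl (List.mem_finRange d))⟩

end DictMachine

/-! ### Rooted trees -/

namespace RootedTree

variable {n h : ℕ} {G : SimpleGraph (Fin n)} {root u v c p : Fin n}

open Classical in
/-- The children of a node. -/
noncomputable def children (G : SimpleGraph (Fin n)) (root u : Fin n) : Finset (Fin n) :=
  {c | G.Adj u c ∧ G.dist root c = G.dist root u + 1}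

theorem mem_children :
    c ∈ children G root u ↔ G.Adj u c ∧ G.dist root c = G.dist root u + 1 := by
  simp [children]

theorem length_eq_dist_of_isPath (hG : G.IsTree) (p : G.Walk u v) (hp : p.IsPath) :
    p.length = G.dist u v := by
  obtain ⟨q, hq, hlen⟩ := hG.connected.exists_path_of_dist u v
  rw [← hlen, (hG.existsUnique_path u v).unique hp hq]

theorem isDesc_iff (hG : G.IsTree) :
    IsDesc G root u v ↔ G.dist root v = G.dist root u + G.dist u v := by
  constructor
  · rintro ⟨p, hp, hu⟩
    rw [← length_eq_dist_of_isPath hG p hp, ← length_eq_dist_of_isPath hG _ (hp.takeUntil hu),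
      ← length_eq_dist_of_isPath hG _ (hp.dropUntil hu), ← SimpleGraph.Walk.length_append,
      p.take_spec hu]
  · intro h
    obtain ⟨p, hp⟩ := hG.connected.exists_walk_length_eq_dist root u
    obtain ⟨q, hq⟩ := hG.connected.exists_walk_length_eq_dist u v
    refine ⟨p.append q, (p.append q).isPath_of_length_eq_dist ?_, ?_⟩
    · rw [SimpleGraph.Walk.length_append, hp, hq, h]
    · exact (SimpleGraph.Walk.mem_support_append_iff ..).2 (.inl p.end_mem_support)

theorem isDesc_self (hG : G.IsTree) (u : Fin n) : IsDesc G root u u := by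
  rw [isDesc_iff hG, G.dist_self, add_zero]

theorem isDesc_of_mem_children (hG : G.IsTree) (hc : c ∈ children G root u)
    (hv : IsDesc G root c v) : IsDesc G root u v ∧ G.dist u v = G.dist c v + 1 := by
  rw [isDesc_iff hG] at hv ⊢
  obtain ⟨hadj, hdist⟩ := mem_children.1 hc
  have huc : G.dist u c = 1 := SimpleGraph.dist_eq_one_iff_adj.2 hadj
  have := hG.connected.dist_triangle (u := u) (v := c) (w := v)
  have := hG.connected.dist_triangle (u := root) (v := u) (w := v)
  lia

theorem exists_child_of_isDesc (hG : G.IsTree) (hv : IsDesc G root u v) (hne : v ≠ u) :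
    ∃ c ∈ children G root u, IsDesc G root c v := by
  rw [isDesc_iff hG] at hv
  obtain ⟨p, hp⟩ := hG.connected.exists_walk_length_eq_dist u v
  cases p with
  | nil => exact absurd rfl hne
  | @cons _ c _ hadj q =>
    rw [SimpleGraph.Walk.length_cons] at hp
    have := SimpleGraph.dist_le q
    have huc : G.dist u c = 1 := SimpleGraph.dist_eq_one_iff_adj.2 hadj
    have := hG.connected.dist_triangle (u := root) (v := u) (w := c)
    have := hG.connected.dist_triangle (u := root) (v := c) (w := v)
    exact ⟨c, mem_children.2 ⟨hadj, by lia⟩, (isDesc_iff hG).2 (by lia)⟩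

theorem exists_isLeaf (hG : G.IsTree) (u : Fin n) :
    ∃ v, IsDesc G root u v ∧ IsLeaf G root v := by
  obtain ⟨v, hv, hmax⟩ := Set.exists_max_image {v | IsDesc G root u v} (G.dist u ·)
    (Set.toFinite _) ⟨u, isDesc_self hG u⟩
  refine ⟨v, hv, fun x hx => ?_⟩
  have hrv := (isDesc_iff hG).1 hv
  have hrx := (isDesc_iff hG).1 hx
  have := hG.connected.dist_triangle (u := u) (v := v) (w := x)
  have := hG.connected.dist_triangle (u := root) (v := u) (w := x)
  have := hmax x ((isDesc_iff hG).2 (by lia))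
  exact (hG.connected.dist_eq_zero_iff.1 (by lia : G.dist v x = 0)).symm

theorem dist_le_height (hd : IsDesc G root u v) (hl : IsLeaf G root v) :
    G.dist u v ≤ height G root u := by
  classical
  exact Finset.le_sup (f := (G.dist u ·)) (Finset.mem_filter.2 ⟨Finset.mem_univ _, hd, hl⟩)

theorem exists_dist_eq_height (hG : G.IsTree) (u : Fin n) :
    ∃ v, IsDesc G root u v ∧ IsLeaf G root v ∧ G.dist u v = height G root u := by
  classical
  obtain ⟨x, hd, hl⟩ := exists_isLeaf (root := root) hG u
  obtain ⟨v, hv, hdist⟩ := Finset.exists_mem_eq_sup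
    (Finset.univ.filter fun v => IsDesc G root u v ∧ IsLeaf G root v)
    ⟨x, Finset.mem_filter.2 ⟨Finset.mem_univ _, hd, hl⟩⟩ (G.dist u ·)
  obtain ⟨-, hd, hl⟩ := Finset.mem_filter.1 hv
  exact ⟨v, hd, hl, hdist.symm⟩

theorem height_eq_sup (hG : G.IsTree) (u : Fin n) :
    height G root u = (children G root u).sup fun c => height G root c + 1 := by
  refine le_antisymm ?_ (Finset.sup_le fun c hc => ?_)
  · obtain ⟨v, hd, hl, hdist⟩ := exists_dist_eq_height (root := root) hG u
    rw [← hdist]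
    obtain rfl | hne := eq_or_ne v u
    · rw [G.dist_self]
      exact Nat.zero_le _
    · obtain ⟨c, hc, hcv⟩ := exists_child_of_isDesc hG hd hne
      rw [(isDesc_of_mem_children hG hc hcv).2]
      exact (Nat.succ_le_succ (dist_le_height hcv hl)).trans
        (Finset.le_sup (f := fun c => height G root c + 1) hc)
  · obtain ⟨v, hd, hl, hdist⟩ := exists_dist_eq_height (root := root) hG c
    obtain ⟨huv, hsucc⟩ := isDesc_of_mem_children hG hc hd
    rw [← hdist, ← hsucc]
    exact dist_le_height huv hl

theorem height_lt_of_mem_children (hG : G.IsTree) (hc : c ∈ children G root u) :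
    height G root c < height G root u := by
  rw [height_eq_sup hG u]
  exact Finset.le_sup (f := fun c => height G root c + 1) hc

theorem height_le_iff (hG : G.IsTree) :
    height G root u ≤ h ↔ ∀ c ∈ children G root u, height G root c < h := by
  rw [height_eq_sup hG u, Finset.sup_le_iff]
  rfl

theorem mem_children_root : v ∈ children G root root ↔ G.Adj root v := by
  rw [mem_children, G.dist_self, zero_add, SimpleGraph.dist_eq_one_iff_adj, and_self]

theorem root_notMem_children (u : Fin n) : root ∉ children G root u := by
  rw [mem_children, G.dist_self]
  lia

theorem exists_parent (hG : G.IsTree) (hu : u ≠ root) :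
    ∃ p, u ∈ children G root p ∧ ∀ v, G.Adj u v ↔ v = p ∨ v ∈ children G root u := by
  obtain ⟨q, hq, hlen⟩ := hG.connected.exists_path_of_dist root u
  have hnil : ¬ q.Nil := fun h => hu h.eq.symm
  have hadj := q.adj_penultimate hnil
  refine ⟨q.penultimate, mem_children.2 ⟨hadj, ?_⟩, fun v => ⟨fun hv => ?_, ?_⟩⟩
  · have hdrop := length_eq_dist_of_isPath hG q.dropLast hq.dropLast
    have : q.length ≠ 0 := fun h => hnil (SimpleGraph.Walk.length_eq_zero_iff.1 h)
    rw [SimpleGraph.Walk.length_dropLast] at hdrop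
    lia
  · by_cases hs : v ∈ q.support
    · exact .inl (hG.isAcyclic.eq_penultimate_of_adj_end hq hv hs)
    · have hdist := length_eq_dist_of_isPath hG _ (hq.concat hs hv)
      rw [SimpleGraph.Walk.length_concat] at hdist
      exact .inr (mem_children.2 ⟨hv, by lia⟩)
  · rintro (rfl | hv)
    · exact hadj.symm
    · exact (mem_children.1 hv).1

theorem parent_notMem_children (h : u ∈ children G root p) : p ∉ children G root u := by
  rw [mem_children] at h ⊢
  lia

theorem parent_unique (hG : G.IsTree) {p' : Fin n} (h : u ∈ children G root p)
    (h' : u ∈ children G root p') : p = p' := by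
  have hu : u ≠ root := by
    rintro rfl
    exact root_notMem_children p h
  obtain ⟨q, -, hq⟩ := exists_parent hG hu
  have eq_of_mem {p} (hp : u ∈ children G root p) : p = q :=
    ((hq p).1 (mem_children.1 hp).1.symm).resolve_right (parent_notMem_children hp)
  rw [eq_of_mem h, eq_of_mem h']

variable {adj : Fin n → List (Fin n)}

theorem card_children (hG : G.IsTree) (ha : IsAdjacencyList G adj) (u : Fin n) :
    (children G root u).card = (adj u).length - if u = root then 0 else 1 := by
  have hmem (v : Fin n) : v ∈ (adj u).toFinset ↔ G.Adj u v := by rw [List.mem_toFinset, (ha u).2]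
  rw [← List.toFinset_card_of_nodup (ha u).1]
  split_ifs with hu
  · subst hu
    rw [Nat.sub_zero]
    congr 1
    ext v
    rw [hmem, mem_children_root]
  · obtain ⟨p, hp, hv⟩ := exists_parent hG hu
    rw [← Finset.card_erase_of_mem ((hmem p).2 ((hv p).2 (.inl rfl)))]
    congr 1
    ext v
    have := parent_notMem_children hp
    rw [Finset.mem_erase, hmem, hv]
    grind

theorem sum_length_adj (hG : G.IsTree) (ha : IsAdjacencyList G adj) :
    ∑ u, (adj u).length + 2 = 2 * n := by
  classical
  have hdeg (u : Fin n) : (adj u).length = G.degree u := by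
    rw [← List.toFinset_card_of_nodup (ha u).1, SimpleGraph.degree]
    congr 1
    ext v
    rw [List.mem_toFinset, (ha u).2, SimpleGraph.mem_neighborFinset]
  have hcard := hG.card_edgeFinset
  rw [Fintype.card_fin] at hcard
  rw [Finset.sum_congr rfl fun u _ => hdeg u, G.sum_degrees_eq_twice_card_edges]
  lia

end RootedTree

/-! ### The adjacency array -/

namespace RootedTree

variable {n i j : ℕ} {adj : Fin n → List (Fin n)} {root u v : Fin n}

/-- The number of entries of the adjacency array that precede the neighbors of node `i`. -/
def offset (adj : Fin n → List (Fin n)) (i : ℕ) : ℕ :=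
  (((List.finRange n).take i).map fun v => (adj v).length).sum

theorem offset_succ (adj : Fin n → List (Fin n)) (u : Fin n) :
    offset adj (u + 1) = offset adj u + (adj u).length := by
  rw [offset, offset, List.take_add_one, List.map_append, List.sum_append]
  simp

theorem offset_eq_sum (adj : Fin n → List (Fin n)) : offset adj n = ∑ u, (adj u).length := by
  rw [offset, List.take_of_length_le (by simp), Fin.sum_univ_def]

theorem offset_mono (adj : Fin n → List (Fin n)) : Monotone (offset adj) := by
  refine monotone_nat_of_le_succ fun i => ?_
  rw [offset, offset, List.take_add_one, List.map_append, List.sum_append]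
  exact Nat.le_add_right _ _

theorem offset_add_lt (hj : j < (adj u).length) : offset adj u + j < offset adj n := by
  have := offset_mono adj (Nat.succ_le_of_lt u.isLt)
  rw [Nat.succ_eq_add_one, offset_succ] at this
  lia

theorem eq_of_offset_add_eq (hi : i < (adj u).length) (hj : j < (adj v).length)
    (h : offset adj u + i = offset adj v + j) : u = v := by
  have lt_of_lt {u v : Fin n} {i : ℕ} (hi : i < (adj u).length) (huv : u < v) :
      offset adj u + i < offset adj v :=
    (Nat.add_lt_add_left hi _).trans_le (offset_succ adj u ▸ offset_mono adj huv)
  obtain huv | rfl | huv := lt_trichotomy u v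
  · have := lt_of_lt hi huv
    lia
  · rfl
  · have := lt_of_lt hj huv
    lia

theorem encode_eq (root : Fin n) (adj : Fin n → List (Fin n)) :
    encode root adj = [n, (root : ℕ)] ++ (List.range (n + 1)).map (offset adj) ++
      (List.finRange n).flatMap fun v => (adj v).map Fin.val := by
  have bind_pure_val (l : List (Fin n)) : (do let a ← l; pure (a : ℕ)) = l.map Fin.val :=
    List.flatMap_pure_eq_map ..
  simp only [encode, bind_pure_val, List.map_id_fun', id]
  rfl

theorem length_encode (root : Fin n) (adj : Fin n → List (Fin n)) :
    (encode root adj).length = n + 3 + offset adj n := by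
  rw [offset_eq_sum, encode_eq, Fin.sum_univ_def]
  simp only [List.length_append, List.length_flatMap, List.length_map, List.length_range,
    List.length_cons, List.length_nil]
  lia

theorem encode_zero (root : Fin n) (adj : Fin n → List (Fin n)) :
    (encode root adj)[0]? = some n := rfl

theorem encode_root (root : Fin n) (adj : Fin n → List (Fin n)) :
    (encode root adj)[1]? = some (root : ℕ) := rfl

theorem encode_offset (root : Fin n) (adj : Fin n → List (Fin n)) (hi : i ≤ n) :
    (encode root adj)[i + 2]? = some (offset adj i) := by
  have hlt : i < n + 1 := Nat.lt_succ_of_le hi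
  rw [encode_eq, List.append_assoc, List.getElem?_append_right (by simp),
    List.getElem?_append_left (by simpa using hlt)]
  simp [hlt]

theorem encode_adj (root : Fin n) (adj : Fin n → List (Fin n)) (hj : j < (adj u).length) :
    (encode root adj)[offset adj u + j + (n + 3)]? = some ((adj u)[j] : ℕ) := by
  set L := (List.finRange n).map fun v => (adj v).map Fin.val with hL
  have hoff (i : ℕ) : ((L.map List.length).take i).sum = offset adj i := by
    simp [hL, offset, List.map_take, Function.comp_def]
  have hblock := List.drop_take_succ_flatten_eq_getElem L u (by simp [hL])
  rw [hoff, hoff, offset_succ] at hblock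
  have hget := congrArg (·[j]?) hblock
  simp only [List.getElem?_drop, List.getElem?_take, Nat.add_lt_add_left hj] at hget
  rw [encode_eq, List.getElem?_append_right (by simp), List.flatMap_def]
  simpa [hL, hj] using hget

theorem map_toNat_inputWords {w : ℕ} (h : ∀ x ∈ encode root adj, x < 2 ^ w) :
    (inputWords w root adj).map BitVec.toNat = encode root adj := by
  rw [inputWords, List.map_map]
  exact (List.map_congr_left fun x hx => by simpa using Nat.mod_eq_of_lt (h x hx)).trans
    (List.map_id _)

theorem le_of_mem_encode {x : ℕ} (h : x ∈ encode root adj) : x ≤ n + offset adj n := by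
  simp only [encode_eq, List.mem_append, List.mem_map, List.mem_flatMap, List.mem_cons,
    List.not_mem_nil, or_false, List.mem_range] at h
  obtain ((rfl | rfl) | ⟨i, hi, rfl⟩) | ⟨v, -, u, -, rfl⟩ := h
  · lia
  · lia
  · exact (offset_mono adj (Nat.le_of_lt_succ hi)).trans (Nat.le_add_left _ _)
  · lia

end RootedTree

/-! ### Counters in binary -/

namespace HeightIterator

open Finset WordRAM DictMachine

attribute [local simp] dwp Operand.Fits DictState.val BinOp.Fits BinOp.val Cmp.HoldsNat

/-- The states agree outside of the registers in `rs` and the dictionaries in `ds`. -/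
structure EqOff (rs : Finset (Fin 12)) (ds : Finset (Fin 5)) (a a' : DictState) : Prop where
  reg : ∀ i ∉ rs, a'.reg i = a.reg i
  set : ∀ d ∉ ds, a'.set d = a.set d

namespace EqOff

variable {rs : Finset (Fin 12)} {ds : Finset (Fin 5)} {a a' : DictState}

theorem refl (a : DictState) : EqOff rs ds a a :=
  ⟨fun _ _ => rfl, fun _ _ => rfl⟩

theorem mono {rs' : Finset (Fin 12)} {ds' : Finset (Fin 5)} (h : EqOff rs ds a a')
    (hrs : rs ⊆ rs') (hds : ds ⊆ ds') : EqOff rs' ds' a a' :=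
  ⟨fun i hi => h.reg i fun hi' => hi (hrs hi'), fun d hd => h.set d fun hd' => hd (hds hd')⟩

theorem trans {a'' : DictState} (h : EqOff rs ds a a') (h' : EqOff rs ds a' a'') :
    EqOff rs ds a a'' :=
  ⟨fun i hi => (h'.reg i hi).trans (h.reg i hi), fun d hd => (h'.set d hd).trans (h.set d hd)⟩

@[simp] theorem setReg_iff {i : Fin 12} (hi : i ∈ rs) (x : ℕ) :
    EqOff rs ds a (a'.setReg i x) ↔ EqOff rs ds a a' := by
  have hreg (j) (hj : j ∉ rs) : (a'.setReg i x).reg j = a'.reg j :=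
    a'.reg_setReg_of_ne (ne_of_mem_of_not_mem hi hj).symm x
  exact ⟨fun h => ⟨fun j hj => (hreg j hj).symm.trans (h.reg j hj), h.set⟩,
    fun h => ⟨fun j hj => (hreg j hj).trans (h.reg j hj), h.set⟩⟩

@[simp] theorem setSet_iff {d : Fin 5} (hd : d ∈ ds) (S : Finset ℕ) :
    EqOff rs ds a (a'.setSet d S) ↔ EqOff rs ds a a' := by
  have hset (e) (he : e ∉ ds) : (a'.setSet d S).set e = a'.set e :=
    a'.set_setSet_of_ne (ne_of_mem_of_not_mem hd he).symm S
  exact ⟨fun h => ⟨h.reg, fun e he => (hset e he).symm.trans (h.set e he)⟩,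
    fun h => ⟨h.reg, fun e he => (hset e he).trans (h.set e he)⟩⟩

end EqOff

/-- The number `x` is stored in binary in the segment of length `l` that starts at `o` of the
characteristic function of `c`. -/
def StoresAt (c : Finset ℕ) (o l x : ℕ) : Prop :=
  ∀ i < l, o + i ∈ c ↔ x.testBit i = true

theorem StoresAt.congr {c c' : Finset ℕ} {o l x : ℕ} (h : StoresAt c o l x)
    (hc : ∀ i < l, o + i ∈ c' ↔ o + i ∈ c) : StoresAt c' o l x :=
  fun i hi => (hc i hi).trans (h i hi)

variable {w B : ℕ} {P : Params w B} {inp : List (BitVec w)} {a : DictState} {o l x M : ℕ}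

/-- Stores the number in register `10` in the segment of the counters between the bounds in the
registers `6` and `7`. -/
def fillLoop : DictProg :=
  .loop .lt (.reg 6) (.reg 7)
    (.op 11 .and (.reg 10) (.lit 1) ;;;
      .ite .eq (.reg 11) (.lit 1) (.insert 4 6) .skip ;;;
      .op 10 .shr (.reg 10) (.lit 1) ;;;
      .op 6 .add (.reg 6) (.lit 1))

theorem runs_fillLoop (h₆ : a.reg 6 = o) (h₇ : a.reg 7 = o + l) (h₁₀ : a.reg 10 = x)
    (hU : o + l ≤ P.U) (hl : o + l < 2 ^ w) :
    DRuns P inp fillLoop a (45 * l + 1) fun a' _ => EqOff {6, 10, 11} {4} a a' ∧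
      ∀ e, e ∈ a'.set 4 ↔ e ∈ a.set 4 ∨ ∃ i < l, o + i = e ∧ x.testBit i = true := by
  refine .frame (DRuns.iterate (m := 44) (n := l) (I := fun j a' => EqOff {6, 10, 11} {4} a a' ∧
    a'.reg 6 = o + j ∧ a'.reg 10 = x / 2 ^ j ∧
    ∀ e, e ∈ a'.set 4 ↔ e ∈ a.set 4 ∨ ∃ i < j, o + i = e ∧ x.testBit i = true)
    trivial trivial ?_ ?_ ?_) le_rfl fun a' _ h => ⟨h.1, h.2.2.2⟩
  · rintro j a' ⟨hoff, h₆', -, -⟩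
    have h₇' := hoff.reg 7 (by decide)
    simp [h₆', h₇', h₇]
  · rintro j hj a' ⟨hoff, h₆', h₁₀', hset⟩
    have hw := P.one_lt_two_pow
    have hbit : x.testBit j = true ↔ x / 2 ^ j % 2 = 1 := by
      simp [Nat.testBit, Nat.shiftRight_eq_div_pow]
    have hdiv : x / 2 ^ j / 2 = x / 2 ^ (j + 1) := by rw [Nat.div_div_eq_div_mul, pow_succ]
    have hoU : o + j < P.U := by lia
    have hol : o + j + 1 < 2 ^ w := by lia
    refine .of_dwp ?_
    simp +contextual [Nat.exists_lt_succ_right, ← add_assoc, or_comm, or_left_comm,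
      eq_comm (a := o + j), -Order.lt_add_one_iff, *]
  · simp [EqOff.refl, h₆, h₁₀]

theorem card_range_sdiff_insert {c : Finset ℕ} {e : ℕ} (he : e < M) (hc : e ∉ c) :
    #(range M \ insert e c) + 1 = #(range M \ c) := by
  rw [sdiff_insert, card_erase_add_one (by simp [he, hc])]

theorem card_range_sdiff_erase_le (c : Finset ℕ) (e : ℕ) :
    #(range M \ c.erase e) ≤ #(range M \ c) + 1 := by
  grw [← card_insert_le e]
  exact card_le_card fun i => by grind

/-- Decrements the number in the segment of the counters between the bounds in the registers `6`
and `7`, and sets register `10` to `1`, unless the number is `0`. -/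
def decrLoop : DictProg :=
  .loop .lt (.reg 6) (.reg 7)
    (.ifMem 4 6
      (.erase 4 6 ;;; .op 7 .add (.lit 0) (.lit 0) ;;; .op 10 .add (.lit 1) (.lit 0))
      (.insert 4 6 ;;; .op 6 .add (.reg 6) (.lit 1)))

/-- The borrow of a decrement has passed over the `j` lowest bits of the number `x`, which were `0`
and are `1` now. -/
structure Borrowing (c : Finset ℕ) (o l x j : ℕ) : Prop where
  testBit : ∀ i < j, x.testBit i = false
  mem : ∀ i < l, o + i ∈ c ↔ i < j ∨ x.testBit i = true

theorem Borrowing.storesAt_pred {c : Finset ℕ} {j : ℕ} (h : Borrowing c o l x j)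
    (hj : x.testBit j = true) : StoresAt (c.erase (o + j)) o l (x - 1) := by
  intro i hi
  have := h.testBit i
  have := h.mem i hi
  rw [BitTricks.testBit_pred hj h.testBit]
  grind

theorem Borrowing.succ {c : Finset ℕ} {j : ℕ} (h : Borrowing c o l x j)
    (hj : x.testBit j = false) : Borrowing (insert (o + j) c) o l x (j + 1) := by
  refine ⟨fun i hi => ?_, fun i hi => ?_⟩
  · obtain hi | rfl := Nat.lt_succ_iff_lt_or_eq.1 hi
    · exact h.testBit i hi
    · exact hj
  · have := h.mem i hi
    grind

theorem Borrowing.eq_zero {c : Finset ℕ} (h : Borrowing c o l x l) (hx : x < 2 ^ l) : x = 0 := by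
  refine Nat.eq_of_testBit_eq fun i => ?_
  have := h.testBit i
  have (hi : l ≤ i) := Nat.testBit_lt_two_pow (hx.trans_le (Nat.pow_le_pow_right two_pos hi))
  grind

theorem runs_decrLoop (h₆ : a.reg 6 = o) (h₇ : a.reg 7 = o + l) (h₁₀ : a.reg 10 = 0)
    (hM : o + l ≤ M) (hMU : M ≤ P.U) (hMw : M < 2 ^ w) (hx : x < 2 ^ l)
    (hc : StoresAt (a.set 4) o l x) :
    DRuns P inp decrLoop a (100 * #(range M \ a.set 4) + 200) fun a' b' =>
      EqOff {6, 7, 10} {4} a a' ∧ (∀ e ∉ Ico o (o + l), e ∈ a'.set 4 ↔ e ∈ a.set 4) ∧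
        (x = 0 ∧ a'.reg 10 = 0 ∨ x ≠ 0 ∧ a'.reg 10 = 1 ∧ StoresAt (a'.set 4) o l (x - 1)) ∧
        100 * #(range M \ a'.set 4) ≤ b' := by
  refine .frame (DRuns.loop (I := fun a' b' => EqOff {6, 7, 10} {4} a a' ∧
    (∀ e ∉ Ico o (o + l), e ∈ a'.set 4 ↔ e ∈ a.set 4) ∧
    ((∃ j ≤ l, Borrowing (a'.set 4) o l x j ∧ a'.reg 6 = o + j ∧ a'.reg 7 = o + l ∧
      a'.reg 10 = 0 ∧ 100 * #(range M \ a'.set 4) + 200 ≤ b') ∨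
    (x ≠ 0 ∧ a'.reg 7 = 0 ∧ a'.reg 10 = 1 ∧ StoresAt (a'.set 4) o l (x - 1) ∧
      100 * #(range M \ a'.set 4) + 1 ≤ b'))) trivial trivial ?_ ?_ ?_) le_rfl ?_
  · grind
  · rintro a' b ⟨hoff, hseg, ⟨j, hj, hbor, h₆', h₇', h₁₀', hb⟩ | ⟨-, h₇', -⟩⟩ hlt
    · have hlt : j < l := by simpa [h₆', h₇'] using hlt
      have hw := P.one_lt_two_pow
      have hU : o + j < P.U := by lia
      have hol : o + j + 1 < 2 ^ w := by lia
      have hIco : ∀ e ∉ Ico o (o + l), e ≠ o + j := by grind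
      have hmem : o + j ∈ a'.set 4 ↔ x.testBit j = true := by simpa using hbor.mem j hlt
      by_cases hbit : x.testBit j = true
      · have hcard := card_range_sdiff_erase_le (M := M) (a'.set 4) (o + j)
        have hne : x ≠ 0 := fun h => by simp [h] at hbit
        have hb' : 100 * #(range M \ (a'.set 4).erase (o + j)) + 1 ≤ b - 1 - 82 := by lia
        have := hbor.storesAt_pred hbit
        refine .frame (m := 82) (.of_dwp ?_) (by lia) fun _ _ => id
        simp_all
      · have hcard := card_range_sdiff_insert (show o + j < M by lia) (hmem.not.2 hbit)
        have hb' : 100 * #(range M \ insert (o + j) (a'.set 4)) + 200 ≤ b - 1 - 81 := by lia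
        have := hbor.succ (Bool.eq_false_iff.2 hbit)
        refine .frame (m := 81) (.of_dwp ?_) (by lia) fun _ _ => id
        simp_all [add_assoc]
    · simp [h₇'] at hlt
  · exact ⟨.refl a, fun _ _ => Iff.rfl, .inl ⟨0, by lia, ⟨by simp, by simpa [StoresAt] using hc⟩,
      h₆, h₇, h₁₀, le_rfl⟩⟩
  · rintro a' b ⟨⟨hoff, hseg, ⟨j, hj, hbor, h₆', h₇', h₁₀', hb⟩ | ⟨hx, -, h₁₀', hx', hb⟩⟩, hlt⟩
    · obtain rfl : j = l := hj.antisymm (by simpa [h₆', h₇'] using hlt)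
      exact ⟨hoff, hseg, .inl ⟨hbor.eq_zero hx, h₁₀'⟩, by lia⟩
    · exact ⟨hoff, hseg, .inr ⟨hx, h₁₀', hx'⟩, by lia⟩

end HeightIterator

/-! ### Access to the tree -/

namespace HeightIterator

open Finset WordRAM DictMachine RootedTree

attribute [local simp] dwp Operand.Fits DictState.val BinOp.Fits BinOp.val Cmp.HoldsNat

section Nodes

variable {n : ℕ}

/-- A set of nodes, as a set of numbers. -/
def nodes (D : Finset (Fin n)) : Finset ℕ :=
  D.map Fin.valEmbedding

@[simp] theorem val_mem_nodes {D : Finset (Fin n)} {u : Fin n} : (u : ℕ) ∈ nodes D ↔ u ∈ D :=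
  mem_map' _

theorem nodes_insert (u : Fin n) (D : Finset (Fin n)) :
    nodes (insert u D) = insert (u : ℕ) (nodes D) :=
  map_insert ..

theorem nodes_erase (D : Finset (Fin n)) (u : Fin n) :
    nodes (D.erase u) = (nodes D).erase (u : ℕ) :=
  map_erase ..

end Nodes

/-- The input memory holds the representation of a tree, and words and dictionaries are long
enough. -/
structure Setting {w B n : ℕ} (P : Params w B) (inp : List (BitVec w)) (root : Fin n)
    (adj : Fin n → List (Fin n)) : Prop where
  inp_eq : inp.map BitVec.toNat = encode root adj
  lt_two_pow : n + 3 + offset adj n < 2 ^ w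
  offset_le : offset adj n ≤ 2 * n
  U_le : 2 * n ≤ P.U

variable {w B n : ℕ} {P : Params w B} {inp : List (BitVec w)} {root u p : Fin n}
  {adj : Fin n → List (Fin n)} {a : DictState} {D : Finset (Fin n)} {x : Fin 12}

theorem Setting.lt_U (hS : Setting P inp root adj) (u : Fin n) : (u : ℕ) < P.U := by
  have := hS.U_le
  lia

theorem offset_add_length_le (adj : Fin n → List (Fin n)) (u : Fin n) :
    offset adj u + (adj u).length ≤ offset adj n := by
  rw [← offset_succ]
  exact offset_mono adj u.isLt

/-- Reads the bounds of the list of neighbors of the node in register `x`. -/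
def rangeProg (x : Fin 12) : DictProg :=
  .op 11 .add (.reg x) (.lit 2) ;;;
  .read 6 (.reg 11) ;;;
  .op 11 .add (.reg 11) (.lit 1) ;;;
  .read 7 (.reg 11)

theorem runs_rangeProg (hS : Setting P inp root adj) (hx : a.reg x = u) :
    DRuns P inp (rangeProg x) a 4 fun a' _ => EqOff {6, 7, 11} ∅ a a' ∧
      a'.reg 6 = offset adj u ∧ a'.reg 7 = offset adj u + (adj u).length := by
  have hlt := hS.lt_two_pow
  have h2 := encode_offset root adj u.isLt.le
  have h3 := encode_offset root adj u.isLt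
  rw [offset_succ] at h3
  have hw := P.one_lt_two_pow
  have hu : (u : ℕ) + 2 < 2 ^ w := by lia
  have hsucc : (u : ℕ) + 2 + 1 < 2 ^ w := by lia
  have := P.lt_two_pow_of_lt_sixteen (i := 2)
  refine .of_dwp ?_
  simp_all [rangeProg, hS.inp_eq, EqOff.refl]

/-- The outcome `x` of a search in the list `l` for a node that is not in `D`; it is `y` if there is
no such node. -/
def IsSearchResult (D : Finset (Fin n)) (y : ℕ) (l : List (Fin n)) (x : ℕ) : Prop :=
  (∀ v ∈ l, v ∈ D) ∧ x = y ∨ ∃ v ∈ l, v ∉ D ∧ x = v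

theorem IsSearchResult.append_of_mem {y z : ℕ} {l : List (Fin n)} {v : Fin n}
    (h : IsSearchResult D y l z) (hv : v ∈ D) : IsSearchResult D y (l ++ [v]) z := by
  grind [IsSearchResult]

theorem isSearchResult_append_of_notMem {y : ℕ} {v : Fin n} (l : List (Fin n)) (hv : v ∉ D) :
    IsSearchResult D y (l ++ [v]) v :=
  .inr ⟨v, by simp, hv, rfl⟩

/-- Looks for a neighbor that has not been deleted. -/
def searchLoop : DictProg :=
  .loop .lt (.reg 6) (.reg 7)
    (.op 11 .add (.reg 6) (.reg 9) ;;;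
      .read 5 (.reg 11) ;;;
      .ifMem 3 5 .skip (.op 8 .add (.reg 5) (.lit 0)) ;;;
      .op 6 .add (.reg 6) (.lit 1))

theorem runs_searchLoop (hS : Setting P inp root adj) (h₆ : a.reg 6 = offset adj u)
    (h₇ : a.reg 7 = offset adj u + (adj u).length) (h₉ : a.reg 9 = n + 3)
    (hD : a.set 3 = nodes D) :
    DRuns P inp searchLoop a (45 * (adj u).length + 1) fun a' _ => EqOff {5, 6, 8, 11} ∅ a a' ∧
      IsSearchResult D (a.reg 8) (adj u) (a'.reg 8) := by
  refine .frame (DRuns.iterate (m := 44) (n := (adj u).length)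
    (I := fun j a' => EqOff {5, 6, 8, 11} ∅ a a' ∧ a'.reg 6 = offset adj u + j ∧
      IsSearchResult D (a.reg 8) ((adj u).take j) (a'.reg 8))
    trivial trivial ?_ ?_ ?_) le_rfl fun a' _ h => ?_
  · rintro j a' ⟨hoff, h₆', -⟩
    have h₇' := hoff.reg 7 (by decide)
    simp [h₆', h₇', h₇]
  · rintro j hj a' ⟨hoff, h₆', hfound⟩
    have hlt := hS.lt_two_pow
    have h₉' := (hoff.reg 9 (by decide)).trans h₉
    have hD' := (hoff.set 3 (by decide)).trans hD
    have htake := List.take_succ_eq_append_getElem hj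
    have henc := encode_adj root adj hj
    have hoj := offset_add_lt hj
    generalize (adj u)[j] = v at htake henc
    have hw := P.one_lt_two_pow
    have hU := hS.lt_U v
    have hv : (v : ℕ) < 2 ^ w := by lia
    have hadd : offset adj u + j + (n + 3) < 2 ^ w := by lia
    have hsucc : offset adj u + (j + 1) < 2 ^ w := by lia
    rw [← hS.inp_eq, List.getElem?_map] at henc
    obtain ⟨c, hc, hcv⟩ := Option.map_eq_some_iff.1 henc
    have hmem := hfound.append_of_mem (v := v)
    have hnot := isSearchResult_append_of_notMem (D := D) (y := a.reg 8) (v := v)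
      ((adj u).take j)
    refine .of_dwp ?_
    simp +contextual [add_assoc _ j 1, *]
  · simp [EqOff.refl, h₆, IsSearchResult]
  · rw [List.take_length] at h
    exact ⟨h.1, h.2.2⟩

/-- Finds the neighbor of the node in register `4` that has not been deleted. -/
def findParentProg : DictProg :=
  rangeProg 4 ;;; .op 8 .add (.reg 0) (.lit 0) ;;; searchLoop

theorem runs_findParentProg (hS : Setting P inp root adj) (h₀ : a.reg 0 = n) (h₄ : a.reg 4 = u)
    (h₉ : a.reg 9 = n + 3) (hD : a.set 3 = nodes D) :
    DRuns P inp findParentProg a (45 * (adj u).length + 6) fun a' _ =>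
      EqOff {5, 6, 7, 8, 11} ∅ a a' ∧ IsSearchResult D n (adj u) (a'.reg 8) := by
  refine .seq ((runs_rangeProg hS h₄).frame (by lia) fun a₁ b₁ ⟨hoff, h₆, h₇⟩ => ?_)
  have hn : n < 2 ^ w := by have := hS.lt_two_pow; lia
  have h₀' := (hoff.reg 0 (by decide)).trans h₀
  refine .seq (.of_dwp ⟨by lia, trivial, Nat.two_pow_pos w, by simp [h₀', hn], ?_⟩)
  simp only [BinOp.val, DictState.val, h₀', add_zero]
  refine (runs_searchLoop (u := u) (D := D) hS (by simp [h₆]) (by simp [h₇])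
    (by simpa using (hoff.reg 9 (by decide)).trans h₉)
    (by simpa using (hoff.set 3 (by decide)).trans hD)).frame (by lia)
    fun a' _ ⟨hoff', hres⟩ => ⟨.trans ?_ (hoff'.mono (by decide) (by decide)), by simpa using hres⟩
  simpa using hoff.mono (by decide) (by decide)

/-- Decrements the counter of the node in register `8`, as in `decrLoop`. -/
def decrementProg : DictProg :=
  rangeProg 8 ;;; .op 10 .add (.lit 0) (.lit 0) ;;; decrLoop

theorem runs_decrementProg {x : ℕ} (hS : Setting P inp root adj) (h₈ : a.reg 8 = p)
    (hx : x < 2 ^ (adj p).length) (hc : StoresAt (a.set 4) (offset adj p) (adj p).length x) :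
    DRuns P inp decrementProg a (100 * #(range (offset adj n) \ a.set 4) + 205) fun a' b' =>
      EqOff {6, 7, 10, 11} {4} a a' ∧
        (∀ e ∉ Ico (offset adj p) (offset adj p + (adj p).length), e ∈ a'.set 4 ↔ e ∈ a.set 4) ∧
        (x = 0 ∧ a'.reg 10 = 0 ∨ x ≠ 0 ∧ a'.reg 10 = 1 ∧
          StoresAt (a'.set 4) (offset adj p) (adj p).length (x - 1)) ∧
        100 * #(range (offset adj n) \ a'.set 4) ≤ b' := by
  refine .seq ((runs_rangeProg hS h₈).frame (by lia) fun a₁ b₁ ⟨hoff, h₆, h₇⟩ => ?_)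
  refine .seq (.of_dwp ⟨by lia, Nat.two_pow_pos w, Nat.two_pow_pos w, by simp, ?_⟩)
  have hlt := hS.lt_two_pow
  have hset := hoff.set 4 (by decide)
  rw [← hset] at hc ⊢
  refine (runs_decrLoop (x := x) (by simp [h₆]) (by simp [h₇]) (by simp)
    (offset_add_length_le adj p) (hS.offset_le.trans hS.U_le) (by lia) hx (by simpa using hc)).frame
    (by simp) fun a' b' ⟨hoff', hseg, hres, hb⟩ =>
      ⟨.trans ?_ (hoff'.mono (by decide) (by decide)), by simpa using hseg, hres,
        hb.trans (Nat.le_add_right ..)⟩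
  simpa using hoff.mono (by decide) (by decide)

end HeightIterator

/-! ### Counters and ready nodes -/

namespace HeightIterator

open Finset WordRAM DictMachine RootedTree

attribute [local simp] dwp Operand.Fits DictState.val BinOp.Fits BinOp.val Cmp.HoldsNat

variable {w B n h : ℕ} {P : Params w B} {inp : List (BitVec w)} {G : SimpleGraph (Fin n)}
  {root u p : Fin n} {adj : Fin n → List (Fin n)} {a a' : DictState} {D : Finset (Fin n)}
  {c c' : Finset ℕ}

/-- The counter of a node holds the number of its children outside of `D`, decremented by one, as
long as there are any. -/
def Counters (G : SimpleGraph (Fin n)) (root : Fin n) (adj : Fin n → List (Fin n))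
    (D : Finset (Fin n)) (c : Finset ℕ) : Prop :=
  ∀ p, (children G root p \ D).Nonempty →
    StoresAt c (offset adj p) (adj p).length (#(children G root p \ D) - 1)

theorem children_sdiff_insert (hp : u ∉ children G root p) :
    children G root p \ insert u D = children G root p \ D := by
  grind

theorem card_children_sdiff_insert (hp : u ∈ children G root p) (hu : u ∉ D) :
    #(children G root p \ insert u D) = #(children G root p \ D) - 1 := by
  rw [sdiff_insert, card_erase_of_mem (mem_sdiff.2 ⟨hp, hu⟩)]

theorem card_children_sdiff_lt_two_pow (hG : G.IsTree) (ha : IsAdjacencyList G adj) (p : Fin n)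
    (D : Finset (Fin n)) : #(children G root p \ D) < 2 ^ (adj p).length := by
  refine (card_le_card sdiff_subset).trans_lt (lt_of_le_of_lt ?_ Nat.lt_two_pow_self)
  rw [card_children hG ha]
  exact Nat.sub_le ..

theorem Counters.insert_root (hc : Counters G root adj D c) :
    Counters G root adj (insert root D) c := by
  intro p
  rw [children_sdiff_insert (root_notMem_children p)]
  exact hc p

theorem Counters.insert (hG : G.IsTree) (hc : Counters G root adj D c)
    (hp : u ∈ children G root p)
    (hseg : ∀ e ∉ Ico (offset adj p) (offset adj p + (adj p).length), e ∈ c' ↔ e ∈ c)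
    (hx : (children G root p \ insert u D).Nonempty →
      StoresAt c' (offset adj p) (adj p).length (#(children G root p \ insert u D) - 1)) :
    Counters G root adj (insert u D) c' := by
  intro q hq
  obtain rfl | hqp := eq_or_ne q p
  · exact hx hq
  · rw [children_sdiff_insert fun hq' => hqp (parent_unique hG hq' hp)] at hq ⊢
    refine (hc q hq).congr fun i hi => hseg _ fun hmem => ?_
    obtain ⟨j, hj⟩ := Nat.exists_eq_add_of_le (mem_Ico.1 hmem).1
    exact hqp (eq_of_offset_add_eq hi (by grind) hj)

open Classical in
/-- The nodes of height greater than `h` whose children belong to `D`. -/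
noncomputable def readyNodes (G : SimpleGraph (Fin n)) (root : Fin n) (h : ℕ)
    (D : Finset (Fin n)) : Finset (Fin n) :=
  {v | h < height G root v ∧ children G root v ⊆ D}

theorem mem_readyNodes {v : Fin n} :
    v ∈ readyNodes G root h D ↔ h < height G root v ∧ children G root v ⊆ D := by
  simp [readyNodes]

theorem readyNodes_insert_root : readyNodes G root h (insert root D) = readyNodes G root h D := by
  ext v
  rw [mem_readyNodes, mem_readyNodes, subset_insert_iff_of_notMem (root_notMem_children v)]

theorem readyNodes_insert (hG : G.IsTree) (hp : u ∈ children G root p) (hu : u ∉ D)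
    (hh : height G root u = h) :
    readyNodes G root h (insert u D) =
      if children G root p ⊆ insert u D then insert p (readyNodes G root h D)
      else readyNodes G root h D := by
  have hlt := height_lt_of_mem_children hG hp
  ext v
  obtain rfl | hv := eq_or_ne v p
  · have hnot : ¬ children G root v ⊆ D := fun hsub => hu (hsub hp)
    split_ifs with hsub <;> simp [mem_readyNodes, hsub, hnot, ← hh, hlt]
  · have hsub := subset_insert_iff_of_notMem (t := D) fun hv' => hv (parent_unique hG hv' hp)
    split_ifs <;> simp [mem_readyNodes, hsub, hv]

/-- The ready nodes and the counters, while nodes of height `h` are deleted and `D` is the set of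
deleted nodes. -/
structure Tallies (G : SimpleGraph (Fin n)) (root : Fin n) (adj : Fin n → List (Fin n)) (h : ℕ)
    (D : Finset (Fin n)) (a : DictState) : Prop where
  ready : a.set 2 = nodes (readyNodes G root h D)
  counters : Counters G root adj D (a.set 4)

namespace Tallies

theorem congr (ht : Tallies G root adj h D a) (h₂ : a'.set 2 = a.set 2)
    (h₄ : a'.set 4 = a.set 4) : Tallies G root adj h D a' :=
  ⟨h₂.trans ht.ready, h₄ ▸ ht.counters⟩

theorem insert_root (ht : Tallies G root adj h D a) : Tallies G root adj h (insert root D) a :=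
  ⟨by rw [readyNodes_insert_root, ht.ready], ht.counters.insert_root⟩

end Tallies

/-- Decrements the counter of the parent in register `8` of a deleted node; the parent becomes ready
if it has no more children. -/
def notifyParentProg : DictProg :=
  decrementProg ;;; .ite .eq (.reg 10) (.lit 0) (.insert 2 8) .skip

theorem runs_notifyParentProg (hG : G.IsTree) (ha : IsAdjacencyList G adj)
    (hS : Setting P inp root adj) (ht : Tallies G root adj h D a) (hp : u ∈ children G root p)
    (hu : u ∉ D) (hh : height G root u = h) (h₈ : a.reg 8 = p) :
    DRuns P inp notifyParentProg a (100 * #(range (offset adj n) \ a.set 4) + 250) fun a' b' =>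
      EqOff {6, 7, 10, 11} {2, 4} a a' ∧ Tallies G root adj h (insert u D) a' ∧
        #(a'.set 2) ≤ #(a.set 2) + 1 ∧ 100 * #(range (offset adj n) \ a'.set 4) ≤ b' := by
  have hne : (children G root p \ D).Nonempty := ⟨u, mem_sdiff.2 ⟨hp, hu⟩⟩
  have hcard := card_children_sdiff_insert hp hu
  refine .seq ((runs_decrementProg (x := #(children G root p \ insert u D)) hS h₈
    (card_children_sdiff_lt_two_pow hG ha p _) (hcard ▸ ht.counters p hne)).frame
    (by lia) fun a₁ b₁ ⟨hoff, hseg, hres, hb⟩ => ?_)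
  have hU := hS.lt_U p
  have h₈' := (hoff.reg 8 (by decide)).trans h₈
  have h₂ := hoff.set 2 (by decide)
  have hready := readyNodes_insert hG hp hu hh
  have hcounters := ht.counters.insert hG hp hseg
  have hoff' : EqOff {6, 7, 10, 11} {2, 4} a a₁ := hoff.mono (by decide) (by decide)
  refine .frame (m := 41) (.of_dwp ?_) (by lia) fun _ _ => id
  obtain ⟨hx, h₁₀⟩ | ⟨hx, h₁₀, hst⟩ := hres
  · have hsub : children G root p ⊆ insert u D := by simpa [sdiff_eq_empty_iff_subset] using hx
    have ht' : Tallies G root adj h (insert u D) (a₁.setSet 2 (insert (p : ℕ) (a.set 2))) :=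
      ⟨by simp [hready, hsub, nodes_insert, ht.ready],
        hcounters fun hne' => absurd hx hne'.card_ne_zero⟩
    have hb' : 100 * #(range (offset adj n) \ a₁.set 4) ≤ b₁ + 4 := hb.trans (by lia)
    simp [h₁₀, h₈', hU, hoff', ht', h₂, hb', card_insert_le]
  · have hsub : ¬ children G root p ⊆ insert u D := by simpa [sdiff_eq_empty_iff_subset] using hx
    have ht' : Tallies G root adj h (insert u D) a₁ :=
      ⟨by simp [hready, hsub, h₂, ht.ready], hcounters fun _ => hst⟩
    have hb' : 100 * #(range (offset adj n) \ a₁.set 4) ≤ 39 + (b₁ + 4) := hb.trans (by lia)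
    simp [h₁₀, hoff', ht', h₂, hb']

end HeightIterator

/-! ### Deletion of the nodes of a level -/

namespace HeightIterator

open Finset WordRAM DictMachine RootedTree

attribute [local simp] dwp Operand.Fits DictState.val BinOp.Fits BinOp.val Cmp.HoldsNat

variable {w B n h : ℕ} {P : Params w B} {inp : List (BitVec w)} {G : SimpleGraph (Fin n)}
  {root u v p : Fin n} {adj : Fin n → List (Fin n)} {a a' : DictState} {D : Finset (Fin n)}
  {rs : Finset (Fin 12)} {ds : Finset (Fin 5)}

@[simp] theorem mem_level : v ∈ level G root h ↔ height G root v = h := by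
  simp [level]

theorem IsSearchResult.eq_parent {y x : ℕ} (hG : G.IsTree) (ha : IsAdjacencyList G adj)
    (hx : IsSearchResult D y (adj u) x) (hp : u ∈ children G root p) (hpD : p ∉ D)
    (hD : children G root u ⊆ D) : x = p := by
  obtain ⟨q, hq, hadj⟩ := exists_parent hG (root := root) (u := u)
    (by rintro rfl; exact root_notMem_children p hp)
  obtain rfl := parent_unique hG hp hq
  simp only [IsSearchResult, (ha u).2, hadj] at hx
  grind

theorem IsSearchResult.eq_default {y x : ℕ} (ha : IsAdjacencyList G adj)
    (hx : IsSearchResult D y (adj root) x) (hD : children G root root ⊆ D) : x = y := by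
  simp only [IsSearchResult, (ha root).2, ← mem_children_root] at hx
  grind

/-- The registers `0`, `1` and `9` contain the number of nodes, the root and the address of the
first list of neighbors in the input. -/
structure Std (root : Fin n) (a : DictState) : Prop where
  size : a.reg 0 = n
  root_eq : a.reg 1 = root
  base : a.reg 9 = n + 3

theorem Std.of_eqOff (hstd : Std root a) (hoff : EqOff rs ds a a')
    (hrs : Disjoint rs {0, 1, 9} := by decide) : Std root a' where
  size := (hoff.reg 0 fun hi => by simpa using disjoint_left.1 hrs hi).trans hstd.size
  root_eq := (hoff.reg 1 fun hi => by simpa using disjoint_left.1 hrs hi).trans hstd.root_eq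
  base := (hoff.reg 9 fun hi => by simpa using disjoint_left.1 hrs hi).trans hstd.base

/-- While the nodes of height `h` are deleted, `D` is the set of deleted nodes, the nodes of height
`h` in `D` have been handed over to the client, and those outside of `D` are still to be deleted. -/
structure Marks (G : SimpleGraph (Fin n)) (root : Fin n) (h : ℕ) (D : Finset (Fin n))
    (a : DictState) : Prop where
  mem_of_lt : ∀ v, height G root v < h → v ∈ D
  le_of_mem : ∀ v ∈ D, height G root v ≤ h
  client : a.set 0 = nodes (level G root h ∩ D)
  current : a.set 1 = nodes (level G root h \ D)
  deleted : a.set 3 = nodes D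

namespace Marks

theorem of_eqOff (hm : Marks G root h D a) (hoff : EqOff rs ds a a')
    (hds : Disjoint ds {0, 1, 3} := by decide) : Marks G root h D a' where
  mem_of_lt := hm.mem_of_lt
  le_of_mem := hm.le_of_mem
  client := (hoff.set 0 fun hi => by simpa using disjoint_left.1 hds hi).trans hm.client
  current := (hoff.set 1 fun hi => by simpa using disjoint_left.1 hds hi).trans hm.current
  deleted := (hoff.set 3 fun hi => by simpa using disjoint_left.1 hds hi).trans hm.deleted

theorem children_subset (hG : G.IsTree) (hm : Marks G root h D a) (hh : height G root u = h) :
    children G root u ⊆ D :=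
  fun c hc => hm.mem_of_lt c (hh ▸ height_lt_of_mem_children hG hc)

theorem parent_notMem (hG : G.IsTree) (hm : Marks G root h D a) (hp : u ∈ children G root p)
    (hh : height G root u = h) : p ∉ D :=
  fun hpD => (hm.le_of_mem p hpD).not_gt (hh ▸ height_lt_of_mem_children hG hp)

end Marks

/-- Deletes the node in register `4` and hands it over to the client. -/
def markProg : DictProg :=
  .erase 1 4 ;;; .insert 0 4 ;;; .insert 3 4

theorem runs_markProg (hS : Setting P inp root adj) (hm : Marks G root h D a)
    (hh : height G root u = h) (h₄ : a.reg 4 = u) :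
    DRuns P inp markProg a 120 fun a' _ => EqOff ∅ {0, 1, 3} a a' ∧
      Marks G root h (insert u D) a' := by
  have hU := hS.lt_U u
  have hm' : Marks G root h (insert u D) (((a.setSet 1 ((a.set 1).erase u)).setSet 0
      (insert (u : ℕ) (a.set 0))).setSet 3 (insert (u : ℕ) (a.set 3))) :=
    { mem_of_lt := fun v hv => mem_insert_of_mem (hm.mem_of_lt v hv)
      le_of_mem := by simpa [hh] using hm.le_of_mem
      client := by simp [hm.client, inter_insert_of_mem, hh, nodes_insert]
      current := by simp [hm.current, sdiff_insert, nodes_erase]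
      deleted := by simp [hm.deleted, nodes_insert] }
  refine .of_dwp ?_
  simp [markProg, h₄, hU, hm', EqOff.refl]

/-- The state while the nodes of height `h` are deleted; `D` is the set of deleted nodes. -/
structure Round (G : SimpleGraph (Fin n)) (root : Fin n) (adj : Fin n → List (Fin n)) (h : ℕ)
    (D : Finset (Fin n)) (a : DictState) : Prop where
  std : Std root a
  marks : Marks G root h D a
  tallies : Tallies G root adj h D a

/-- The number of steps that are reserved for the deletion of the nodes outside of `D`. -/
def weight (adj : Fin n → List (Fin n)) (D : Finset (Fin n)) : ℕ :=
  ∑ v ∈ Dᶜ, (50 * (adj v).length + 2000)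

theorem weight_insert (hu : u ∉ D) :
    weight adj D = weight adj (insert u D) + (50 * (adj u).length + 2000) := by
  rw [weight, weight, compl_insert, sum_erase_add _ _ (mem_compl.2 hu)]

/-- The number of steps that are reserved for the rest of the iteration. Every `0` of a counter pays
for its next change to `1`, and every ready node pays for its move to the current level. -/
def potential (adj : Fin n → List (Fin n)) (D : Finset (Fin n)) (a : DictState) : ℕ :=
  weight adj D + 100 * #(range (offset adj n) \ a.set 4) + 200 * #(a.set 2)

/-- Deletes the node in register `4`. -/
def deleteProg : DictProg :=
  markProg ;;; findParentProg ;;; .ite .lt (.reg 8) (.reg 0) notifyParentProg .skip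

theorem runs_deleteProg (hG : G.IsTree) (ha : IsAdjacencyList G adj) (hS : Setting P inp root adj)
    (hr : Round G root adj h D a) (hu : u ∈ level G root h \ D) (h₄ : a.reg 4 = u) :
    DRuns P inp deleteProg a (potential adj D a) fun a' b' =>
      Round G root adj h (insert u D) a' ∧ potential adj (insert u D) a' + 1000 ≤ b' := by
  obtain ⟨hh, hu⟩ : height G root u = h ∧ u ∉ D := by simpa using hu
  have hweight := weight_insert (adj := adj) hu
  have hpot : potential adj D a = weight adj D + _ + _ := rfl
  refine .seq ((runs_markProg hS hr.marks hh h₄).frame (by lia) fun a₁ b₁ ⟨hoff₁, hm₁⟩ => ?_)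
  have hstd₁ := hr.std.of_eqOff hoff₁
  refine .seq ((runs_findParentProg hS hstd₁.size ((hoff₁.reg 4 (by decide)).trans h₄) hstd₁.base
    hm₁.deleted).frame (by lia) fun a₂ b₂ ⟨hoff₂, hres⟩ => ?_)
  have hstd₂ := hstd₁.of_eqOff hoff₂
  have hm₂ := hm₁.of_eqOff hoff₂
  have hset₂ : a₂.set 2 = a.set 2 :=
    (hoff₂.set 2 (by decide)).trans (hoff₁.set 2 (by decide))
  have hset₄ : a₂.set 4 = a.set 4 :=
    (hoff₂.set 4 (by decide)).trans (hoff₁.set 4 (by decide))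
  have ht₂ := hr.tallies.congr hset₂ hset₄
  have hsub := hm₂.children_subset hG hh
  obtain rfl | hroot := eq_or_ne u root
  · have h₈ := hres.eq_default ha hsub
    refine .ite (by lia) trivial trivial (fun hlt => ?_) fun _ => .of_dwp ⟨by lia, ?_, ?_⟩
    · simp [h₈, hstd₂.size] at hlt
    · exact ⟨hstd₂, hm₂, ht₂.insert_root⟩
    · rw [potential, hset₂, hset₄]
      lia
  · obtain ⟨p, hp, -⟩ := exists_parent hG hroot
    have h₈ := hres.eq_parent hG ha hp (hm₂.parent_notMem hG hp hh) hsub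
    refine .ite (by lia) trivial trivial (fun _ => ?_) fun hlt => ?_
    · rw [← hset₂, ← hset₄] at hpot
      refine (runs_notifyParentProg hG ha hS ht₂ hp hu hh h₈).frame (by lia)
        fun a₃ b₃ ⟨hoff₃, ht₃, hcard, hb⟩ =>
          ⟨⟨hstd₂.of_eqOff hoff₃, hm₂.of_eqOff hoff₃, ht₃⟩, ?_⟩
      grw [potential, hcard, hb]
      lia
    · simp [h₈, hstd₂.size] at hlt

end HeightIterator

/-! ### The next level -/

namespace HeightIterator

open Finset WordRAM DictMachine RootedTree

attribute [local simp] dwp Operand.Fits DictState.val BinOp.Fits BinOp.val Cmp.HoldsNat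

section Choice

variable {w B n : ℕ} {P : Params w B} {inp : List (BitVec w)} {a : DictState}

/-- The outcome `x` of the operation `choice` on the set `S`, where `n` stands for failure. -/
def IsChoice (n : ℕ) (S : Finset ℕ) (x : ℕ) : Prop :=
  x ∈ S ∨ S = ∅ ∧ x = n

theorem IsChoice.lt_iff {S : Finset ℕ} {x : ℕ} (hx : IsChoice n S x) (hS : ∀ y ∈ S, y < n) :
    x < n ↔ x ∈ S := by
  obtain hx | ⟨rfl, rfl⟩ := hx
  · exact ⟨fun _ => hx, hS x⟩
  · simp

theorem IsChoice.nonempty_iff {S : Finset ℕ} {x : ℕ} (hx : IsChoice n S x) (hS : ∀ y ∈ S, y < n) :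
    S.Nonempty ↔ x < n := by
  rw [hx.lt_iff hS]
  obtain hx | ⟨rfl, rfl⟩ := hx
  · exact ⟨fun _ => hx, fun _ => ⟨x, hx⟩⟩
  · simp

theorem runs_choice (y : Fin 12) (d : Fin 5) (h₀ : a.reg 0 = n) :
    DRuns P inp (.choice y d) a 40 fun a' _ =>
      EqOff {y} ∅ a a' ∧ IsChoice n (a.set d) (a'.reg y) := by
  refine .of_dwp ?_
  simp +contextual [EqOff.refl, IsChoice, h₀]

/-- Moves the set `2` into the set `1`; register `4` contains an element of the set `2`. -/
def moveLoop : DictProg :=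
  .loop .lt (.reg 4) (.reg 0) (.erase 2 4 ;;; .insert 1 4 ;;; .choice 4 2)

theorem runs_moveLoop (h₀ : a.reg 0 = n) (h₄ : IsChoice n (a.set 2) (a.reg 4))
    (hn : ∀ x ∈ a.set 2, x < n) (hU : n ≤ P.U) :
    DRuns P inp moveLoop a (200 * #(a.set 2) + 1) fun a' _ =>
      EqOff {4} {1, 2} a a' ∧ a'.set 1 = a.set 1 ∪ a.set 2 ∧ a'.set 2 = ∅ := by
  refine .frame (DRuns.loop (I := fun a' b' => EqOff {4} {1, 2} a a' ∧
    a'.set 1 ∪ a'.set 2 = a.set 1 ∪ a.set 2 ∧ a'.set 2 ⊆ a.set 2 ∧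
    IsChoice n (a'.set 2) (a'.reg 4) ∧ 200 * #(a'.set 2) + 1 ≤ b')
    trivial trivial ?_ ?_ ?_) le_rfl ?_
  · grind
  · rintro a' b ⟨hoff, hunion, hsub, hx, hb⟩ hlt
    have h₀' := (hoff.reg 0 (by decide)).trans h₀
    have hmem : a'.reg 4 ∈ a'.set 2 :=
      (hx.lt_iff fun x hx => hn x (hsub hx)).1 (by simpa [h₀'] using hlt)
    have hltU := (hn _ (hsub hmem)).trans_le hU
    have hcard := card_erase_add_one hmem
    refine .seq (.of_dwp ⟨by lia, hltU, .seq (.of_dwp ⟨by lia, hltU, ?_⟩)⟩)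
    refine (runs_choice (n := n) 4 2 (by simpa using h₀')).frame (by lia)
      fun a₁ b₁ ⟨hoff₁, hx₁⟩ => ?_
    have h₁ := hoff₁.set 1 (by simp)
    have h₂ := hoff₁.set 2 (by simp)
    simp only [DictState.set_setSet_self, ne_eq, Fin.reduceEq, not_false_eq_true,
      DictState.set_setSet_of_ne, DictState.reg_setSet] at h₁ h₂ hx₁
    refine ⟨.trans ?_ (hoff₁.mono (by decide) (by decide)), ?_, ?_, ?_, ?_⟩
    · simpa using hoff
    · rw [← hunion, h₁, h₂, insert_union, ← union_insert, insert_erase hmem]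
    · rw [h₂]
      exact (erase_subset ..).trans hsub
    · rwa [h₂]
    · rw [h₂]
      lia
  · exact ⟨.refl a, rfl, Subset.rfl, h₄, le_rfl⟩
  · rintro a' b ⟨⟨hoff, hunion, hsub, hx, -⟩, hlt⟩
    have h₀' := (hoff.reg 0 (by decide)).trans h₀
    have hempty : a'.set 2 = ∅ := not_nonempty_iff_eq_empty.1 <|
      (hx.nonempty_iff fun x hx => hn x (hsub hx)).not.2 (by simpa [h₀'] using hlt)
    rw [hempty, union_empty] at hunion
    exact ⟨hoff, hunion, hempty⟩

end Choice

variable {w B n h : ℕ} {P : Params w B} {inp : List (BitVec w)} {G : SimpleGraph (Fin n)}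
  {root v : Fin n} {adj : Fin n → List (Fin n)} {a a' : DictState} {D : Finset (Fin n)}
  {rs : Finset (Fin 12)} {x : View n}

theorem lt_of_mem_nodes {y : ℕ} (hy : y ∈ nodes D) : y < n := by
  obtain ⟨u, -, rfl⟩ := mem_map.1 hy
  exact u.isLt

theorem IsChoice.exists_eq {y : ℕ} (hy : IsChoice n (nodes D) y) (hlt : y < n) :
    ∃ u ∈ D, y = u := by
  obtain ⟨u, hu, rfl⟩ := mem_map.1 ((hy.lt_iff fun _ => lt_of_mem_nodes).1 hlt)
  exact ⟨u, hu, rfl⟩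

theorem IsChoice.eq_empty {y : ℕ} (hy : IsChoice n (nodes D) y) (hlt : ¬ y < n) : D = ∅ := by
  rw [← hy.nonempty_iff fun _ => lt_of_mem_nodes, not_nonempty_iff_eq_empty] at hlt
  exact map_eq_empty.1 hlt

open Classical in
/-- The nodes of height less than `h`. -/
noncomputable def lowNodes (G : SimpleGraph (Fin n)) (root : Fin n) (h : ℕ) : Finset (Fin n) :=
  {v | height G root v < h}

@[simp] theorem mem_lowNodes : v ∈ lowNodes G root h ↔ height G root v < h := by
  simp [lowNodes]

theorem disjoint_level_lowNodes : Disjoint (level G root h) (lowNodes G root h) :=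
  disjoint_left.2 fun v => by simp +contextual

/-- The state between two calls of a client with the view `x`. The set `1` contains the level that
the next call of `next` returns, and the deleted nodes are those that have been returned before. -/
structure Idle (G : SimpleGraph (Fin n)) (root : Fin n) (adj : Fin n → List (Fin n)) (x : View n)
    (a : DictState) : Prop where
  std : Std root a
  client : a.set 0 = nodes x.S
  current : a.set 1 = nodes (level G root x.h)
  ready : a.set 2 = ∅
  deleted : a.set 3 = nodes (lowNodes G root x.h)
  counters : Counters G root adj (lowNodes G root x.h) (a.set 4)

theorem readyNodes_lowNodes (hG : G.IsTree) : readyNodes G root h (lowNodes G root h) = ∅ := by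
  ext v
  have := height_le_iff hG (root := root) (u := v) (h := h)
  grind [mem_readyNodes, mem_lowNodes]

theorem readyNodes_lowNodes_succ (hG : G.IsTree) :
    readyNodes G root h (lowNodes G root (h + 1)) = level G root (h + 1) := by
  ext v
  have := height_le_iff hG (root := root) (u := v) (h := h + 1)
  grind [mem_readyNodes, mem_lowNodes, mem_level]

theorem Idle.round (hG : G.IsTree) (hi : Idle G root adj x a) (h₀ : a'.set 0 = ∅)
    (hoff : EqOff rs {0} a a') (hrs : Disjoint rs {0, 1, 9} := by decide) :
    Round G root adj x.h (lowNodes G root x.h) a' where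
  std := hi.std.of_eqOff hoff hrs
  marks :=
    { mem_of_lt := fun v => mem_lowNodes.2
      le_of_mem := fun v hv => (mem_lowNodes.1 hv).le
      client := by rw [h₀, disjoint_iff_inter_eq_empty.1 disjoint_level_lowNodes]; rfl
      current := by
        rw [hoff.set 1 (by decide), hi.current, sdiff_eq_self_of_disjoint disjoint_level_lowNodes]
      deleted := (hoff.set 3 (by decide)).trans hi.deleted }
  tallies :=
    { ready := by rw [hoff.set 2 (by decide), hi.ready, readyNodes_lowNodes hG]; rfl
      counters := hoff.set 4 (by decide) ▸ hi.counters }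

theorem Round.of_eqOff (hr : Round G root adj h D a) (hoff : EqOff rs ∅ a a')
    (hrs : Disjoint rs {0, 1, 9} := by decide) : Round G root adj h D a' where
  std := hr.std.of_eqOff hoff hrs
  marks := hr.marks.of_eqOff hoff
  tallies := hr.tallies.congr (hoff.set 2 (by decide)) (hoff.set 4 (by decide))

theorem Marks.eq_lowNodes_succ (hm : Marks G root h D a) (hD : level G root h \ D = ∅) :
    D = lowNodes G root (h + 1) := by
  ext v
  have := hm.mem_of_lt v
  have := hm.le_of_mem v
  have : v ∈ level G root h → v ∈ D := fun hv => sdiff_eq_empty_iff_subset.1 hD hv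
  grind [mem_level, mem_lowNodes]

/-- Deletes the nodes of the current level; register `4` contains one of them. -/
def deleteLoop : DictProg :=
  .loop .lt (.reg 4) (.reg 0) (deleteProg ;;; .choice 4 1)

theorem runs_deleteLoop (hG : G.IsTree) (ha : IsAdjacencyList G adj) (hS : Setting P inp root adj)
    (hr : Round G root adj h (lowNodes G root h) a) (h₄ : IsChoice n (a.set 1) (a.reg 4)) :
    DRuns P inp deleteLoop a (potential adj (lowNodes G root h) a + 1) fun a' b' =>
      Round G root adj h (lowNodes G root (h + 1)) a' ∧ a'.set 1 = ∅ ∧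
        potential adj (lowNodes G root (h + 1)) a' + 900 * #(level G root h) ≤ b' := by
  refine .frame (DRuns.loop (I := fun a' b' => ∃ D, Round G root adj h D a' ∧
    IsChoice n (nodes (level G root h \ D)) (a'.reg 4) ∧
    potential adj D a' + 900 * #(level G root h ∩ D) + 1 ≤ b') trivial trivial ?_ ?_ ?_) le_rfl ?_
  · grind
  · rintro a' b ⟨D, hr', hx, hb⟩ hlt
    obtain ⟨u, hu, hx⟩ := hx.exists_eq (by simpa [hr'.std.size] using hlt)
    refine .seq ((runs_deleteProg hG ha hS hr' hu hx).frame (by lia) fun a₁ b₁ ⟨hr₁, hb₁⟩ => ?_)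
    refine (runs_choice 4 1 hr₁.std.size).frame (by grw [← hb₁]; lia) fun a₂ b₂ ⟨hoff, hx₂⟩ =>
      ⟨_, hr₁.of_eqOff hoff, hr₁.marks.current ▸ hx₂, ?_⟩
    have hcard : #(level G root h ∩ insert u D) ≤ #(level G root h ∩ D) + 1 := by
      rw [inter_insert_of_mem (mem_sdiff.1 hu).1]
      exact card_insert_le ..
    have hpot : potential adj (insert u D) a₂ = potential adj (insert u D) a₁ := by
      rw [potential, potential, hoff.set 2 (by decide), hoff.set 4 (by decide)]
    lia
  · refine ⟨_, hr, hr.marks.current ▸ h₄, ?_⟩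
    rw [disjoint_iff_inter_eq_empty.1 disjoint_level_lowNodes]
    rfl
  · rintro a' b ⟨⟨D, hr', hx, hb⟩, hlt⟩
    have hempty := hx.eq_empty (by simpa [hr'.std.size] using hlt)
    obtain rfl := hr'.marks.eq_lowNodes_succ hempty
    rw [inter_eq_left.2 (sdiff_eq_empty_iff_subset.1 hempty)] at hb
    exact ⟨hr', by rw [hr'.marks.current, hempty]; rfl, by lia⟩

/-- Makes the ready nodes the current level. -/
def ascendProg : DictProg :=
  .choice 4 2 ;;; moveLoop

theorem runs_ascendProg (hG : G.IsTree) (hS : Setting P inp root adj)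
    (hr : Round G root adj h (lowNodes G root (h + 1)) a) (h₁ : a.set 1 = ∅) :
    DRuns P inp ascendProg a (200 * #(a.set 2) + 41) fun a' _ =>
      Idle G root adj ⟨h + 1, level G root h⟩ a' ∧ a'.set 4 = a.set 4 := by
  refine .seq ((runs_choice 4 2 hr.std.size).frame (by lia) fun a₁ b₁ ⟨hoff₁, hx⟩ => ?_)
  have hr₁ := hr.of_eqOff hoff₁
  have h₁' := (hoff₁.set 1 (by decide)).trans h₁
  have h₂ := hoff₁.set 2 (by decide)
  have hready := hr₁.tallies.ready
  rw [readyNodes_lowNodes_succ hG] at hready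
  have hU := hS.U_le
  refine (runs_moveLoop hr₁.std.size (h₂ ▸ hx) (hready ▸ fun _ => lt_of_mem_nodes)
    (by lia)).frame (by lia) fun a₂ _ ⟨hoff₂, hcurrent, hempty⟩ =>
      ⟨⟨?_, ?_, ?_, hempty, ?_, ?_⟩, ?_⟩
  · exact hr₁.std.of_eqOff hoff₂
  · rw [hoff₂.set 0 (by decide), hr₁.marks.client, inter_eq_left.2]
    exact fun v => by simp +contextual
  · rw [hcurrent, h₁', hready, empty_union]
  · exact (hoff₂.set 3 (by decide)).trans hr₁.marks.deleted
  · exact hoff₂.set 4 (by decide) ▸ hr₁.tallies.counters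
  · exact (hoff₂.set 4 (by decide)).trans (hoff₁.set 4 (by decide))

/-- Returns the current level to the client, deletes it, and determines the level above it. -/
def nextProg : DictProg :=
  .clear 0 ;;; .choice 4 1 ;;; deleteLoop ;;; ascendProg

theorem runs_nextProg (hG : G.IsTree) (ha : IsAdjacencyList G adj) (hS : Setting P inp root adj)
    (hi : Idle G root adj x a) (hne : (level G root x.h).Nonempty) :
    DRuns P inp nextProg a (potential adj (lowNodes G root x.h) a + 500) fun a' b' =>
      Idle G root adj ⟨x.h + 1, level G root x.h⟩ a' ∧
        potential adj (lowNodes G root (x.h + 1)) a' + 500 ≤ b' := by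
  have hpos := hne.card_pos
  refine .seq (.of_dwp ⟨by lia, ?_⟩)
  refine .seq ((runs_choice (n := n) 4 1 (by simpa using hi.std.size)).frame (by lia)
    fun a₁ b₁ ⟨hoff₁, hx₁⟩ => ?_)
  have hoff₁' : EqOff {4} {0} a a₁ :=
    .trans (by simp [EqOff.refl]) (hoff₁.mono (by decide) (by decide))
  have hr₁ := hi.round hG (by simp [hoff₁.set 0]) hoff₁'
  have hpot : potential adj (lowNodes G root x.h) a₁ = potential adj (lowNodes G root x.h) a := by
    rw [potential, potential, hoff₁'.set 2 (by decide), hoff₁'.set 4 (by decide)]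
  refine .seq ((runs_deleteLoop hG ha hS hr₁ (by simpa [hoff₁.set] using hx₁)).frame
    (by lia) fun a₂ b₂ ⟨hr₂, h₁, hb₂⟩ => ?_)
  have hpot₂ : potential adj (lowNodes G root (x.h + 1)) a₂ = _ + _ + _ := rfl
  refine (runs_ascendProg hG hS hr₂ h₁).frame (by grw [← hb₂]; lia) fun a₃ b₃ ⟨hi₃, h₄⟩ => ⟨hi₃, ?_⟩
  rw [potential, hi₃.ready, h₄, card_empty]
  lia

end HeightIterator

/-! ### Initialization -/

namespace HeightIterator

open Finset WordRAM DictMachine RootedTree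

attribute [local simp] dwp Operand.Fits DictState.val BinOp.Fits BinOp.val Cmp.HoldsNat

variable {w B n k : ℕ} {P : Params w B} {inp : List (BitVec w)} {G : SimpleGraph (Fin n)}
  {root u : Fin n} {adj : Fin n → List (Fin n)} {a a' : DictState}

/-- The nodes less than `k` have been initialized: the set `1` contains those without children, and
the counters of the others are stored. -/
structure Prepared (G : SimpleGraph (Fin n)) (root : Fin n) (adj : Fin n → List (Fin n)) (k : ℕ)
    (a : DictState) : Prop where
  mem_leaves : ∀ y, y ∈ a.set 1 ↔ ∃ v : Fin n, (v : ℕ) = y ∧ y < k ∧ children G root v = ∅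
  lt_offset : ∀ e ∈ a.set 4, e < offset adj k
  storesAt : ∀ v : Fin n, (v : ℕ) < k → (children G root v).Nonempty →
    StoresAt (a.set 4) (offset adj v) (adj v).length (#(children G root v) - 1)

namespace Prepared

theorem zero (h₁ : a.set 1 = ∅) (h₄ : a.set 4 = ∅) : Prepared G root adj 0 a := by
  constructor <;> simp [h₁, h₄]

theorem congr (hp : Prepared G root adj k a) (h₁ : a'.set 1 = a.set 1)
    (h₄ : a'.set 4 = a.set 4) : Prepared G root adj k a' :=
  ⟨h₁ ▸ hp.mem_leaves, h₄ ▸ hp.lt_offset, h₄ ▸ hp.storesAt⟩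

theorem succ_of_eq_empty (hp : Prepared G root adj u a) (hu : children G root u = ∅)
    (h₁ : a'.set 1 = insert (u : ℕ) (a.set 1)) (h₄ : a'.set 4 = a.set 4) :
    Prepared G root adj (u + 1) a' where
  mem_leaves y := by
    rw [h₁, mem_insert, hp.mem_leaves]
    constructor
    · rintro (rfl | ⟨v, rfl, hv, hv'⟩)
      · exact ⟨u, rfl, by lia, hu⟩
      · exact ⟨v, rfl, by lia, hv'⟩
    · rintro ⟨v, rfl, hv, hv'⟩
      exact (Nat.lt_succ_iff_lt_or_eq.1 hv).symm.imp_right fun hlt => ⟨v, rfl, hlt, hv'⟩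
  lt_offset e he := (hp.lt_offset e (h₄ ▸ he)).trans_le (offset_mono adj (Nat.le_succ _))
  storesAt v hv hne := by
    obtain hlt | heq := Nat.lt_succ_iff_lt_or_eq.1 hv
    · exact h₄ ▸ hp.storesAt v hlt hne
    · exact absurd (Fin.ext heq ▸ hu) hne.ne_empty

theorem succ_of_nonempty (hp : Prepared G root adj u a) (hu : (children G root u).Nonempty)
    (h₁ : a'.set 1 = a.set 1)
    (h₄ : ∀ e, e ∈ a'.set 4 ↔ e ∈ a.set 4 ∨ ∃ i < (adj u).length, offset adj u + i = e ∧
      (#(children G root u) - 1).testBit i = true) :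
    Prepared G root adj (u + 1) a' where
  mem_leaves y := by
    rw [h₁, hp.mem_leaves]
    refine exists_congr fun v => and_congr_right ?_
    rintro rfl
    have hne : children G root v = ∅ → (v : ℕ) ≠ u := fun hv heq =>
      hu.ne_empty (Fin.ext heq ▸ hv)
    grind
  lt_offset e he := by
    rw [offset_succ]
    have := hp.lt_offset e
    grind
  storesAt v hv hne i hi := by
    rw [h₄]
    obtain hlt | heq := Nat.lt_succ_iff_lt_or_eq.1 hv
    · rw [← hp.storesAt v hlt hne i hi, or_iff_left]
      rintro ⟨j, hj, heq, -⟩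
      exact hlt.ne (congrArg Fin.val (eq_of_offset_add_eq hi hj heq.symm))
    · obtain rfl := Fin.ext heq
      have := hp.lt_offset (offset adj v + i)
      grind

end Prepared

theorem one_le_length_adj (hG : G.IsTree) (ha : IsAdjacencyList G adj) (hu : u ≠ root) :
    1 ≤ (adj u).length := by
  obtain ⟨p, hp, -⟩ := exists_parent hG hu
  exact List.length_pos_of_mem (((ha u).2 p).2 (mem_children.1 hp).1.symm)

/-- Counts the children of the node in register `4`. -/
def countChildrenProg : DictProg :=
  rangeProg 4 ;;;
  .op 10 .sub (.reg 7) (.reg 6) ;;;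
  .ite .eq (.reg 4) (.reg 1) .skip (.op 10 .sub (.reg 10) (.lit 1))

theorem runs_countChildrenProg (hG : G.IsTree) (ha : IsAdjacencyList G adj)
    (hS : Setting P inp root adj) (h₁ : a.reg 1 = root) (h₄ : a.reg 4 = u) :
    DRuns P inp countChildrenProg a 7 fun a' _ => EqOff {6, 7, 10, 11} ∅ a a' ∧
      a'.reg 6 = offset adj u ∧ a'.reg 7 = offset adj u + (adj u).length ∧
      a'.reg 10 = #(children G root u) := by
  refine .seq ((runs_rangeProg hS h₄).frame (by lia) fun a₁ b₁ ⟨hoff, h₆, h₇⟩ => ?_)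
  have h₁' := (hoff.reg 1 (by decide)).trans h₁
  have h₄' := (hoff.reg 4 (by decide)).trans h₄
  have hcard := card_children hG ha (root := root) u
  have hle := one_le_length_adj hG ha (u := u) (root := root)
  have hoff' : EqOff {6, 7, 10, 11} ∅ a a₁ := hoff.mono (by decide) (by decide)
  have hw := P.one_lt_two_pow
  refine .frame (m := 3) (.of_dwp ?_) (by lia) fun _ _ => id
  by_cases hu : u = root <;> simp_all [Fin.val_inj]

/-- Stores the counter of the node in register `4`, or inserts the node into the lowest level if it
has no children. -/
def storeCounterProg : DictProg :=
  .ite .eq (.reg 10) (.lit 0) (.insert 1 4) (.op 10 .sub (.reg 10) (.lit 1) ;;; fillLoop)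

theorem runs_storeCounterProg (hS : Setting P inp root adj) (hp : Prepared G root adj u a)
    (h₄ : a.reg 4 = u) (h₆ : a.reg 6 = offset adj u)
    (h₇ : a.reg 7 = offset adj u + (adj u).length) (h₁₀ : a.reg 10 = #(children G root u)) :
    DRuns P inp storeCounterProg a (45 * (adj u).length + 41) fun a' _ =>
      EqOff {6, 10, 11} {1, 4} a a' ∧ Prepared G root adj (u + 1) a' := by
  have hU := hS.lt_U u
  have hw := P.one_lt_two_pow
  refine .ite (by lia) trivial (by simp) (fun hc => ?_) fun hc => ?_
  · have hu : children G root u = ∅ := by simpa [h₁₀] using hc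
    have hp' : Prepared G root adj (u + 1) (a.setSet 1 (insert (u : ℕ) (a.set 1))) :=
      hp.succ_of_eq_empty hu (by simp) (by simp)
    refine .frame (m := 40) (.of_dwp ?_) (by lia) fun _ _ => id
    simp [h₄, hU, hp', EqOff.refl]
  · have hu : (children G root u).Nonempty := by
      simpa [h₁₀, nonempty_iff_ne_empty] using hc
    have hle := hu.card_pos
    have hlt := hS.lt_two_pow
    have hoU := hS.offset_le.trans hS.U_le
    have hseg := offset_add_length_le adj u
    refine .seq (.of_dwp ⟨by lia, trivial, hw, by simpa [h₁₀] using hle, ?_⟩)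
    refine (runs_fillLoop (o := offset adj u) (l := (adj u).length)
      (x := #(children G root u) - 1) (by simpa using h₆) (by simpa using h₇) (by simp [h₁₀])
      (by lia) (by lia)).frame (by lia) fun a₁ _ ⟨hoff, hmem⟩ => ⟨?_, ?_⟩
    · exact .trans (by simp [EqOff.refl]) (hoff.mono (by decide) (by decide))
    · exact hp.succ_of_nonempty hu (hoff.set 1 (by decide)) hmem

/-- Prepares the nodes from the one in register `4` on. -/
def prepareLoop : DictProg :=
  .loop .lt (.reg 4) (.reg 0)
    (countChildrenProg ;;; storeCounterProg ;;; .op 4 .add (.reg 4) (.lit 1))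

theorem runs_prepareLoop (hG : G.IsTree) (ha : IsAdjacencyList G adj)
    (hS : Setting P inp root adj) (hstd : Std root a) (h₄ : a.reg 4 = 0)
    (hp : Prepared G root adj 0 a) :
    DRuns P inp prepareLoop a (100 * n + 50 * offset adj n + 1) fun a' _ =>
      EqOff {4, 6, 7, 10, 11} {1, 4} a a' ∧ Prepared G root adj n a' := by
  refine .frame (DRuns.loop (I := fun a' b' => EqOff {4, 6, 7, 10, 11} {1, 4} a a' ∧
    ∃ k ≤ n, a'.reg 4 = k ∧ Prepared G root adj k a' ∧
      100 * (n - k) + 50 * (offset adj n - offset adj k) + 1 ≤ b')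
    trivial trivial ?_ ?_ ?_) le_rfl ?_
  · grind
  · rintro a' b ⟨hoff, k, -, h₄', hp', hb⟩ hlt
    have hstd' := hstd.of_eqOff hoff
    obtain ⟨u, rfl⟩ : ∃ u : Fin n, (u : ℕ) = k := ⟨⟨k, by simpa [h₄', hstd'.size] using hlt⟩, rfl⟩
    have hseg := offset_add_length_le adj u
    have hsucc := offset_succ adj u
    have hn : n < 2 ^ w := by have := hS.lt_two_pow; lia
    have hw := P.one_lt_two_pow
    refine .seq ((runs_countChildrenProg hG ha hS hstd'.root_eq h₄').frame (by lia)
      fun a₁ b₁ ⟨hoff₁, h₆, h₇, h₁₀⟩ => ?_)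
    have h₄₁ := (hoff₁.reg 4 (by decide)).trans h₄'
    have hp₁ := hp'.congr (hoff₁.set 1 (by decide)) (hoff₁.set 4 (by decide))
    refine .seq ((runs_storeCounterProg hS hp₁ h₄₁ h₆ h₇ h₁₀).frame (by lia)
      fun a₂ b₂ ⟨hoff₂, hp₂⟩ => ?_)
    have h₄₂ := (hoff₂.reg 4 (by decide)).trans h₄₁
    refine .of_dwp ⟨by lia, trivial, hw, by simp [h₄₂]; lia, ?_, u + 1, u.isLt, ?_, ?_, by lia⟩
    · simpa using (hoff.trans (hoff₁.mono (by decide) (by decide))).trans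
        (hoff₂.mono (by decide) (by decide))
    · simp [h₄₂]
    · exact hp₂.congr (by simp) (by simp)
  · exact ⟨.refl a, 0, n.zero_le, h₄, hp, by lia⟩
  · rintro a' b ⟨⟨hoff, k, hk, h₄', hp', -⟩, hlt⟩
    have hstd' := hstd.of_eqOff hoff
    have hkn : ¬ k < n := by simpa [h₄', hstd'.size] using hlt
    obtain rfl : k = n := by lia
    exact ⟨hoff, hp'⟩

theorem Prepared.idle (hG : G.IsTree) (hp : Prepared G root adj n a) (hstd : Std root a)
    (h₀ : a.set 0 = ∅) (h₂ : a.set 2 = ∅) (h₃ : a.set 3 = ∅) : Idle G root adj ⟨0, ∅⟩ a where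
  std := hstd
  client := h₀
  current := by
    ext y
    have hmem (v : Fin n) : v ∈ level G root 0 ↔ children G root v = ∅ := by
      rw [mem_level, ← Nat.le_zero, height_le_iff hG, eq_empty_iff_forall_notMem]
      simp
    rw [hp.mem_leaves, nodes, mem_map]
    refine exists_congr fun v => ⟨?_, ?_⟩
    · rintro ⟨rfl, -, hv⟩
      exact ⟨(hmem v).2 hv, rfl⟩
    · rintro ⟨hv, rfl⟩
      exact ⟨rfl, v.isLt, (hmem v).1 hv⟩
  ready := h₂
  deleted := by
    rw [h₃, eq_comm, nodes, map_eq_empty]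
    simp [lowNodes]
  counters p hne := by
    have hlow : lowNodes G root 0 = ∅ := by simp [lowNodes]
    rw [hlow, sdiff_empty] at hne ⊢
    exact hp.storesAt p p.isLt hne

/-- Determines the root and the address of the first list of neighbors, and starts at the node
`0`. -/
def startProg : DictProg :=
  .read 1 (.lit 1) ;;; .op 9 .add (.reg 0) (.lit 3) ;;; .op 4 .add (.lit 0) (.lit 0)

theorem runs_startProg (hS : Setting P inp root adj) (h₀ : a.reg 0 = n) :
    DRuns P inp startProg a 3 fun a' _ => EqOff {1, 4, 9} ∅ a a' ∧ Std root a' ∧ a'.reg 4 = 0 := by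
  have hn : n + 3 < 2 ^ w := by have := hS.lt_two_pow; lia
  have hroot := encode_root root adj
  have hw := P.one_lt_two_pow
  have h3 := P.lt_two_pow_of_lt_sixteen (i := 3)
  refine .of_dwp ?_
  simp_all [startProg, hS.inp_eq, EqOff.refl, Std.mk]

/-- Initializes the iterator. -/
def initProg : DictProg :=
  startProg ;;; prepareLoop

theorem runs_initProg (hG : G.IsTree) (ha : IsAdjacencyList G adj) (hS : Setting P inp root adj)
    (h₀ : a.reg 0 = n) (hset : ∀ d, a.set d = ∅) :
    DRuns P inp initProg a (200 * n + 4) fun a' _ => Idle G root adj ⟨0, ∅⟩ a' := by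
  have hle := hS.offset_le
  refine .seq ((runs_startProg hS h₀).frame (by lia) fun a₁ b₁ ⟨hoff₁, hstd, h₄⟩ => ?_)
  have hset₁ (d : Fin 5) : a₁.set d = ∅ := (hoff₁.set d (notMem_empty d)).trans (hset d)
  refine (runs_prepareLoop hG ha hS hstd h₄ (.zero (hset₁ 1) (hset₁ 4))).frame (by lia)
    fun a₂ _ ⟨hoff₂, hp⟩ => ?_
  have hset₂ (d : Fin 5) (hd : d ∉ ({1, 4} : Finset (Fin 5))) : a₂.set d = ∅ :=
    (hoff₂.set d hd).trans (hset₁ d)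
  exact hp.idle hG (hstd.of_eqOff hoff₂) (hset₂ 0 (by decide)) (hset₂ 2 (by decide))
    (hset₂ 3 (by decide))

end HeightIterator

/-! ### The calls of a client -/

namespace HeightIterator

open Finset WordRAM DictMachine RootedTree

attribute [local simp] dwp Operand.Fits DictState.val BinOp.Fits BinOp.val Cmp.HoldsNat

variable {w B n : ℕ} {P : Params w B} {inp : List (BitVec w)} {G : SimpleGraph (Fin n)}
  {root v : Fin n} {adj : Fin n → List (Fin n)} {a a' : DictState} {x : View n} {c : Call n}
  {σ : State 25 20 w}

theorem Idle.of_eqOff {rs : Finset (Fin 12)} {S : Finset (Fin n)} (hi : Idle G root adj x a)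
    (hoff : EqOff rs {0} a a') (h₀ : a'.set 0 = nodes S)
    (hrs : Disjoint rs {0, 1, 9} := by decide) : Idle G root adj ⟨x.h, S⟩ a' where
  std := hi.std.of_eqOff hoff hrs
  client := h₀
  current := (hoff.set 1 (by decide)).trans hi.current
  ready := (hoff.set 2 (by decide)).trans hi.ready
  deleted := (hoff.set 3 (by decide)).trans hi.deleted
  counters := hoff.set 4 (by decide) ▸ hi.counters

/-- Writes the truth value that there is a next level to register `3`. -/
def hasNextProg : DictProg :=
  .choice 4 1 ;;;
  .ite .lt (.reg 4) (.reg 0) (.op 3 .add (.lit 1) (.lit 0)) (.op 3 .add (.lit 0) (.lit 0))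

theorem runs_hasNextProg (hi : Idle G root adj x a) :
    DRuns P inp hasNextProg a 100 fun a' _ => EqOff {2, 3, 4} ∅ a a' ∧
      CorrectAnswer G root x .hasNext (BitVec.ofNat w (a'.reg 3)) := by
  refine .seq ((runs_choice 4 1 hi.std.size).frame (by lia) fun a₁ b₁ ⟨hoff, hx⟩ => ?_)
  have hoff' : EqOff {2, 3, 4} ∅ a a₁ := hoff.mono (by decide) (by decide)
  have h₀ := (hoff.reg 0 (by decide)).trans hi.std.size
  have hlevel : a₁.reg 4 < n ↔ (level G root x.h).Nonempty := by
    rw [← hx.nonempty_iff (hi.current ▸ fun _ => lt_of_mem_nodes), hi.current, nodes, map_nonempty]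
  have hw := P.one_lt_two_pow
  refine .frame (m := 2) (.of_dwp ?_) (by lia) fun _ _ => id
  simp_all [CorrectAnswer]

/-- Writes the truth value that the node in register `2` is in the set of the client to
register `3`. -/
def containsProg : DictProg :=
  .ifMem 0 2 (.op 3 .add (.lit 1) (.lit 0)) (.op 3 .add (.lit 0) (.lit 0))

theorem runs_containsProg (hS : Setting P inp root adj) (hi : Idle G root adj x a)
    (h₂ : a.reg 2 = v) :
    DRuns P inp containsProg a 100 fun a' _ => EqOff {2, 3, 4} ∅ a a' ∧
      CorrectAnswer G root x (.contains v) (BitVec.ofNat w (a'.reg 3)) := by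
  have hU := hS.lt_U v
  have hw := P.one_lt_two_pow
  have hclient := hi.client
  refine .of_dwp ?_
  simp_all [containsProg, CorrectAnswer, EqOff.refl]

/-- The program that serves a call. -/
def callProg : Call n → DictProg
  | .hasNext => hasNextProg
  | .next => nextProg
  | .add _ => .insert 0 2
  | .remove _ => .erase 0 2
  | .contains _ => containsProg
  | .choice => .choice 3 0
  | .clear => .clear 0

/-- The state after the client has put the argument of a call into register `2`. -/
def passed (a : DictState) : Call n → DictState
  | .add v => a.setReg 2 v
  | .remove v => a.setReg 2 v
  | .contains v => a.setReg 2 v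
  | _ => a

theorem eqOff_passed (a : DictState) (c : Call n) : EqOff {2, 3, 4} {0} a (passed a c) := by
  cases c <;> simp [passed, EqOff.refl]

theorem View.after_h_of_ne_next (hc : c ≠ .next) : (x.after G root c).h = x.h := by
  cases c <;> first | rfl | contradiction

theorem IsChoice.correctAnswer {y : ℕ} (hy : IsChoice n (nodes x.S) y) :
    CorrectAnswer G root x .choice (BitVec.ofNat w y) := by
  obtain hy | ⟨hS, rfl⟩ := hy
  · obtain ⟨v, hv, rfl⟩ := mem_map.1 hy
    exact .inl ⟨v, hv, rfl⟩
  · exact .inr ⟨map_eq_empty.1 hS, rfl⟩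

theorem runs_callProg (hS : Setting P inp root adj) (hi : Idle G root adj x a) (hc : c ≠ .next) :
    DRuns P inp (callProg c) (passed a c) 100 fun a' _ =>
      EqOff {2, 3, 4} {0} (passed a c) a' ∧ a'.set 0 = nodes (x.after G root c).S ∧
        CorrectAnswer G root x c (BitVec.ofNat w (a'.reg 3)) := by
  have hclient := hi.client
  cases c with
  | hasNext =>
    exact (runs_hasNextProg hi).frame le_rfl fun a' _ ⟨hoff, hans⟩ =>
      ⟨hoff.mono Subset.rfl (by decide), (hoff.set 0 (by decide)).trans hclient, hans⟩
  | next => contradiction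
  | add v =>
    have hU := hS.lt_U v
    refine .frame (m := 40) (.of_dwp ?_) (by lia) fun _ _ => id
    simp [callProg, passed, View.after, CorrectAnswer, EqOff.refl, hU, hclient, nodes_insert]
  | remove v =>
    have hU := hS.lt_U v
    refine .frame (m := 40) (.of_dwp ?_) (by lia) fun _ _ => id
    simp [callProg, passed, View.after, CorrectAnswer, EqOff.refl, hU, hclient, nodes_erase]
  | contains v =>
    have hoff₁ : EqOff {2} {0} a (passed a (.contains v)) := by simp [passed, EqOff.refl]
    refine (runs_containsProg hS (hi.of_eqOff hoff₁ hclient) (v := v)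
      (by simp [passed])).frame le_rfl fun a' _ ⟨hoff, hans⟩ => ?_
    exact ⟨hoff.mono Subset.rfl (by decide), (hoff.set 0 (by decide)).trans hclient, hans⟩
  | choice =>
    exact (runs_choice 3 0 hi.std.size).frame (by lia) fun a' _ ⟨hoff, hx⟩ =>
      ⟨hoff.mono (by decide) (by decide), (hoff.set 0 (by decide)).trans hclient,
        (hclient ▸ hx).correctAnswer⟩
  | clear =>
    refine .frame (m := 40) (.of_dwp ?_) (by lia) fun _ _ => id
    simp [callProg, passed, View.after, CorrectAnswer, EqOff.refl, nodes]

/-- The implementation of the iterator. -/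
def impl : Impl where
  r := 25
  k := 20
  arg := user 2
  res := user 3
  init := setupProg ;; initProg.compile
  hasNext := hasNextProg.compile
  next := nextProg.compile
  add := (DictProg.insert 0 2).compile
  remove := (DictProg.erase 0 2).compile
  contains := containsProg.compile
  choice := (DictProg.choice 3 0).compile
  clear := (DictProg.clear 0).compile

theorem compile_callProg (c : Call n) : (callProg c).compile = impl.prog c := by
  cases c <;> rfl

theorem rel_passed (hn : n < 2 ^ w) (hσ : Rel P σ a) (c : Call n) :
    Rel P (impl.pass σ c) (passed a c) := by
  have hset (v : Fin n) :
      Rel P (σ.setReg (user 2) (BitVec.ofNat w v)) (a.setReg 2 v) :=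
    hσ.setReg 2 (by rw [BitVec.toNat_ofNat, Nat.mod_eq_of_lt (v.isLt.trans hn)])
  cases c <;> first | exact hset _ | exact hσ

theorem regs_user (hσ : Rel P σ a) (i : Fin 12) : σ.regs (user i) = BitVec.ofNat w (a.reg i) := by
  obtain ⟨ν, hν, ha⟩ := hσ
  rw [← ha.user, ← hν.reg, BitVec.ofNat_toNat, BitVec.setWidth_eq]

/-- The implementation serves the call `c` in the state `σ`, with the result `σ'` after `t` steps,
and the state `a'` of the iterator. A call of `next` is paid for with the potential. -/
structure Serves (P : Params w B) (inp : List (BitVec w)) (G : SimpleGraph (Fin n)) (root : Fin n)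
    (adj : Fin n → List (Fin n)) (x : View n) (c : Call n) (σ : State 25 20 w) (a : DictState)
    (σ' : State 25 20 w) (t : ℕ) (a' : DictState) : Prop where
  exec : Exec inp B (impl.prog c) (impl.pass σ c) σ' t
  rel : Rel P σ' a'
  idle : Idle G root adj (x.after G root c) a'
  correct : CorrectAnswer G root x c (σ'.regs (user 3))
  time_le : c ≠ .next → t ≤ 100
  potential_le :
    (if c = .next then t else 0) + potential adj (lowNodes G root (x.after G root c).h) a' ≤
      potential adj (lowNodes G root x.h) a

theorem exists_serves_next (hG : G.IsTree) (ha : IsAdjacencyList G adj)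
    (hS : Setting P inp root adj) (hne : (level G root x.h).Nonempty) (hσ : Rel P σ a)
    (hi : Idle G root adj x a) : ∃ σ' t a', Serves P inp G root adj x .next σ a σ' t a' := by
  obtain ⟨σ', t, a', b', hexec, hσ', hle, hi', hb'⟩ := runs_nextProg hG ha hS hi hne σ hσ
  exact ⟨σ', t, a', hexec, hσ', hi', trivial, fun h => absurd rfl h, by
    rw [if_pos rfl, View.after]; lia⟩

theorem exists_serves_of_ne_next (hS : Setting P inp root adj) (hc : c ≠ .next) (hσ : Rel P σ a)
    (hi : Idle G root adj x a) : ∃ σ' t a', Serves P inp G root adj x c σ a σ' t a' := by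
  have hn : n < 2 ^ w := by have := hS.lt_two_pow; lia
  obtain ⟨σ', t, a', b', hexec, hσ', hle, hoff, h₀, hans⟩ :=
    runs_callProg hS hi hc _ (rel_passed hn hσ c)
  have hoff' := (eqOff_passed a c).trans hoff
  have hh := View.after_h_of_ne_next (G := G) (root := root) (x := x) hc
  have hi' := hi.of_eqOff hoff' h₀
  rw [← hh] at hi'
  refine ⟨σ', t, a', compile_callProg c ▸ hexec, hσ', hi', regs_user hσ' 3 ▸ hans,
    fun _ => by lia, ?_⟩
  rw [if_neg hc, zero_add, hh, potential, potential, hoff'.set 2 (by decide),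
    hoff'.set 4 (by decide)]

theorem exists_session (hG : G.IsTree) (ha : IsAdjacencyList G adj) (hS : Setting P inp root adj)
    {calls : List (Call n)} (hc : AllPermitted G root x calls) (hσ : Rel P σ a)
    (hi : Idle G root adj x a) :
    ∃ events : List (Event n w), events.map (fun e => e.call) = calls ∧
      Session impl inp B σ events ∧ AllCorrect G root x events ∧
      (∀ e ∈ events, e.call ≠ .next → e.time ≤ 100) ∧
      ((events.filter fun e => e.call = .next).map fun e => e.time).sum ≤
        potential adj (lowNodes G root x.h) a := by
  induction calls generalizing x σ a with
  | nil => exact ⟨[], rfl, Session.nil (I := impl) σ, trivial, by simp, by simp⟩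
  | cons c cs ih =>
    obtain ⟨σ', t, a', hs⟩ : ∃ σ' t a', Serves P inp G root adj x c σ a σ' t a' := by
      obtain rfl | hne := eq_or_ne c .next
      · exact exists_serves_next hG ha hS hc.1 hσ hi
      · exact exists_serves_of_ne_next hS hne hσ hi
    obtain ⟨events, rfl, hsession, hcorrect, htime, hsum⟩ := ih hc.2 hs.rel hs.idle
    refine ⟨⟨c, σ'.regs (user 3), t⟩ :: events, rfl, .cons hs.exec hsession,
      ⟨hs.correct, hcorrect⟩, List.forall_mem_cons.2 ⟨hs.time_le, htime⟩, ?_⟩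
    grw [← hs.potential_le, ← hsum]
    by_cases h : c = .next <;> simp [h]

end HeightIterator

namespace HeightIterator

open WordRAM RootedTree DictMachine Finset

variable {w n : ℕ} {root : Fin n} {adj : Fin n → List (Fin n)} {G : SimpleGraph (Fin n)}

theorem four_le_of_mul_le_two_pow (hn : 1 ≤ n) (hw : 0 < w) (h : (3 * n + 1) * w ≤ 2 ^ w) :
    4 ≤ w := by
  by_contra! hlt
  have h4 : 4 * w ≤ 2 ^ w := h.trans' (Nat.mul_le_mul_right w (by lia))
  interval_cases w <;> lia

theorem length_encode_of_isTree (hG : G.IsTree) (ha : IsAdjacencyList G adj) :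
    (encode root adj).length = 3 * n + 1 := by
  have hsum := sum_length_adj hG ha
  rw [length_encode, offset_eq_sum]
  lia

theorem setting_mkParams (hG : G.IsTree) (ha : IsAdjacencyList G adj) (hw : 4 ≤ w)
    (hnw : 2 * n + w < 2 ^ w) (hlt : 3 * n + 1 < 2 ^ w) :
    Setting (mkParams n w hw hnw) (inputWords w root adj) root adj where
  inp_eq := map_toNat_inputWords fun x hx => by
    have hle := le_of_mem_encode hx
    have hsum := sum_length_adj hG ha
    rw [offset_eq_sum] at hle
    lia
  lt_two_pow := by
    rwa [← length_encode root, length_encode_of_isTree hG ha]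
  offset_le := by
    rw [offset_eq_sum, ← sum_length_adj hG ha]
    exact Nat.le_add_right _ _
  U_le := le_mkParams_U hw hnw

theorem potential_lowNodes_zero_le (hG : G.IsTree) (ha : IsAdjacencyList G adj)
    {a : DictState} (h₂ : a.set 2 = ∅) : potential adj (lowNodes G root 0) a ≤ 3000 * n := by
  have hsum := sum_length_adj hG ha
  have hlow : lowNodes G root 0 = ∅ := by simp [lowNodes]
  have hweight : weight adj ∅ = 50 * ∑ u, (adj u).length + 2000 * n := by
    simp [weight, sum_add_distrib, mul_sum, mul_comm]
  have hcard : #(range (offset adj n) \ a.set 4) ≤ ∑ u, (adj u).length := by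
    rw [← offset_eq_sum, ← card_range (offset adj n)]
    exact (card_le_card sdiff_subset).trans (by rw [card_range])
  rw [potential, hlow, hweight, h₂, card_empty]
  lia

theorem exists_init (hG : G.IsTree) (ha : IsAdjacencyList G adj) (hw : 4 ≤ w)
    (hnw : 2 * n + w < 2 ^ w) (hlt : 3 * n + 1 < 2 ^ w) (σ₀ : State 25 20 w) :
    ∃ σ₁ t a, Exec (inputWords w root adj) (numWords n w) impl.init σ₀ σ₁ t ∧ t ≤ 3000 * n ∧
      Rel (mkParams n w hw hnw) σ₁ a ∧ Idle G root adj ⟨0, ∅⟩ a := by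
  have hn := root.pos
  have hS : Setting _ (inputWords w root adj) root adj := setting_mkParams hG ha hw hnw hlt
  have hσ₀ : Represents σ₀
      ⟨fun i => (σ₀.regs i).toNat, fun b x => (σ₀.mem b (BitVec.ofNat w x)).toNat⟩ :=
    ⟨fun _ => rfl, fun b x => by simp⟩
  obtain ⟨σ, t, ν, b, hsetup, hσν, htb, h₀, hν⟩ :=
    runs_setupProg hw hnw (hS.inp_eq ▸ encode_zero root adj) σ₀ hσ₀
  obtain ⟨σ₁, t', a, b', hinit, hσ₁, htb', hi⟩ :=
    runs_initProg hG ha hS h₀ (fun _ => rfl) σ ⟨ν, hσν, hν⟩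
  exact ⟨σ₁, t + t', a, .seq hsetup hinit, by lia, hσ₁, hi⟩

end HeightIterator

theorem mainTheorem7 :
    ∃ (I : HeightIterator.Impl) (C : ℕ),
      ∀ (n : ℕ) (G : SimpleGraph (Fin n)) (root : Fin n) (adj : Fin n → List (Fin n)),
        G.IsTree → RootedTree.IsAdjacencyList G adj →
      ∀ w : ℕ, 0 < w → (RootedTree.encode root adj).length * w ≤ 2 ^ w →
      ∃ B : ℕ, (I.r + I.k * B) * w ≤ C * (n + w) ∧
      ∀ σ₀ : WordRAM.State I.r I.k w,
      ∃ (σ₁ : WordRAM.State I.r I.k w) (t₀ : ℕ),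
        WordRAM.Exec (RootedTree.inputWords w root adj) B I.init σ₀ σ₁ t₀ ∧
        t₀ ≤ C * n ∧
        ∀ calls : List (HeightIterator.Call n),
          HeightIterator.AllPermitted G root ⟨0, ∅⟩ calls →
          ∃ events : List (HeightIterator.Event n w),
            events.map (fun e => e.call) = calls ∧
            HeightIterator.Session I (RootedTree.inputWords w root adj) B σ₁ events ∧
            HeightIterator.AllCorrect G root ⟨0, ∅⟩ events ∧
            (∀ e ∈ events, e.call ≠ HeightIterator.Call.next → e.time ≤ C) ∧
            ((events.filter fun e => e.call = HeightIterator.Call.next).map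
              fun e => e.time).sum ≤ C * n := by
  refine ⟨HeightIterator.impl, 3000, fun n G root adj hG ha w hw hle => ?_⟩
  have hn : 1 ≤ n := root.pos
  rw [HeightIterator.length_encode_of_isTree hG ha] at hle
  have hw₄ := HeightIterator.four_le_of_mul_le_two_pow hn hw hle
  have hnw : 2 * n + w < 2 ^ w := by nlinarith
  have hlt : 3 * n + 1 < 2 ^ w := by nlinarith
  refine ⟨DictMachine.numWords n w, ?_, fun σ₀ => ?_⟩
  · have hB := DictMachine.numWords_mul_le n w
    change (25 + 20 * DictMachine.numWords n w) * w ≤ 3000 * (n + w)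
    lia
  · obtain ⟨σ₁, t₀, a, hexec, ht₀, hσ₁, hi⟩ :=
      HeightIterator.exists_init hG ha hw₄ hnw hlt σ₀
    refine ⟨σ₁, t₀, hexec, ht₀, fun calls hcalls => ?_⟩
    obtain ⟨events, hcall, hsession, hcorrect, htime, hsum⟩ := HeightIterator.exists_session hG ha
      (HeightIterator.setting_mkParams hG ha hw₄ hnw hlt) hcalls hσ₁ hi
    exact ⟨events, hcall, hsession, hcorrect, fun e he hne => (htime e he hne).trans (by norm_num),
      hsum.trans (HeightIterator.potential_lowNodes_zero_le hG ha hi.ready)⟩
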